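/- Let $(y_{m,n})_{n\in\mathbb Z}$, $m\ge 1$, be mutually independent, stationary, zero-mean (circular) complex Gaussian time series, i.e. every finite complex linear combination of the $y_{m,n}$, $n\in\mathbb Z$, has independent $\mathcal N(0,v/2)$ real and imaginary parts for some $v\ge 0$. Let $r_m(u)=\mathbb E[y_{m,n+u}\overline{y_{m,n}}]$ and $s_m(\nu)=\sum_{u\in\mathbb Z} r_m(u)e^{-2i\pi u\nu}$, and assume $$\sup_{m\ge1}\sum_{u\in\mathbb Z}(1+|u|)\,|r_m(u)|<+\infty,\qquad \inf_{m\ge1}\min_{\nu\in[0,1]}s_m(\nu)>0 .$$ Let $M=M(N)$ and $B=B(N)$ be integers, $B$ even, such that for some constants $C_1,C_2>0$ and $\rho\in(0,1)$ one has $C_1N^\rho\le B,M\le C_2N^\rho$ for all large $N$, and $M/B\to c$ for some $c\in(0,+\infty)$. Let $\epsilon_{m,n}$ be the normalized innovation of $y_m$ at time $n$, i.e. $y_{m,n}$ minus its orthogonal projection in $L^2$ onto the closed linear span of $\{y_{m,k}:k<n\}$, divided by its $L^2$ norm. Let $a_{m,k}=\mathbb E[y_{m,n}\overline{\epsilon_{m,n-k}}]$,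 $k\ge 0$, be the coefficients of the causal representation $y_{m,n}=\sum_{k\ge0}a_{m,k}\epsilon_{m,n-k}$, and let $h_m(\nu)=\sum_{k\ge0}a_{m,k}e^{-2i\pi k\nu}$ be the corresponding (outer) spectral factor of $s_m$. With $\xi_{\epsilon_m}(\nu)=N^{-1/2}\sum_{n=1}^N\epsilon_{m,n}e^{-2i\pi(n-1)\nu}$ put $$\tilde s_{ij}(\nu)=\frac1{B+1}\sum_{b=-B/2}^{B/2}h_i\Big(\nu+\frac bN\Big)\overline{h_j\Big(\nu+\frac bN\Big)}\,\xi_{\epsilon_i}\Big(\nu+\frac bN\Big)\overline{\xi_{\epsilon_j}\Big(\nu+\frac bN\Big)},$$ $$\sigma_{ij}^2(\nu)=\frac1{B+1}\sum_{b=-B/2}^{B/2}s_i\Big(\nu+\frac bN\Big)s_j\Big(\nu+\frac bN\Big),$$ and let $\mathcal I=\{(i,j,\nu):1\le i<j\le M,\ \nu\in\mathcal G\}$ with $\mathcal G=\{k\frac{B+1}N:k\in\mathbb N,\ 0\le k\le \frac N{B+1}\}$. Then for every $t\in\mathbb R$, $$\mathbb P\Big(\max_{(i,j,\nu)\in\mathcal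 I}(B+1)\frac{|\tilde s_{ij}(\nu)|^2}{\sigma_{ij}^2(\nu)}\le t+\log\frac N{B+1}+\log\frac{M(M-1)}2\Big)\xrightarrow[N\to+\infty]{}e^{-e^{-t}} .$$ -/

import Mathlib

open MeasureTheory ProbabilityTheory Filter Topology
open scoped ComplexConjugate NNReal ENNReal

noncomputable section

namespace SpectralCoherence

variable {Ω : Type*} [MeasurableSpace Ω]

/-- `X ∼ 𝒩_ℂ(0, v)`: real and imaginary part are i.i.d. `𝒩(0, v/2)`. -/
def HasComplexGaussianLaw (X : Ω → ℂ) (v : ℝ≥0) (P : Measure Ω) : Prop :=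
  P.map (fun ω => (X ω).re) = gaussianReal 0 (v / 2) ∧
  P.map (fun ω => (X ω).im) = gaussianReal 0 (v / 2) ∧
  IndepFun (fun ω => (X ω).re) (fun ω => (X ω).im) P

/-- Zero-mean (circular) complex Gaussian time series: every finite complex linear combination
of its values is `𝒩_ℂ(0, v)` for some variance `v`. -/
def IsComplexGaussianSeries (x : ℤ → Ω → ℂ) (P : Measure Ω) : Prop :=
  ∀ (S : Finset ℤ) (c : ℤ → ℂ), ∃ v : ℝ≥0,
    HasComplexGaussianLaw (fun ω => ∑ n ∈ S, c n * x n ω) v P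

/-- Covariance sequence `r(u) = 𝔼[x_{u} \bar x_{0}]`. -/
def autocov (x : ℤ → Ω → ℂ) (P : Measure Ω) (u : ℤ) : ℂ :=
  ∫ ω, x u ω * conj (x 0 ω) ∂P

/-- Stationarity: `𝔼[x_{n+u} \bar x_{n}]` does not depend on `n`. For zero-mean complex Gaussian
series this is equivalent to strict stationarity. -/
def IsStationary (x : ℤ → Ω → ℂ) (P : Measure Ω) : Prop :=
  ∀ n u : ℤ, ∫ ω, x (n + u) ω * conj (x n ω) ∂P = autocov x P u

/-- Spectral density `s(ν) = ∑_{u ∈ ℤ} r(u) e^{-2 i π u ν}`. The sum is real since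
`r(-u)` is the conjugate of `r(u)`. -/
def specDensity (x : ℤ → Ω → ℂ) (P : Measure Ω) (ν : ℝ) : ℝ :=
  (∑' u : ℤ, autocov x P u * Complex.exp (-2 * Real.pi * Complex.I * u * ν)).re

open Classical in
/-- The class in `L²(P)` of a square integrable random variable (`0` for any other function). -/
def toL2 (X : Ω → ℂ) (P : Measure Ω) : Lp ℂ 2 P :=
  if h : MemLp X 2 P then h.toLp X else 0

/-- The linear past: closed linear span in `L²(P)` of the `x_k` with `k < n`. -/
def pastSpace (x : ℤ → Ω → ℂ) (P : Measure Ω) (n : ℤ) : Submodule ℂ (Lp ℂ 2 P) :=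
  (Submodule.span ℂ {z : Lp ℂ 2 P | ∃ k : ℤ, k < n ∧ z = toL2 (x k) P}).topologicalClosure

instance (x : ℤ → Ω → ℂ) (P : Measure Ω) (n : ℤ) :
    (pastSpace x P n).HasOrthogonalProjection := by
  have : CompleteSpace (pastSpace x P n) :=
    (Submodule.isClosed_topologicalClosure _).completeSpace_coe
  infer_instance

/-- Innovation: `x_n` minus its best linear prediction from the past. -/
def innovation (x : ℤ → Ω → ℂ) (P : Measure Ω) (n : ℤ) : Lp ℂ 2 P :=
  toL2 (x n) P - (pastSpace x P n).starProjection (toL2 (x n) P)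

/-- Normalized innovation sequence `ε_n`, of unit variance. -/
def normInnovation (x : ℤ → Ω → ℂ) (P : Measure Ω) (n : ℤ) : Lp ℂ 2 P :=
  ((‖innovation x P n‖ : ℂ)⁻¹) • innovation x P n

/-- Coefficients `a_k = 𝔼[x_k \bar ε_0]` of the causal representation
`x_n = ∑_{k ≥ 0} a_k ε_{n-k}` in terms of the normalized innovations. -/
def wienerCoeff (x : ℤ → Ω → ℂ) (P : Measure Ω) (k : ℕ) : ℂ :=
  ∫ ω, x (k : ℤ) ω * conj (normInnovation x P 0 ω) ∂P

/-- Causal (outer) spectral factor `h(ν) = ∑_{k ≥ 0} a_k e^{-2 i π k ν}`. -/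
def specFactor (x : ℤ → Ω → ℂ) (P : Measure Ω) (ν : ℝ) : ℂ :=
  ∑' k : ℕ, wienerCoeff x P k * Complex.exp (-2 * Real.pi * Complex.I * k * ν)

/-- Normalized finite Fourier transform
`ξ_z(ν) = N^{-1/2} ∑_{n=1}^N z_n e^{-2 i π (n-1) ν}`. -/
def finFourier (N : ℕ) (z : ℤ → ℂ) (ν : ℝ) : ℂ :=
  ((Real.sqrt N : ℝ) : ℂ)⁻¹ *
    ∑ n ∈ Finset.Icc (1 : ℤ) N, z n * Complex.exp (-2 * Real.pi * Complex.I * (n - 1) * ν)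

/-- The smoothing window `b = -B/2, …, B/2` (used for even `B`). -/
def window (B : ℕ) : Finset ℤ := Finset.Icc (-((B : ℤ) / 2)) ((B : ℤ) / 2)

/-- `s̃_{ij}(ν)` for two series `x = y_i`, `x' = y_j`. -/
def sTilde (x x' : ℤ → Ω → ℂ) (P : Measure Ω) (N B : ℕ) (ν : ℝ) (ω : Ω) : ℂ :=
  ((B : ℂ) + 1)⁻¹ * ∑ b ∈ window B,
    specFactor x P (ν + b / N) * conj (specFactor x' P (ν + b / N)) *
      finFourier N (fun n => normInnovation x P n ω) (ν + b / N) *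
      conj (finFourier N (fun n => normInnovation x' P n ω) (ν + b / N))

/-- `σ²_{ij}(ν)`: average of `s_i s_j` over the smoothing window. -/
def sigmaSq (x x' : ℤ → Ω → ℂ) (P : Measure Ω) (N B : ℕ) (ν : ℝ) : ℝ :=
  ((B : ℝ) + 1)⁻¹ * ∑ b ∈ window B,
    specDensity x P (ν + b / N) * specDensity x' P (ν + b / N)

/-- Frequency grid `𝒢 = {k (B+1)/N : k ∈ ℕ, 0 ≤ k ≤ N/(B+1)}`. -/
def freqGrid (N B : ℕ) : Set ℝ :=
  {ν | ∃ k : ℕ, (k : ℝ) ≤ (N : ℝ) / ((B : ℝ) + 1) ∧ ν = k * (((B : ℝ) + 1) / N)}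

/-- Index set `ℐ` of the triples `(i, j, ν)` with `i < j` among the first `M` series
(numbered from `0`) and `ν ∈ 𝒢`. -/
def indexSet (N M B : ℕ) : Set (ℕ × ℕ × ℝ) :=
  {α | α.1 < α.2.1 ∧ α.2.1 < M ∧ α.2.2 ∈ freqGrid N B}

/-- `max_{(i,j,ν) ∈ ℐ} (B+1) |s̃_{ij}(ν)|² / σ²_{ij}(ν)`; the index set is finite, and nonempty
as soon as `M ≥ 2`. -/
def maxStat (y : ℕ → ℤ → Ω → ℂ) (P : Measure Ω) (N M B : ℕ) (ω : Ω) : ℝ :=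
  ⨆ α : indexSet N M B,
    ((B : ℝ) + 1) * ‖sTilde (y α.1.1) (y α.1.2.1) P N B α.1.2.2 ω‖ ^ 2 /
      sigmaSq (y α.1.1) (y α.1.2.1) P N B α.1.2.2

end SpectralCoherence

end

/-! The normalized innovations of all the series together are orthonormal elements of one Gaussian
space, and the discrete Fourier basis is orthogonal. Hence the `ξ_{ε_m}(q/N)`, for all `m` and all
`q` distinct modulo `N`, are exactly independent standard complex Gaussian variables. Grid points
are `B+1` Fourier indices apart, so their windows do not overlap and distinct grid points give
independent statistics. The last point may wrap around modulo `N`; dropping it costs one vanishing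
probability.

Inside one window the statistic of a pair is `‖∑ g_b ζ_{i,b} conj ζ_{j,b}‖² / ∑ ‖g_b‖²`, because
`‖h_m‖² = s_m`. Given `ζ_i` the form is complex Gaussian, so the tail at level `x` is `exp(-x/U)`,
where `U` is a weighted mean of the `‖ζ_{i,b}‖²` with weights at most `m = O(1/B)`. As `U` has mean
1 and variance at most `m`, averaging gives `e^{-x}(1 + o(1))` as soon as `x² m → 0`, which holds
since `x = O(log N)` and `B` is of order `N^ρ`. Two pairs sharing one series are conditionally
independent given it, and the same estimate bounds their joint exceedance by `e^{-2x}(1 + o(1))`;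
pairs without a common series are independent. With `L = M(M-1)/2`, second order Bonferroni shows
that a window exceeds `x` with probability `L e^{-x}(1 + o(1)) + O((L e^{-x})²)`. The centring makes
`L e^{-x} = e^{-t}(B+1)/N`, and the product over about `N/(B+1)` independent windows tends to
`exp(-e^{-t})`.

The identity `‖h_m‖² = s_m` and the explicit form of the innovations rest on an absolutely summable
predictor. The finite order predictors satisfy a bound on `∑ k² ‖d_k‖²` uniform in the order, from
coercivity of the Toeplitz form and a Schur test. Compactness then gives coefficients of infinite
order, and the factorization follows by convolving Fourier series.

Main steps: `integral_condTail_le`, `integral_condTail_mul_le`, `le_integral_condTail`,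
`exists_whitening`, `iIndepFun_of_orthonormal`, `measureReal_maxStat_bounds`. -/

noncomputable section

/-! ### The standard complex Gaussian law: moments, tail, linear forms. -/

namespace SpectralCoherence

/-- The standard complex Gaussian law `𝒩_ℂ(0, 1)`. -/
def stdCGauss : Measure ℂ :=
  volume.withDensity fun z => ENNReal.ofReal (Real.pi⁻¹ * Real.exp (-‖z‖ ^ 2))

lemma integral_stdCGauss {E : Type*} [NormedAddCommGroup E] [NormedSpace ℝ E] (f : ℂ → E) :
    ∫ z, f z ∂stdCGauss = ∫ z, (Real.pi⁻¹ * Real.exp (-‖z‖ ^ 2)) • f z := by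
  rw [stdCGauss, integral_withDensity_eq_integral_toReal_smul (by fun_prop) (by simp)]
  congr 1 with z
  rw [ENNReal.toReal_ofReal (by positivity)]

lemma integrable_stdCGauss_iff {f : ℂ → ℝ} :
    Integrable f stdCGauss ↔ Integrable fun z => (Real.pi⁻¹ * Real.exp (-‖z‖ ^ 2)) * f z := by
  rw [stdCGauss, integrable_withDensity_iff_integrable_smul' (by fun_prop) (by simp)]
  refine integrable_congr (Eventually.of_forall fun z => ?_)
  simp only [smul_eq_mul]
  rw [ENNReal.toReal_ofReal (by positivity)]

lemma charFun_stdCGauss (t : ℂ) : charFun stdCGauss t = Real.exp (-(‖t‖ ^ 2 / 4)) := by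
  rw [charFun_apply, integral_stdCGauss]
  have h := GaussianFourier.integral_cexp_neg_mul_sq_norm_add (V := ℂ) (b := 1) (by simp)
    Complex.I t
  have h2 : ∀ z : ℂ, (Real.pi⁻¹ * Real.exp (-‖z‖ ^ 2)) • Complex.exp ((inner ℝ z t : ℝ) * Complex.I)
      = (Real.pi⁻¹ : ℂ) * Complex.exp (-1 * ‖z‖ ^ 2 + Complex.I * (inner ℝ t z : ℝ)) := by
    intro z
    rw [real_inner_comm, Complex.real_smul, Complex.exp_add]
    push_cast
    rw [mul_assoc]
    congr 2
    · congr 1; ring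
    · congr 1; ring
  simp_rw [h2]
  rw [integral_const_mul, h, Complex.finrank_real_complex]
  push_cast
  have hpi : (Real.pi : ℂ) ≠ 0 := by exact_mod_cast Real.pi_ne_zero
  have : ((2 : ℂ) / 2) = 1 := by norm_num
  rw [this, Complex.cpow_one, Complex.I_sq]
  field_simp

instance : IsProbabilityMeasure stdCGauss := by
  have h := charFun_stdCGauss 0
  have h1 : Integrable (fun _ : ℂ => (1 : ℝ)) stdCGauss := by
    rw [integrable_stdCGauss_iff]
    -- A non-integrable function has Bochner integral 0, whereas the radial integral formula gives
    -- 1. The same device yields integrability from a computed integral below.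
    by_contra hc
    have h3 := Complex.integral_rpow_mul_exp_neg_rpow (p := 2) (q := 0) (by norm_num) (by norm_num)
    have : ∫ z : ℂ, (Real.pi⁻¹ * Real.exp (-‖z‖ ^ 2)) * 1 = 1 := by
      simp_rw [mul_one, integral_const_mul]
      simp at h3
      rw [h3]; field_simp
    rw [integral_undef hc] at this
    norm_num at this
  have hf : IsFiniteMeasure stdCGauss := by
    simpa [integrable_const_iff] using h1
  rw [charFun_zero] at h
  refine ⟨?_⟩
  have h4 : stdCGauss.real Set.univ = 1 := by
    simpa using h
  rw [measureReal_def, ENNReal.toReal_eq_one_iff] at h4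
  exact h4

lemma integral_exp_mul_normSq_stdCGauss {a : ℝ} (ha : a < 1) :
    ∫ z, Real.exp (a * ‖z‖ ^ 2) ∂stdCGauss = (1 - a)⁻¹ := by
  rw [integral_stdCGauss]
  have h := GaussianFourier.integral_rexp_neg_mul_sq_norm (V := ℂ) (b := 1 - a) (by linarith)
  have h2 : ∀ z : ℂ, (Real.pi⁻¹ * Real.exp (-‖z‖ ^ 2)) • Real.exp (a * ‖z‖ ^ 2)
      = Real.pi⁻¹ * Real.exp (-(1 - a) * ‖z‖ ^ 2) := by
    intro z
    rw [smul_eq_mul, mul_assoc, ← Real.exp_add]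
    congr 2; ring
  simp_rw [h2]
  rw [integral_const_mul, h, Complex.finrank_real_complex]
  have : (1 - a) ≠ 0 := by linarith
  norm_num
  field_simp

lemma integrable_exp_mul_normSq_stdCGauss {a : ℝ} (ha : a < 1) :
    Integrable (fun z => Real.exp (a * ‖z‖ ^ 2)) stdCGauss := by
  by_contra hc
  have := integral_exp_mul_normSq_stdCGauss ha
  rw [integral_undef hc] at this
  have h0 : 0 < (1 - a)⁻¹ := inv_pos.2 (by linarith)
  linarith

lemma integral_normSq_stdCGauss : ∫ z, ‖z‖ ^ 2 ∂stdCGauss = 1 := by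
  rw [integral_stdCGauss]
  have h3 := Complex.integral_rpow_mul_exp_neg_rpow (p := 2) (q := 2) (by norm_num) (by norm_num)
  have h2 : ∀ z : ℂ, (Real.pi⁻¹ * Real.exp (-‖z‖ ^ 2)) • ‖z‖ ^ 2
      = Real.pi⁻¹ * (‖z‖ ^ (2 : ℝ) * Real.exp (-‖z‖ ^ (2 : ℝ))) := by
    intro z; simp; ring
  simp_rw [h2]
  rw [integral_const_mul, h3]
  norm_num

lemma integral_norm_pow_four_stdCGauss : ∫ z, ‖z‖ ^ 4 ∂stdCGauss = 2 := by
  rw [integral_stdCGauss]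
  have h3 := Complex.integral_rpow_mul_exp_neg_rpow (p := 2) (q := 4) (by norm_num) (by norm_num)
  have h2 : ∀ z : ℂ, (Real.pi⁻¹ * Real.exp (-‖z‖ ^ 2)) • ‖z‖ ^ 4
      = Real.pi⁻¹ * (‖z‖ ^ (4 : ℝ) * Real.exp (-‖z‖ ^ (2 : ℝ))) := by
    intro z
    rw [show (4 : ℝ) = ((4 : ℕ) : ℝ) by norm_num, Real.rpow_natCast]
    simp; ring
  simp_rw [h2]
  rw [integral_const_mul, h3]
  norm_num

lemma memLp_normSq_stdCGauss : MemLp (fun z : ℂ => ‖z‖ ^ 2) 2 stdCGauss := by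
  rw [memLp_two_iff_integrable_sq (by fun_prop)]
  by_contra hc
  have := integral_norm_pow_four_stdCGauss
  rw [show (fun z : ℂ => (‖z‖ ^ 2) ^ 2) = fun z => ‖z‖ ^ 4 by ext; ring] at hc
  rw [integral_undef hc] at this
  norm_num at this

lemma variance_normSq_stdCGauss : Var[fun z : ℂ => ‖z‖ ^ 2; stdCGauss] = 1 := by
  rw [variance_eq_sub memLp_normSq_stdCGauss, integral_normSq_stdCGauss]
  have : ((fun z : ℂ => ‖z‖ ^ 2) ^ 2 : ℂ → ℝ) = fun z => ‖z‖ ^ 4 := by ext; simp; ring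
  rw [this, integral_norm_pow_four_stdCGauss]
  norm_num

/-- In polar coordinates the density is proportional to `r e^{-r²}`, so the squared modulus is
exponential with mean 1. This is the source of the Gumbel limit. -/
lemma stdCGauss_tail {y : ℝ} (hy : 0 ≤ y) :
    stdCGauss.real {z : ℂ | y < ‖z‖ ^ 2} = Real.exp (-y) := by
  have hm : MeasurableSet {z : ℂ | y < ‖z‖ ^ 2} := measurableSet_lt (by fun_prop) (by fun_prop)
  rw [← integral_indicator_one hm, integral_stdCGauss]
  have h2 : ∀ z : ℂ, (Real.pi⁻¹ * Real.exp (-‖z‖ ^ 2)) • Set.indicator {z : ℂ | y < ‖z‖ ^ 2} 1 z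
      = (Real.pi⁻¹ * (if y < ‖z‖ ^ 2 then Real.exp (-‖z‖ ^ 2) else 0)) := by
    intro z
    by_cases h : y < ‖z‖ ^ 2 <;> simp [Set.indicator, h]
  simp_rw [h2]
  rw [integral_const_mul, ← Complex.integral_comp_polarCoord_symm]
  have h3 : ∫ p in polarCoord.target, p.1 • (if y < ‖Complex.polarCoord.symm p‖ ^ 2 then
      Real.exp (-‖Complex.polarCoord.symm p‖ ^ 2) else 0) =
      ∫ p in Set.Ioi (0 : ℝ) ×ˢ Set.Ioo (-Real.pi) Real.pi,
        (p.1 * (if y < p.1 ^ 2 then Real.exp (-p.1 ^ 2) else 0)) * (fun _ => (1 : ℝ)) p.2 := by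
    rw [polarCoord_target]
    simp_rw [Complex.norm_polarCoord_symm, smul_eq_mul, sq_abs, mul_one]
  rw [h3, Measure.volume_eq_prod, setIntegral_prod_mul (f := fun r : ℝ => r * (if y < r ^ 2 then Real.exp (-r ^ 2) else 0))
    (g := fun _ => (1 : ℝ))]
  have h4 : ∫ r in Set.Ioi (0 : ℝ), r * (if y < r ^ 2 then Real.exp (-r ^ 2) else 0)
      = ∫ r in Set.Ioi (√y), r * Real.exp (-r ^ 2) := by
    rw [← integral_indicator measurableSet_Ioi, ← integral_indicator measurableSet_Ioi]
    congr 1 with r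
    by_cases hr : √y < r
    · have h0 : 0 < r := (Real.sqrt_nonneg y).trans_lt hr
      have h1 : y < r ^ 2 := (Real.sqrt_lt' h0).1 hr
      simp [Set.indicator, hr, h0, h1]
    · by_cases h0 : 0 < r
      · have h1 : ¬ y < r ^ 2 := fun h => hr ((Real.sqrt_lt' h0).2 h)
        simp [Set.indicator, hr, h1]
      · simp [Set.indicator, hr, h0]
  have hder : ∀ x : ℝ, HasDerivAt (fun r : ℝ => -(1 / 2) * Real.exp (-r ^ 2))
      (x * Real.exp (-x ^ 2)) x := by
    intro x
    have := (((hasDerivAt_id x).pow 2).neg.exp).const_mul (-(1 / 2 : ℝ))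
    convert! this using 1
    simp; ring
  have hlim : Tendsto (fun r : ℝ => -(1 / 2) * Real.exp (-r ^ 2)) atTop (𝓝 (-(1 / 2) * 0)) := by
    refine Tendsto.const_mul _ (Real.tendsto_exp_neg_atTop_nhds_zero.comp ?_)
    exact tendsto_pow_atTop two_ne_zero
  have h5 : ∫ r in Set.Ioi (√y), r * Real.exp (-r ^ 2) = (1 / 2) * Real.exp (-y) := by
    rw [integral_Ioi_of_hasDerivAt_of_nonneg' (fun x _ => hder x) (fun x hx => ?_) hlim]
    · rw [Real.sq_sqrt hy]; ring
    · have : 0 < x := (Real.sqrt_nonneg y).trans_lt hx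
      positivity
  rw [h4, h5]
  simp only [integral_const, MeasurableSet.univ, measureReal_restrict_apply, Set.univ_inter,
    smul_eq_mul, mul_one]
  rw [Real.volume_real_Ioo_of_le (by linarith [Real.pi_pos])]
  field_simp
  ring

lemma measurable_sum_mul_conj {W : Type*} [Fintype W] (c : W → ℂ) :
    Measurable fun w : W → ℂ => ∑ b, c b * conj (w b) :=
  Continuous.measurable (by fun_prop)

/-- A normalized linear combination of independent standard complex Gaussian variables is standard
complex Gaussian. -/
lemma stdCGauss_pi_map_linear {W : Type*} [Fintype W] (c : W → ℂ) (hc : ∑ b, ‖c b‖ ^ 2 = 1) :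
    (Measure.pi fun _ : W => stdCGauss).map (fun w => ∑ b, c b * conj (w b)) = stdCGauss := by
  have : IsProbabilityMeasure ((Measure.pi fun _ : W => stdCGauss).map
      (fun w => ∑ b, c b * conj (w b))) :=
    Measure.isProbabilityMeasure_map (measurable_sum_mul_conj c).aemeasurable
  refine Measure.ext_of_charFun ?_
  ext t
  rw [charFun_stdCGauss, charFun_apply, integral_map (measurable_sum_mul_conj c).aemeasurable
    (by fun_prop)]
  have h : ∀ w : W → ℂ, Complex.exp ((inner ℝ (∑ b, c b * conj (w b)) t : ℝ) * Complex.I) =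
      ∏ b, Complex.exp ((inner ℝ (w b) (c b * conj t) : ℝ) * Complex.I) := by
    intro w
    rw [← Complex.exp_sum, sum_inner, ← Finset.sum_mul]
    push_cast
    congr 2
    refine Finset.sum_congr rfl fun b _ => ?_
    congr 1
    simp only [Complex.inner, map_mul, Complex.conj_conj, Complex.mul_re, Complex.mul_im,
      Complex.conj_re, Complex.conj_im]
    ring
  simp_rw [h]
  rw [integral_fintype_prod_eq_prod
    (f := fun b (z : ℂ) => Complex.exp ((inner ℝ z (c b * conj t) : ℝ) * Complex.I))]
  simp_rw [← charFun_apply, charFun_stdCGauss]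
  rw [← Complex.ofReal_prod, ← Real.exp_sum, Finset.sum_neg_distrib]
  simp_rw [norm_mul, mul_pow, RCLike.norm_conj, mul_div_assoc]
  rw [← Finset.sum_mul, hc, one_mul]

lemma stdCGauss_pi_tail {W : Type*} [Fintype W] (c : W → ℂ) (hc : 0 < ∑ b, ‖c b‖ ^ 2) {y : ℝ}
    (hy : 0 ≤ y) :
    (Measure.pi fun _ : W => stdCGauss).real {w | y < ‖∑ b, c b * conj (w b)‖ ^ 2} =
      Real.exp (-(y / ∑ b, ‖c b‖ ^ 2)) := by
  set V := ∑ b, ‖c b‖ ^ 2 with hV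
  have h1 := stdCGauss_pi_map_linear (fun b => ((√V)⁻¹ : ℝ) * c b) (by
    simp_rw [norm_mul, mul_pow, ← Finset.mul_sum, ← hV]
    rw [Complex.norm_real, Real.norm_eq_abs, sq_abs, inv_pow, Real.sq_sqrt hc.le]
    field_simp)
  rw [← stdCGauss_tail (div_nonneg hy hc.le)]
  nth_rewrite 2 [← h1]
  rw [map_measureReal_apply (measurable_sum_mul_conj _)
    (measurableSet_lt (by fun_prop) (by fun_prop))]
  congr 1
  ext w
  change y < _ ↔ y / V < _
  simp only [mul_assoc, ← Finset.mul_sum]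
  rw [norm_mul, mul_pow, Complex.norm_real, Real.norm_eq_abs, sq_abs, inv_pow, Real.sq_sqrt hc.le,
    div_lt_iff₀ hc]
  field_simp

end SpectralCoherence

/-! ### Tail of a bilinear Gaussian form, by conditioning on one of the two vectors. -/

namespace SpectralCoherence

/-- The law of a vector of independent standard complex Gaussian variables. -/
abbrev stdCGaussVec (W : Type*) [Fintype W] : Measure (W → ℂ) := Measure.pi fun _ => stdCGauss

/-- Serves twice: it bounds the moment generating function `1/(1-v)` of an exponential variable, and
later gives `1 - u ≥ exp(-(u + u²))` in the product over windows. -/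
lemma inv_one_sub_le_exp {y : ℝ} (h0 : 0 ≤ y) (h1 : y ≤ 1 / 2) :
    (1 - y)⁻¹ ≤ Real.exp (y + y ^ 2) := by
  have h2 : 0 < 1 - y := by linarith
  have h3 : 1 + (y + y ^ 2) + (y + y ^ 2) ^ 2 / 2 ≤ Real.exp (y + y ^ 2) :=
    Real.quadratic_le_exp_of_nonneg (by positivity)
  refine le_trans ?_ h3
  rw [inv_le_iff_one_le_mul₀ h2]
  nlinarith [mul_nonneg (sq_nonneg y) (by linarith : (0 : ℝ) ≤ 1 / 2 - y), pow_nonneg h0 3,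
    pow_nonneg h0 4, mul_nonneg (pow_nonneg h0 3) (by linarith : (0 : ℝ) ≤ 1 / 2 - y),
    mul_nonneg (pow_nonneg h0 4) (by linarith : (0 : ℝ) ≤ 1 / 2 - y)]

section Weighted

variable {W : Type*} [Fintype W]

lemma integrable_exp_weighted (v : W → ℝ) (hv : ∀ b, v b < 1) :
    Integrable (fun z : W → ℂ => Real.exp (∑ b, v b * ‖z b‖ ^ 2)) (stdCGaussVec W) := by
  simp_rw [Real.exp_sum]
  exact Integrable.fintype_prod (f := fun b (z : ℂ) => Real.exp (v b * ‖z‖ ^ 2))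
    fun b => integrable_exp_mul_normSq_stdCGauss (hv b)

lemma integral_exp_weighted_le (v : W → ℝ) (h0 : ∀ b, 0 ≤ v b) (h1 : ∀ b, v b ≤ 1 / 2) :
    ∫ z : W → ℂ, Real.exp (∑ b, v b * ‖z b‖ ^ 2) ∂(stdCGaussVec W) ≤
      Real.exp (∑ b, v b + ∑ b, v b ^ 2) := by
  simp_rw [Real.exp_sum]
  rw [integral_fintype_prod_eq_prod (f := fun b (z : ℂ) => Real.exp (v b * ‖z‖ ^ 2)),
    ← Finset.sum_add_distrib, Real.exp_sum]
  refine Finset.prod_le_prod (fun b _ => integral_nonneg fun z => (Real.exp_pos _).le)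
    fun b _ => ?_
  rw [integral_exp_mul_normSq_stdCGauss (by linarith [h1 b])]
  exact inv_one_sub_le_exp (h0 b) (h1 b)

lemma memLp_weighted (v : W → ℝ) :
    MemLp (fun z : W → ℂ => ∑ b, v b * ‖z b‖ ^ 2) 2 (stdCGaussVec W) := by
  refine memLp_finsetSum _ fun b _ => ?_
  have h := (memLp_normSq_stdCGauss.const_mul (v b)).comp_measurePreserving
    (measurePreserving_eval (fun _ : W => stdCGauss) b)
  exact h

lemma integral_weighted (v : W → ℝ) :
    ∫ z : W → ℂ, ∑ b, v b * ‖z b‖ ^ 2 ∂(stdCGaussVec W) = ∑ b, v b := by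
  have hint : ∀ b, Integrable (fun z : W → ℂ => v b * ‖z b‖ ^ 2) (stdCGaussVec W) := fun b =>
    ((memLp_normSq_stdCGauss.const_mul (v b)).comp_measurePreserving
      (measurePreserving_eval (fun _ : W => stdCGauss) b)).integrable (by norm_num)
  rw [integral_finsetSum _ fun b _ => hint b]
  refine Finset.sum_congr rfl fun b _ => ?_
  rw [integral_const_mul]
  have h := integral_map (measurePreserving_eval (fun _ : W => stdCGauss) b).aemeasurable
    (f := fun z : ℂ => ‖z‖ ^ 2) (by fun_prop)
  rw [(measurePreserving_eval (fun _ : W => stdCGauss) b).map_eq, integral_normSq_stdCGauss] at h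
  simp only [Function.eval] at h
  rw [← h, mul_one]

lemma variance_weighted (v : W → ℝ) :
    Var[fun z : W → ℂ => ∑ b, v b * ‖z b‖ ^ 2; stdCGaussVec W] = ∑ b, v b ^ 2 := by
  have h := variance_sum_pi (μ := fun _ : W => stdCGauss) (X := fun b z => v b * ‖z‖ ^ 2)
    fun b => memLp_normSq_stdCGauss.const_mul (v b)
  have h2 : (∑ b, fun z : W → ℂ => v b * ‖z b‖ ^ 2) = fun z : W → ℂ => ∑ b, v b * ‖z b‖ ^ 2 := by
    ext z; simp
  rw [h2] at h
  rw [h]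
  refine Finset.sum_congr rfl fun b _ => ?_
  rw [variance_const_mul, variance_normSq_stdCGauss, mul_one]

end Weighted

/-- The convex function `1/u` lies above its tangent `2 - u` at 1. The bound is exponential in `u`,
so its expectation is a moment generating function. -/
lemma exp_neg_div_le {x u : ℝ} (hx : 0 ≤ x) (hu : 0 < u) :
    Real.exp (-(x / u)) ≤ Real.exp (-2 * x + x * u) := by
  refine Real.exp_le_exp.2 ?_
  have h : 2 - u ≤ 1 / u := by
    rw [le_div_iff₀ hu]; nlinarith [sq_nonneg (u - 1)]
  have := mul_le_mul_of_nonneg_left h hx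
  rw [mul_one_div] at this
  linarith

/-- A lower bound quadratic in `u`, so that only the mean and variance of `u` matter after
averaging. For `u ≥ 1/2` it comes from `e^s ≥ 1 + s` with `s = x(u-1)/u`; for `u < 1/2` the left
side is nonpositive because `x ≥ 2`. -/
lemma le_exp_neg_div {x u : ℝ} (hx : 2 ≤ x) (hu : 0 < u) :
    Real.exp (-x) * (1 + x * (u - 1) - 2 * x * (u - 1) ^ 2) ≤ Real.exp (-(x / u)) := by
  by_cases h : u < 1 / 2
  · refine le_trans ?_ (Real.exp_pos _).le
    refine mul_nonpos_of_nonneg_of_nonpos (Real.exp_pos _).le ?_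
    nlinarith [mul_nonneg (by linarith : 0 ≤ x) (sq_nonneg (u - 1))]
  · push Not at h
    have h1 : -(x / u) = -x + x * ((u - 1) / u) := by field_simp; ring
    rw [h1, Real.exp_add]
    refine mul_le_mul_of_nonneg_left ?_ (Real.exp_pos _).le
    refine le_trans ?_ (Real.add_one_le_exp _)
    have h2 : (u - 1) - 2 * (u - 1) ^ 2 ≤ (u - 1) / u := by
      rw [le_div_iff₀ hu]
      nlinarith [mul_nonneg (sq_nonneg (u - 1)) (by linarith : 0 ≤ 2 * u - 1)]
    have := mul_le_mul_of_nonneg_left h2 (by linarith : 0 ≤ x)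
    linarith

section Tail

variable {W : Type*} [Fintype W]

/-- The event, for the bilinear Gaussian form with coefficients `g`, of exceeding the level `x`
relative to its variance. -/
def crossSet (g : W → ℂ) (x : ℝ) : Set ((W → ℂ) × (W → ℂ)) :=
  {p | x * ∑ b, ‖g b‖ ^ 2 < ‖∑ b, g b * p.1 b * conj (p.2 b)‖ ^ 2}

lemma measurableSet_crossSet (g : W → ℂ) (x : ℝ) : MeasurableSet (crossSet g x) :=
  measurableSet_lt measurable_const (Continuous.measurable (by fun_prop))

/-- The normalized conditional variance of the form with coefficients `g`. -/
def relVar (g : W → ℂ) (z : W → ℂ) : ℝ := ∑ b, (‖g b‖ ^ 2 / ∑ a, ‖g a‖ ^ 2) * ‖z b‖ ^ 2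

lemma relVar_nonneg (g z : W → ℂ) : 0 ≤ relVar g z :=
  Finset.sum_nonneg fun b _ => by positivity

/-- Conditional tail probability given the first vector. -/
def condTail (g : W → ℂ) (x : ℝ) (z : W → ℂ) : ℝ :=
  (stdCGaussVec W).real (Prod.mk z ⁻¹' crossSet g x)

lemma condTail_nonneg (g : W → ℂ) (x : ℝ) (z : W → ℂ) : 0 ≤ condTail g x z := measureReal_nonneg

/-- With `z` frozen the form is linear in the conjugate of the second vector, with coefficients `g b
* z b` and variance `(∑ ‖g b‖²) * relVar g z`. -/
lemma condTail_eq_of_pos {g : W → ℂ} (hg : 0 < ∑ b, ‖g b‖ ^ 2) {x : ℝ} (hx : 0 ≤ x) {z : W → ℂ}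
    (hz : 0 < relVar g z) : condTail g x z = Real.exp (-(x / relVar g z)) := by
  have h1 : ∑ b, ‖g b * z b‖ ^ 2 = (∑ b, ‖g b‖ ^ 2) * relVar g z := by
    rw [relVar, Finset.mul_sum]
    refine Finset.sum_congr rfl fun b _ => ?_
    rw [norm_mul]; field_simp
  have h2 : 0 < ∑ b, ‖g b * z b‖ ^ 2 := by rw [h1]; positivity
  have h3 := stdCGauss_pi_tail (fun b => g b * z b) h2 (y := x * ∑ b, ‖g b‖ ^ 2) (by positivity)
  rw [condTail]
  refine h3.trans ?_
  rw [h1]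
  congr 2
  field_simp

/-- The degenerate case needs its own value: since `x / 0 = 0`, the exponential formula would give 1
instead of 0. -/
lemma condTail_eq_zero {g : W → ℂ} (hg : 0 < ∑ b, ‖g b‖ ^ 2) {x : ℝ} (hx : 0 ≤ x) {z : W → ℂ}
    (hz : relVar g z = 0) : condTail g x z = 0 := by
  have h1 : ∀ b, g b * z b = 0 := by
    intro b
    have h := (Finset.sum_eq_zero_iff_of_nonneg (fun b _ => by positivity)).1 hz b (Finset.mem_univ b)
    rcases mul_eq_zero.1 h with h | h
    · rw [div_eq_zero_iff] at h
      rcases h with h | h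
      · have : g b = 0 := by simpa using h
        simp [this]
      · exact absurd h hg.ne'
    · have : z b = 0 := by simpa using h
      simp [this]
  have : Prod.mk z ⁻¹' crossSet g x = ∅ := by
    ext w
    simp only [crossSet, Set.mem_preimage, Set.mem_empty_iff_false, iff_false]
    change ¬ (x * _ < _)
    simp only [h1, zero_mul, Finset.sum_const_zero, norm_zero]
    have : 0 ≤ x * ∑ b, ‖g b‖ ^ 2 := by positivity
    simpa using this
  rw [condTail, this, measureReal_empty]

lemma condTail_le {g : W → ℂ} (hg : 0 < ∑ b, ‖g b‖ ^ 2) {x : ℝ} (hx : 0 ≤ x) (z : W → ℂ) :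
    condTail g x z ≤ Real.exp (-2 * x + x * relVar g z) := by
  rcases (relVar_nonneg g z).eq_or_lt with h | h
  · rw [condTail_eq_zero hg hx h.symm]; positivity
  · rw [condTail_eq_of_pos hg hx h]; exact exp_neg_div_le hx h

lemma le_condTail {g : W → ℂ} (hg : 0 < ∑ b, ‖g b‖ ^ 2) {x : ℝ} (hx : 2 ≤ x) (z : W → ℂ) :
    Real.exp (-x) * (1 + x * (relVar g z - 1) - 2 * x * (relVar g z - 1) ^ 2) ≤ condTail g x z := by
  rcases (relVar_nonneg g z).eq_or_lt with h | h
  · rw [condTail_eq_zero hg (by linarith) h.symm, ← h]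
    refine mul_nonpos_of_nonneg_of_nonpos (Real.exp_pos _).le ?_
    linarith
  · rw [condTail_eq_of_pos hg (by linarith) h]; exact le_exp_neg_div hx h

lemma measurable_condTail (g : W → ℂ) (x : ℝ) : Measurable (condTail g x) :=
  (measurable_measure_prodMk_left (measurableSet_crossSet g x)).ennreal_toReal

lemma sum_relWeight {g : W → ℂ} (hg : 0 < ∑ b, ‖g b‖ ^ 2) :
    ∑ b, ‖g b‖ ^ 2 / ∑ a, ‖g a‖ ^ 2 = 1 := by
  rw [← Finset.sum_div, div_self hg.ne']

lemma condTail_le_one (g : W → ℂ) (x : ℝ) (z : W → ℂ) : condTail g x z ≤ 1 := measureReal_le_one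

lemma integrable_condTail (g : W → ℂ) (x : ℝ) : Integrable (condTail g x) (stdCGaussVec W) :=
  Integrable.of_bound (measurable_condTail g x).aestronglyMeasurable 1
    (Eventually.of_forall fun z => by
      rw [Real.norm_of_nonneg (condTail_nonneg g x z)]; exact condTail_le_one g x z)

lemma sum_sq_le_of_le {v : W → ℝ} (h0 : ∀ b, 0 ≤ v b) {m : ℝ} (hm : ∀ b, v b ≤ m) :
    ∑ b, v b ^ 2 ≤ m * ∑ b, v b := by
  rw [Finset.mul_sum]
  exact Finset.sum_le_sum fun b _ => by nlinarith [h0 b, hm b]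

/-- The tangent bound leaves `e^{-2x} E[e^{xU}]`. The weights `v` have sum `x` and maximum at most
`x m`, so `∑ v + ∑ v² ≤ x + x² m`. -/
lemma integral_condTail_le {g : W → ℂ} (hg : 0 < ∑ b, ‖g b‖ ^ 2) {x m : ℝ} (hx : 0 ≤ x)
    (hm : ∀ b, ‖g b‖ ^ 2 / ∑ a, ‖g a‖ ^ 2 ≤ m) (hxm : x * m ≤ 1 / 2) :
    ∫ z, condTail g x z ∂(stdCGaussVec W) ≤ Real.exp (-x + x ^ 2 * m) := by
  set v : W → ℝ := fun b => x * (‖g b‖ ^ 2 / ∑ a, ‖g a‖ ^ 2) with hv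
  have hv0 : ∀ b, 0 ≤ v b := fun b => by positivity
  have hv1 : ∀ b, v b ≤ x * m := fun b => mul_le_mul_of_nonneg_left (hm b) hx
  have hsum : ∑ b, v b = x := by rw [← Finset.mul_sum, sum_relWeight hg, mul_one]
  have hrel : ∀ z, x * relVar g z = ∑ b, v b * ‖z b‖ ^ 2 := fun z => by
    rw [relVar, Finset.mul_sum]; exact Finset.sum_congr rfl fun b _ => by simp only [v]; ring
  calc ∫ z, condTail g x z ∂(stdCGaussVec W)
      ≤ ∫ z, Real.exp (-2 * x) * Real.exp (∑ b, v b * ‖z b‖ ^ 2) ∂(stdCGaussVec W) := by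
        refine integral_mono (integrable_condTail g x)
          ((integrable_exp_weighted v fun b => by linarith [hv1 b]).const_mul _) fun z => ?_
        simp only
        rw [← hrel, ← Real.exp_add]
        exact condTail_le hg hx z
    _ ≤ Real.exp (-2 * x) * Real.exp (∑ b, v b + ∑ b, v b ^ 2) := by
        rw [integral_const_mul]
        exact mul_le_mul_of_nonneg_left
          (integral_exp_weighted_le v hv0 fun b => (hv1 b).trans hxm) (Real.exp_pos _).le
    _ ≤ Real.exp (-x + x ^ 2 * m) := by
        rw [← Real.exp_add]
        refine Real.exp_le_exp.2 ?_
        have := sum_sq_le_of_le hv0 hv1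
        rw [hsum] at this ⊢
        nlinarith

/-- The joint tail of two forms sharing their first vector. The two relative variances may be
arbitrarily correlated: their weights simply add, with sum `2x` and maximum `2xm`, whence `∑ v² ≤
4x² m`. The condition `x m ≤ 1/4` keeps every weight below 1/2. -/
lemma integral_condTail_mul_le {g g' : W → ℂ} (hg : 0 < ∑ b, ‖g b‖ ^ 2)
    (hg' : 0 < ∑ b, ‖g' b‖ ^ 2) {x m : ℝ} (hx : 0 ≤ x)
    (hm : ∀ b, ‖g b‖ ^ 2 / ∑ a, ‖g a‖ ^ 2 ≤ m) (hm' : ∀ b, ‖g' b‖ ^ 2 / ∑ a, ‖g' a‖ ^ 2 ≤ m)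
    (hxm : x * m ≤ 1 / 4) :
    ∫ z, condTail g x z * condTail g' x z ∂(stdCGaussVec W) ≤
      Real.exp (-2 * x + 4 * x ^ 2 * m) := by
  set v : W → ℝ := fun b => x * (‖g b‖ ^ 2 / ∑ a, ‖g a‖ ^ 2) + x * (‖g' b‖ ^ 2 / ∑ a, ‖g' a‖ ^ 2)
    with hv
  have hv0 : ∀ b, 0 ≤ v b := fun b => by positivity
  have hv1 : ∀ b, v b ≤ 2 * (x * m) := fun b => by
    have h1 := mul_le_mul_of_nonneg_left (hm b) hx
    have h2 := mul_le_mul_of_nonneg_left (hm' b) hx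
    simp only [v]; linarith
  have hsum : ∑ b, v b = 2 * x := by
    rw [Finset.sum_add_distrib, ← Finset.mul_sum, ← Finset.mul_sum, sum_relWeight hg,
      sum_relWeight hg']; ring
  have hrel : ∀ z, x * relVar g z + x * relVar g' z = ∑ b, v b * ‖z b‖ ^ 2 := fun z => by
    rw [relVar, relVar, Finset.mul_sum, Finset.mul_sum, ← Finset.sum_add_distrib]
    exact Finset.sum_congr rfl fun b _ => by simp only [v]; ring
  calc ∫ z, condTail g x z * condTail g' x z ∂(stdCGaussVec W)
      ≤ ∫ z, Real.exp (-4 * x) * Real.exp (∑ b, v b * ‖z b‖ ^ 2) ∂(stdCGaussVec W) := by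
        refine integral_mono_of_nonneg (Eventually.of_forall fun z =>
            mul_nonneg (condTail_nonneg g x z) (condTail_nonneg g' x z))
          ((integrable_exp_weighted v fun b => by linarith [hv1 b]).const_mul _)
          (Eventually.of_forall fun z => ?_)
        simp only
        rw [← hrel, ← Real.exp_add]
        refine (mul_le_mul (condTail_le hg hx z) (condTail_le hg' hx z) (condTail_nonneg g' x z)
          (Real.exp_pos _).le).trans_eq ?_
        rw [← Real.exp_add]; congr 1; ring
    _ ≤ Real.exp (-4 * x) * Real.exp (∑ b, v b + ∑ b, v b ^ 2) := by
        rw [integral_const_mul]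
        exact mul_le_mul_of_nonneg_left
          (integral_exp_weighted_le v hv0 fun b => (hv1 b).trans (by linarith)) (Real.exp_pos _).le
    _ ≤ Real.exp (-2 * x + 4 * x ^ 2 * m) := by
        rw [← Real.exp_add]
        refine Real.exp_le_exp.2 ?_
        have := sum_sq_le_of_le hv0 hv1
        rw [hsum] at this ⊢
        nlinarith

/-- In the quadratic lower bound the linear term averages to 0, as the relative variance has mean 1;
its variance is the sum of the squared weights, at most `m`. -/
lemma le_integral_condTail {g : W → ℂ} (hg : 0 < ∑ b, ‖g b‖ ^ 2) {x m : ℝ} (hx : 2 ≤ x)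
    (hm : ∀ b, ‖g b‖ ^ 2 / ∑ a, ‖g a‖ ^ 2 ≤ m) :
    Real.exp (-x) * (1 - 2 * x * m) ≤ ∫ z, condTail g x z ∂(stdCGaussVec W) := by
  have hmem : MemLp (relVar g) 2 (stdCGaussVec W) := memLp_weighted _
  have hmean : ∫ z, relVar g z ∂(stdCGaussVec W) = 1 :=
    (integral_weighted _).trans (sum_relWeight hg)
  have hvar : ∫ z, (relVar g z - 1) ^ 2 ∂(stdCGaussVec W) ≤ m := by
    have h := variance_weighted (fun b => ‖g b‖ ^ 2 / ∑ a, ‖g a‖ ^ 2)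
    have h2 : Var[relVar g; stdCGaussVec W] = ∫ z, (relVar g z - 1) ^ 2 ∂(stdCGaussVec W) := by
      rw [variance_eq_integral hmem.aemeasurable, hmean]
    rw [← h2]
    refine h.trans_le ((sum_sq_le_of_le (fun b => by positivity) hm).trans_eq ?_)
    rw [sum_relWeight hg, mul_one]
  have hint1 : Integrable (fun z => relVar g z - 1) (stdCGaussVec W) :=
    (hmem.integrable (by norm_num)).sub (integrable_const _)
  have hint2 : Integrable (fun z => (relVar g z - 1) ^ 2) (stdCGaussVec W) :=
    (hmem.sub (memLp_const 1)).integrable_sq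
  calc Real.exp (-x) * (1 - 2 * x * m)
      ≤ Real.exp (-x) * (1 + x * 0 - 2 * x * ∫ z, (relVar g z - 1) ^ 2 ∂(stdCGaussVec W)) := by
        refine mul_le_mul_of_nonneg_left ?_ (Real.exp_pos _).le
        nlinarith
    _ = ∫ z, Real.exp (-x) * (1 + x * (relVar g z - 1) - 2 * x * (relVar g z - 1) ^ 2)
          ∂(stdCGaussVec W) := by
        have h0 : ∫ z, (relVar g z - 1) ∂(stdCGaussVec W) = 0 := by
          rw [integral_sub (hmem.integrable (by norm_num)) (integrable_const _), hmean]; simp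
        rw [integral_const_mul, integral_sub, integral_add, integral_const_mul, integral_const_mul,
          h0]
        · simp
        · exact integrable_const _
        · exact hint1.const_mul _
        · exact (integrable_const _).add (hint1.const_mul _)
        · exact hint2.const_mul _
    _ ≤ ∫ z, condTail g x z ∂(stdCGaussVec W) := by
        refine integral_mono ?_ (integrable_condTail g x) fun z => le_condTail hg hx z
        exact (((integrable_const _).add (hint1.const_mul _)).sub (hint2.const_mul _)).const_mul _

end Tail

end SpectralCoherence

/-! ### Bonferroni inequality and exceedances of all pairs in one window. -/

namespace SpectralCoherence

section Bonferroni

variable {Ω α : Type*} [MeasurableSpace Ω] {P : Measure Ω} [IsProbabilityMeasure P]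

/-- Second order Bonferroni inequality (with ordered pairs). -/
lemma sum_sub_sum_inter_le_measureReal_biUnion [DecidableEq α] (A : Finset α) (E : α → Set Ω)
    (hE : ∀ a ∈ A, MeasurableSet (E a)) :
    ∑ a ∈ A, P.real (E a) - ∑ a ∈ A, ∑ b ∈ A.erase a, P.real (E a ∩ E b) ≤
      P.real (⋃ a ∈ A, E a) := by
  have hU : MeasurableSet (⋃ a ∈ A, E a) := Finset.measurableSet_biUnion A hE
  have hi : ∀ s : Set Ω, MeasurableSet s → Integrable (s.indicator (1 : Ω → ℝ)) P := fun s hs =>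
    (integrable_const (1 : ℝ)).indicator hs
  have hI : ∀ a ∈ A, ∀ b ∈ A.erase a, MeasurableSet (E a ∩ E b) := fun a ha b hb =>
    (hE a ha).inter (hE b (Finset.mem_of_mem_erase hb))
  have h1 : ∑ a ∈ A, P.real (E a) - ∑ a ∈ A, ∑ b ∈ A.erase a, P.real (E a ∩ E b) =
      ∫ ω, (∑ a ∈ A, (E a).indicator (1 : Ω → ℝ) ω -
        ∑ a ∈ A, ∑ b ∈ A.erase a, (E a ∩ E b).indicator (1 : Ω → ℝ) ω) ∂P := by
    rw [integral_sub, integral_finsetSum, integral_finsetSum]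
    · congr 1
      · exact Finset.sum_congr rfl fun a ha => (integral_indicator_one (hE a ha)).symm
      · refine Finset.sum_congr rfl fun a ha => ?_
        rw [integral_finsetSum _ fun b hb => hi _ (hI a ha b hb)]
        exact Finset.sum_congr rfl fun b hb => (integral_indicator_one (hI a ha b hb)).symm
    · exact fun a ha => integrable_finsetSum _ fun b hb => hi _ (hI a ha b hb)
    · exact fun a ha => hi _ (hE a ha)
    · exact integrable_finsetSum _ fun a ha => hi _ (hE a ha)
    · exact integrable_finsetSum _ fun a ha =>
        integrable_finsetSum _ fun b hb => hi _ (hI a ha b hb)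
  rw [h1, ← integral_indicator_one hU]
  refine integral_mono ?_ (hi _ hU) fun ω => ?_
  · refine (integrable_finsetSum _ fun a ha => hi _ (hE a ha)).sub
      (integrable_finsetSum _ fun a ha => integrable_finsetSum _ fun b hb => hi _ (hI a ha b hb))
  · classical
    -- If `c` events contain `ω`, the pointwise claim for `c ≥ 1` is `c - c(c-1) ≤ 1`, that is
    -- `(c-1)² ≥ 0`.
    set C : Finset α := A.filter fun a => ω ∈ E a with hC
    have hs1 : ∑ a ∈ A, (E a).indicator (1 : Ω → ℝ) ω = C.card := by
      rw [hC, Finset.card_filter]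
      push_cast
      exact Finset.sum_congr rfl fun a _ => by by_cases h : ω ∈ E a <;> simp [h]
    have hs2 : ∑ a ∈ A, ∑ b ∈ A.erase a, (E a ∩ E b).indicator (1 : Ω → ℝ) ω =
        C.card * (C.card - 1) := by
      have hin : ∀ a ∈ A, ∑ b ∈ A.erase a, (E a ∩ E b).indicator (1 : Ω → ℝ) ω =
          (E a).indicator (1 : Ω → ℝ) ω * (C.card - 1) := by
        intro a ha
        by_cases h : ω ∈ E a
        · have h2 : ∑ b ∈ A.erase a, (E a ∩ E b).indicator (1 : Ω → ℝ) ω =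
              ∑ b ∈ A.erase a, (E b).indicator (1 : Ω → ℝ) ω :=
            Finset.sum_congr rfl fun b _ => by by_cases hb : ω ∈ E b <;> simp [h, hb]
          rw [h2, ← hs1, ← Finset.add_sum_erase A _ ha]
          simp [h]
        · simp [h]
      rw [Finset.sum_congr rfl hin, ← Finset.sum_mul, hs1]
    simp only
    rw [hs1, hs2]
    by_cases h0 : C.card = 0
    · rw [h0]; simp; exact Set.indicator_nonneg (fun _ _ => zero_le_one) _
    · have hω : ω ∈ ⋃ a ∈ A, E a := by
        obtain ⟨a, ha⟩ := Finset.card_pos.1 (Nat.pos_of_ne_zero h0)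
        rw [hC, Finset.mem_filter] at ha
        exact Set.mem_biUnion ha.1 ha.2
      rw [Set.indicator_of_mem hω]
      have h1 : (1 : ℝ) ≤ C.card := by exact_mod_cast Nat.pos_of_ne_zero h0
      simp only [Pi.one_apply]
      nlinarith [sq_nonneg ((C.card : ℝ) - 1)]

end Bonferroni

section Events

variable {Ω ι W : Type*} [MeasurableSpace Ω] {P : Measure Ω} [IsProbabilityMeasure P] [Fintype W]
  {ζ : ι → Ω → W → ℂ}

/-- The event that the cross form of the vectors `i` and `j` exceeds its relative level. -/
def crossEvent (ζ : ι → Ω → W → ℂ) (g : W → ℂ) (x : ℝ) (i j : ι) : Set Ω :=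
  {ω | x * ∑ b, ‖g b‖ ^ 2 < ‖∑ b, g b * ζ i ω b * conj (ζ j ω b)‖ ^ 2}

lemma measurableSet_crossEvent (hm : ∀ i, Measurable (ζ i)) (g : W → ℂ) (x : ℝ) (i j : ι) :
    MeasurableSet (crossEvent ζ g x i j) :=
  ((hm i).prodMk (hm j)) (measurableSet_crossSet g x)

omit [MeasurableSpace Ω] in
-- Conjugating the form exchanges the two vectors, so a series shared by two pairs can always be put
-- in the first slot.
lemma crossEvent_swap (g : W → ℂ) (x : ℝ) (i j : ι) :
    crossEvent ζ g x i j = crossEvent ζ (fun b => conj (g b)) x j i := by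
  ext ω
  change x * _ < ‖_‖ ^ 2 ↔ x * _ < ‖_‖ ^ 2
  simp only [RCLike.norm_conj]
  rw [← RCLike.norm_conj (∑ b, g b * ζ i ω b * conj (ζ j ω b)), map_sum]
  have : ∀ b, conj (g b * ζ i ω b * conj (ζ j ω b)) = conj (g b) * ζ j ω b * conj (ζ i ω b) := by
    intro b; simp only [map_mul, Complex.conj_conj]; ring
  simp_rw [this]

variable (hm : ∀ i, Measurable (ζ i)) (hind : iIndepFun ζ P)
  (hlaw : ∀ i, P.map (ζ i) = stdCGaussVec W)

include hm hind hlaw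

lemma measureReal_crossEvent {i j : ι} (hij : i ≠ j) (g : W → ℂ) (x : ℝ) :
    P.real (crossEvent ζ g x i j) = ∫ z, condTail g x z ∂(stdCGaussVec W) := by
  have h := (indepFun_iff_map_prod_eq_prod_map_map (hm i).aemeasurable (hm j).aemeasurable).1
    (hind.indepFun hij)
  rw [hlaw, hlaw] at h
  have h1 : crossEvent ζ g x i j = (fun ω => (ζ i ω, ζ j ω)) ⁻¹' crossSet g x := rfl
  rw [h1, ← map_measureReal_apply ((hm i).prodMk (hm j)) (measurableSet_crossSet g x), h,
    measureReal_def, Measure.prod_apply (measurableSet_crossSet g x)]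
  simp_rw [condTail, measureReal_def]
  rw [integral_toReal (measurable_measure_prodMk_left (measurableSet_crossSet g x)).aemeasurable
    (Eventually.of_forall fun z => measure_lt_top _ _)]

/-- Once the shared vector is fixed, the slice of the intersection is a rectangle in two independent
vectors, so its probability factorizes. -/
lemma measureReal_crossEvent_inter {i j k : ι} (hij : i ≠ j) (hik : i ≠ k) (hjk : j ≠ k)
    (g g' : W → ℂ) (x : ℝ) :
    P.real (crossEvent ζ g x i j ∩ crossEvent ζ g' x i k) =
      ∫ z, condTail g x z * condTail g' x z ∂(stdCGaussVec W) := by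
  have h2 := (indepFun_iff_map_prod_eq_prod_map_map (hm j).aemeasurable (hm k).aemeasurable).1
    (hind.indepFun hjk)
  have h := (indepFun_iff_map_prod_eq_prod_map_map (hm i).aemeasurable
    ((hm j).prodMk (hm k)).aemeasurable).1
    (hind.indepFun_prodMk hm j k i hij.symm hik.symm).symm
  rw [h2, hlaw, hlaw, hlaw] at h
  set S : Set ((W → ℂ) × (W → ℂ) × (W → ℂ)) :=
    {p | (p.1, p.2.1) ∈ crossSet g x ∧ (p.1, p.2.2) ∈ crossSet g' x} with hS
  have hSm : MeasurableSet S :=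
    ((measurable_fst.prodMk (measurable_fst.comp measurable_snd)) (measurableSet_crossSet g x)).inter
      ((measurable_fst.prodMk (measurable_snd.comp measurable_snd)) (measurableSet_crossSet g' x))
  have h1 : crossEvent ζ g x i j ∩ crossEvent ζ g' x i k =
    (fun ω => (ζ i ω, ζ j ω, ζ k ω)) ⁻¹' S := rfl
  rw [h1, ← map_measureReal_apply ((hm i).prodMk ((hm j).prodMk (hm k))) hSm, h,
    measureReal_def, Measure.prod_apply hSm]
  have h3 : ∀ z, condTail g x z * condTail g' x z =
      (((stdCGaussVec W).prod (stdCGaussVec W)) (Prod.mk z ⁻¹' S)).toReal := by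
    intro z
    have : Prod.mk z ⁻¹' S = (Prod.mk z ⁻¹' crossSet g x) ×ˢ (Prod.mk z ⁻¹' crossSet g' x) := rfl
    rw [this, Measure.prod_prod, ENNReal.toReal_mul]; rfl
  simp_rw [h3]
  rw [integral_toReal (measurable_measure_prodMk_left hSm).aemeasurable
    (Eventually.of_forall fun z => measure_lt_top _ _)]

omit [IsProbabilityMeasure P] hlaw in
lemma measureReal_crossEvent_inter_of_disjoint {i j k l : ι} (hik : i ≠ k)
    (hil : i ≠ l) (hjk : j ≠ k) (hjl : j ≠ l) (g g' : W → ℂ) (x : ℝ) :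
    P.real (crossEvent ζ g x i j ∩ crossEvent ζ g' x k l) =
      P.real (crossEvent ζ g x i j) * P.real (crossEvent ζ g' x k l) := by
  have h := hind.indepFun_prodMk_prodMk hm i j k l hik hil hjk hjl
  have := h.measure_inter_preimage_eq_mul _ _ (measurableSet_crossSet g x)
    (measurableSet_crossSet g' x)
  rw [measureReal_def, measureReal_def, measureReal_def, ← ENNReal.toReal_mul]
  exact congrArg _ this

variable {m x : ℝ} {g g' : W → ℂ} (hg : 0 < ∑ b, ‖g b‖ ^ 2)
  (hgm : ∀ b, ‖g b‖ ^ 2 / ∑ a, ‖g a‖ ^ 2 ≤ m) (hg' : 0 < ∑ b, ‖g' b‖ ^ 2)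
  (hgm' : ∀ b, ‖g' b‖ ^ 2 / ∑ a, ‖g' a‖ ^ 2 ≤ m) (hm0 : 0 ≤ m)

include hg hgm in
lemma measureReal_crossEvent_le (hx : 0 ≤ x) (hxm : x * m ≤ 1 / 4) {i j : ι} (hij : i ≠ j) :
    P.real (crossEvent ζ g x i j) ≤ Real.exp (-x + x ^ 2 * m) := by
  rw [measureReal_crossEvent hm hind hlaw hij]
  exact integral_condTail_le hg hx hgm (by linarith)

include hg hgm in
lemma le_measureReal_crossEvent (hx : 2 ≤ x) {i j : ι} (hij : i ≠ j) :
    Real.exp (-x) * (1 - 2 * x * m) ≤ P.real (crossEvent ζ g x i j) := by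
  rw [measureReal_crossEvent hm hind hlaw hij]
  exact le_integral_condTail hg hx hgm

include hg hgm hg' hgm' hm0 in
-- Two different pairs share at most one index, in one of four positions, all reduced to a common
-- first vector by `crossEvent_swap`. Without a shared index the probabilities multiply, with the
-- smaller exponent `2x² m`.
lemma measureReal_crossEvent_inter_le (hx : 0 ≤ x) (hxm : x * m ≤ 1 / 4) {i j k l : ι}
    (hij : i ≠ j) (hkl : k ≠ l) (h1 : ¬ (i = k ∧ j = l)) (h2 : ¬ (i = l ∧ j = k)) :
    P.real (crossEvent ζ g x i j ∩ crossEvent ζ g' x k l) ≤ Real.exp (-2 * x + 4 * x ^ 2 * m) := by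
  have hgc : 0 < ∑ b, ‖conj (g b)‖ ^ 2 := by simpa only [RCLike.norm_conj] using hg
  have hgc' : 0 < ∑ b, ‖conj (g' b)‖ ^ 2 := by simpa only [RCLike.norm_conj] using hg'
  have hgmc : ∀ b, ‖conj (g b)‖ ^ 2 / ∑ a, ‖conj (g a)‖ ^ 2 ≤ m := by
    simpa only [RCLike.norm_conj] using hgm
  have hgmc' : ∀ b, ‖conj (g' b)‖ ^ 2 / ∑ a, ‖conj (g' a)‖ ^ 2 ≤ m := by
    simpa only [RCLike.norm_conj] using hgm'
  by_cases hik : i = k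
  · subst hik
    rw [measureReal_crossEvent_inter hm hind hlaw hij hkl (fun h => h1 ⟨rfl, h⟩)]
    exact integral_condTail_mul_le hg hg' hx hgm hgm' hxm
  by_cases hjl : j = l
  · subst hjl
    rw [crossEvent_swap, crossEvent_swap g',
      measureReal_crossEvent_inter hm hind hlaw hij.symm hkl.symm hik]
    exact integral_condTail_mul_le hgc hgc' hx hgmc hgmc' hxm
  by_cases hil : i = l
  · subst hil
    rw [crossEvent_swap g',
      measureReal_crossEvent_inter hm hind hlaw hij hkl.symm (fun h => h2 ⟨rfl, h⟩)]
    exact integral_condTail_mul_le hg hgc' hx hgm hgmc' hxm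
  by_cases hjk : j = k
  · subst hjk
    rw [crossEvent_swap,
      measureReal_crossEvent_inter hm hind hlaw hij.symm hkl hil]
    exact integral_condTail_mul_le hgc hg' hx hgmc hgm' hxm
  rw [measureReal_crossEvent_inter_of_disjoint hm hind hik hil hjk hjl]
  refine (mul_le_mul (measureReal_crossEvent_le hm hind hlaw hg hgm hx hxm hij)
    (measureReal_crossEvent_le hm hind hlaw hg' hgm' hx hxm hkl) measureReal_nonneg
    (Real.exp_pos _).le).trans ?_
  rw [← Real.exp_add]
  refine Real.exp_le_exp.2 ?_
  nlinarith [mul_nonneg (sq_nonneg x) hm0]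

end Events

section Union

variable {Ω ι W : Type*} [MeasurableSpace Ω] {P : Measure Ω} [IsProbabilityMeasure P] [Fintype W]
  [LinearOrder ι] {ζ : ι → Ω → W → ℂ}
  (hm : ∀ i, Measurable (ζ i)) (hind : iIndepFun ζ P)
  (hlaw : ∀ i, P.map (ζ i) = stdCGaussVec W)
  {m x : ℝ} (hm0 : 0 ≤ m) (g : ι × ι → W → ℂ) (A : Finset (ι × ι)) (hA : ∀ p ∈ A, p.1 < p.2)
  (hg : ∀ p ∈ A, 0 < ∑ b, ‖g p b‖ ^ 2)
  (hgm : ∀ p ∈ A, ∀ b, ‖g p b‖ ^ 2 / ∑ a, ‖g p a‖ ^ 2 ≤ m)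

include hm hind hlaw hA hg hgm

lemma measureReal_biUnion_crossEvent_le (hx : 0 ≤ x) (hxm : x * m ≤ 1 / 4) :
    P.real (⋃ p ∈ A, crossEvent ζ (g p) x p.1 p.2) ≤ A.card * Real.exp (-x + x ^ 2 * m) := by
  refine (measureReal_biUnion_finset_le A _).trans ?_
  rw [← nsmul_eq_mul]
  exact Finset.sum_le_card_nsmul _ _ _ fun p hp =>
    measureReal_crossEvent_le hm hind hlaw (hg p hp) (hgm p hp) hx hxm (hA p hp).ne

include hm0 in
lemma le_measureReal_biUnion_crossEvent (hx : 2 ≤ x) (hxm : x * m ≤ 1 / 4) :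
    A.card * (Real.exp (-x) * (1 - 2 * x * m)) -
        (A.card : ℝ) ^ 2 * Real.exp (-2 * x + 4 * x ^ 2 * m) ≤
      P.real (⋃ p ∈ A, crossEvent ζ (g p) x p.1 p.2) := by
  refine le_trans ?_ (sum_sub_sum_inter_le_measureReal_biUnion A _
    fun p _ => measurableSet_crossEvent hm (g p) x p.1 p.2)
  refine sub_le_sub ?_ ?_
  · rw [← nsmul_eq_mul]
    exact Finset.card_nsmul_le_sum _ _ _ fun p hp =>
      le_measureReal_crossEvent hm hind hlaw (hg p hp) (hgm p hp) hx (hA p hp).ne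
  · rw [sq, mul_assoc, ← nsmul_eq_mul]
    refine Finset.sum_le_card_nsmul _ _ _ fun p hp => ?_
    refine le_trans (Finset.sum_le_card_nsmul _ _ (Real.exp (-2 * x + 4 * x ^ 2 * m))
      fun q hq => ?_) ?_
    · have hqA := Finset.mem_of_mem_erase hq
      refine measureReal_crossEvent_inter_le hm hind hlaw (hg p hp) (hgm p hp) (hg q hqA)
        (hgm q hqA) hm0 (by linarith) hxm (hA p hp).ne (hA q hqA).ne (fun h => ?_) (fun h => ?_)
      · exact (Finset.ne_of_mem_erase hq) (Prod.ext h.1.symm h.2.symm)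
      -- A pair and its reversal would carry the same event up to conjugation; both being increasing
      -- excludes this.
      · have h1 := hA p hp
        have h2 := hA q hqA
        rw [h.1, h.2] at h1
        exact lt_asymm h1 h2
    · rw [nsmul_eq_mul]
      refine mul_le_mul_of_nonneg_right ?_ (Real.exp_pos _).le
      exact_mod_cast Finset.card_le_card (Finset.erase_subset _ _)

end Union

end SpectralCoherence

/-! ### Absolutely convergent Fourier series, Toeplitz forms and convolutions. -/

namespace SpectralCoherence

section Characters

/-- The character `ν ↦ e^{-2iπuν}`. -/
def fchar (u : ℤ) (ν : ℝ) : ℂ := Complex.exp (-2 * Real.pi * Complex.I * u * ν)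

lemma fchar_add (u v : ℤ) (ν : ℝ) : fchar (u + v) ν = fchar u ν * fchar v ν := by
  rw [fchar, fchar, fchar, ← Complex.exp_add]
  congr 1; push_cast; ring

lemma fchar_conj (u : ℤ) (ν : ℝ) : conj (fchar u ν) = fchar (-u) ν := by
  rw [fchar, fchar, ← Complex.exp_conj]
  congr 1
  simp only [map_mul, map_neg, Complex.conj_ofReal, Complex.conj_I, map_ofNat, map_intCast]
  push_cast; ring

lemma norm_fchar (u : ℤ) (ν : ℝ) : ‖fchar u ν‖ = 1 := by
  rw [fchar, show -2 * Real.pi * Complex.I * u * ν = ((-2 * Real.pi * u * ν : ℝ) : ℂ) * Complex.I by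
    push_cast; ring, Complex.norm_exp_ofReal_mul_I]

lemma continuous_fchar (u : ℤ) : Continuous (fchar u) := by
  unfold fchar; fun_prop

lemma fchar_add_int (u n : ℤ) (ν : ℝ) : fchar u (ν + n) = fchar u ν := by
  rw [fchar, fchar, Complex.exp_eq_exp_iff_exists_int]
  exact ⟨-(u * n), by push_cast; ring⟩

lemma fchar_zero (ν : ℝ) : fchar 0 ν = 1 := by simp [fchar]

lemma integral_fchar (u : ℤ) : ∫ ν in (0 : ℝ)..1, fchar u ν = if u = 0 then 1 else 0 := by
  split_ifs with h
  · subst h; simp [fchar_zero]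
  · have hc : (-2 * Real.pi * Complex.I * u : ℂ) ≠ 0 := by
      have : (Real.pi : ℂ) ≠ 0 := by exact_mod_cast Real.pi_ne_zero
      have : (u : ℂ) ≠ 0 := by exact_mod_cast h
      simp [*]
    have h2 := integral_exp_mul_complex (a := 0) (b := 1) hc
    unfold fchar
    rw [h2]
    have h3 : Complex.exp (-2 * Real.pi * Complex.I * u * (1 : ℝ)) = 1 := by
      rw [Complex.exp_eq_one_iff]
      exact ⟨-u, by push_cast; ring⟩
    rw [h3]; simp

variable {r : ℤ → ℂ} (hr : Summable fun u => ‖r u‖)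

/-- The Fourier series with coefficients `r`. -/
def fseries (r : ℤ → ℂ) (ν : ℝ) : ℂ := ∑' u : ℤ, r u * fchar u ν

include hr

lemma continuous_fseries : Continuous (fseries r) :=
  continuous_tsum (fun u => continuous_const.mul (continuous_fchar u)) hr
    fun u ν => by rw [norm_mul, norm_fchar, mul_one]

omit hr in
lemma fseries_add_int (ν : ℝ) (n : ℤ) : fseries r (ν + n) = fseries r ν := by
  simp_rw [fseries, fchar_add_int]

lemma norm_fseries_le (ν : ℝ) : ‖fseries r ν‖ ≤ ∑' u, ‖r u‖ := by
  refine (norm_tsum_le_tsum_norm ?_).trans_eq ?_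
  · simpa only [norm_mul, norm_fchar, mul_one] using hr
  · simp only [norm_mul, norm_fchar, mul_one]

lemma integral_fseries_mul_fchar (n : ℤ) :
    ∫ ν in (0 : ℝ)..1, fseries r ν * fchar (-n) ν = r n := by
  have h := intervalIntegral.hasSum_intervalIntegral_of_summable_norm (a := 0) (b := 1)
    (f := fun u : ℤ => (⟨fun ν => r u * fchar (u - n) ν,
      continuous_const.mul (continuous_fchar _)⟩ : C(ℝ, ℂ))) (by
      refine Summable.of_nonneg_of_le (fun _ => norm_nonneg _) (fun u => ?_) hr
      rw [ContinuousMap.norm_le _ (norm_nonneg _)]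
      intro ν
      simp [norm_fchar])
  have h1 : ∀ u : ℤ, ∫ ν in (0 : ℝ)..1, r u * fchar (u - n) ν = if u = n then r n else 0 := by
    intro u
    rw [intervalIntegral.integral_const_mul, integral_fchar]
    by_cases hu : u = n
    · simp [hu]
    · simp [hu, sub_eq_zero]
  simp only [ContinuousMap.coe_mk, h1] at h
  have h2 : ∀ ν, ∑' u : ℤ, r u * fchar (u - n) ν = fseries r ν * fchar (-n) ν := by
    intro ν
    rw [fseries, ← tsum_mul_right]
    congr 1; ext u
    rw [sub_eq_add_neg, fchar_add, mul_assoc]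
  simp only [h2] at h
  rw [← h.tsum_eq, tsum_ite_eq]

/-- The Toeplitz form of a summable sequence whose symbol is bounded below is coercive. -/
lemma toeplitz_coercive {κ : ℝ} (hκ : ∀ ν ∈ Set.Icc (0 : ℝ) 1, κ ≤ (fseries r ν).re)
    (S : Finset ℤ) (c : ℤ → ℂ) :
    κ * ∑ k ∈ S, ‖c k‖ ^ 2 ≤ (∑ k ∈ S, ∑ l ∈ S, conj (c k) * c l * r (l - k)).re := by
  -- The Toeplitz form is the integral of the symbol against `‖p‖²`, and Parseval identifies `∑ ‖c
  -- k‖²` with the integral of `‖p‖²`.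
  set p : ℝ → ℂ := fun ν => ∑ l ∈ S, c l * fchar (-l) ν with hp
  have hpc : Continuous p := continuous_finsetSum _ fun l _ => continuous_const.mul (continuous_fchar _)
  have hpp : ∀ ν, conj (p ν) * p ν = ∑ k ∈ S, ∑ l ∈ S, conj (c k) * c l * fchar (-(l - k)) ν := by
    intro ν
    simp only [hp, map_sum, map_mul, fchar_conj, neg_neg, Finset.sum_mul_sum]
    refine Finset.sum_congr rfl fun k _ => Finset.sum_congr rfl fun l _ => ?_
    rw [show -(l - k) = k + -l by ring, fchar_add]; ring
  have hint : ∀ F : ℝ → ℂ, Continuous F → ∫ ν in (0 : ℝ)..1, F ν * (conj (p ν) * p ν) =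
      ∑ k ∈ S, ∑ l ∈ S, conj (c k) * c l * ∫ ν in (0 : ℝ)..1, F ν * fchar (-(l - k)) ν := by
    intro F hF
    have hcont : ∀ k l : ℤ, Continuous fun ν => F ν * (conj (c k) * c l * fchar (-(l - k)) ν) :=
      fun k l => hF.mul (continuous_const.mul (continuous_fchar _))
    simp_rw [hpp, Finset.mul_sum]
    rw [intervalIntegral.integral_finsetSum fun k _ =>
      (continuous_finsetSum _ fun l _ => hcont k l).intervalIntegrable 0 1]
    refine Finset.sum_congr rfl fun k _ => ?_
    rw [intervalIntegral.integral_finsetSum fun l _ => (hcont k l).intervalIntegrable 0 1]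
    refine Finset.sum_congr rfl fun l _ => ?_
    rw [← intervalIntegral.integral_const_mul]
    congr 1; ext ν; ring
  have h1 := hint _ (continuous_fseries hr)
  simp_rw [integral_fseries_mul_fchar hr] at h1
  have h2 := hint (fun _ => 1) continuous_const
  simp_rw [one_mul, integral_fchar] at h2
  have h3 : ∑ k ∈ S, ∑ l ∈ S, conj (c k) * c l * (if -(l - k) = 0 then 1 else 0) =
      ((∑ k ∈ S, ‖c k‖ ^ 2 : ℝ) : ℂ) := by
    push_cast
    refine Finset.sum_congr rfl fun k hk => ?_
    rw [Finset.sum_eq_single_of_mem k hk]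
    · simp [← Complex.conj_mul']
    · intro l _ hl
      rw [if_neg (by simpa [sub_eq_zero] using Ne.symm hl), mul_zero]
  rw [h3] at h2
  rw [← h1]
  have hcs : Continuous fun ν => fseries r ν * (conj (p ν) * p ν) :=
    (continuous_fseries hr).mul ((Complex.continuous_conj.comp hpc).mul hpc)
  have hre : ∀ F : ℝ → ℂ, Continuous F →
      (∫ ν in (0 : ℝ)..1, F ν).re = ∫ ν in (0 : ℝ)..1, (F ν).re := fun F hF =>
    (Complex.reCLM.intervalIntegral_comp_comm (hF.intervalIntegrable 0 1)).symm
  rw [hre _ hcs]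
  have hsq : ∀ ν, conj (p ν) * p ν = ((‖p ν‖ ^ 2 : ℝ) : ℂ) := fun ν => by
    rw [Complex.conj_mul']; push_cast; rfl
  have h4 : ∑ k ∈ S, ‖c k‖ ^ 2 = ∫ ν in (0 : ℝ)..1, ‖p ν‖ ^ 2 := by
    have h5 := congrArg Complex.re h2
    rw [hre (fun ν => conj (p ν) * p ν) ((Complex.continuous_conj.comp hpc).mul hpc), Complex.ofReal_re] at h5
    rw [← h5]
    simp_rw [hsq, Complex.ofReal_re]
  rw [h4, ← intervalIntegral.integral_const_mul]
  refine intervalIntegral.integral_mono_on zero_le_one ?_ ?_ fun ν hν => ?_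
  · exact Continuous.intervalIntegrable (by fun_prop) 0 1
  · exact Continuous.intervalIntegrable (Complex.continuous_re.comp hcs) 0 1
  · rw [hsq, Complex.re_mul_ofReal]
    exact mul_le_mul_of_nonneg_right (hκ ν hν) (by positivity)

/-- Fourier series of a convolution. -/
lemma fseries_conv {c : ℕ → ℂ} (hc : Summable fun j => ‖c j‖) (τ : ℕ → ℤ) :
    (Summable fun k => ‖∑' j, c j * r (k - τ j)‖) ∧
    ∀ ν, fseries (fun k => ∑' j, c j * r (k - τ j)) ν =
      (∑' j, c j * fchar (τ j) ν) * fseries r ν := by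
  -- This shear turns the convolution into a product family, for which absolute summability and
  -- interchange of sums are immediate. The shifts `τ j = j` and `τ j = -j` are both needed later.
  let eq : ℕ × ℤ ≃ ℕ × ℤ :=
    { toFun := fun p => (p.1, p.2 - τ p.1)
      invFun := fun p => (p.1, p.2 + τ p.1)
      left_inv := fun p => by simp
      right_inv := fun p => by simp }
  have hprod : Summable fun p : ℕ × ℤ => ‖c p.1‖ * ‖r p.2‖ :=
    hc.mul_of_nonneg hr (fun _ => norm_nonneg _) (fun _ => norm_nonneg _)
  have h1 : Summable fun p : ℕ × ℤ => ‖c p.1 * r (p.2 - τ p.1)‖ := by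
    simpa only [norm_mul] using! (eq.summable_iff.2 hprod)
  have h1' : Summable fun p : ℤ × ℕ => ‖c p.2 * r (p.1 - τ p.2)‖ :=
    ((Equiv.prodComm ℤ ℕ).summable_iff.2 h1)
  have hfib : ∀ k, Summable fun j => ‖c j * r (k - τ j)‖ := fun k => h1'.prod_factor k
  refine ⟨?_, fun ν => ?_⟩
  · refine Summable.of_nonneg_of_le (fun _ => norm_nonneg _)
      (fun k => norm_tsum_le_tsum_norm (hfib k)) ?_
    exact h1'.prod
  · have hsc : Summable fun j => ‖c j * fchar (τ j) ν‖ := by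
      simpa only [norm_mul, norm_fchar, mul_one] using hc
    have hsr : Summable fun u => ‖r u * fchar u ν‖ := by
      simpa only [norm_mul, norm_fchar, mul_one] using hr
    rw [fseries, fseries, tsum_mul_tsum_of_summable_norm hsc hsr, ← eq.tsum_eq,
      ← (Equiv.prodComm ℤ ℕ).tsum_eq]
    have hval : ∀ p : ℤ × ℕ, c (eq (Equiv.prodComm ℤ ℕ p)).1 * fchar (τ (eq (Equiv.prodComm ℤ ℕ p)).1) ν *
        (r (eq (Equiv.prodComm ℤ ℕ p)).2 * fchar (eq (Equiv.prodComm ℤ ℕ p)).2 ν) =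
        c p.2 * r (p.1 - τ p.2) * fchar p.1 ν := by
      intro p
      simp only [eq, Equiv.coe_fn_mk, Equiv.prodComm_apply, Prod.fst_swap, Prod.snd_swap]
      have : fchar p.1 ν = fchar (τ p.2) ν * fchar (p.1 - τ p.2) ν := by
        rw [← fchar_add]; congr 1; ring
      rw [this]; ring
    simp_rw [hval]
    rw [Summable.tsum_prod' (Summable.of_norm (by
      simpa only [norm_mul, norm_fchar, mul_one] using h1'))]
    · simp_rw [tsum_mul_right]
    · intro k
      exact Summable.of_norm (by simpa only [norm_mul, norm_fchar, mul_one] using hfib k)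

end Characters

end SpectralCoherence

/-! ### Predictors of finite order, uniform bounds, and the predictor of infinite order. -/

namespace SpectralCoherence

/-- Schur test for nonnegative Toeplitz kernels, in an additive form. -/
lemma schur_toeplitz {ρ : ℤ → ℝ} (hρ0 : ∀ u, 0 ≤ ρ u) (hρ : Summable ρ) {R : ℝ}
    (hR : ∑' u, ρ u ≤ R) (S : Finset ℕ) (a b : ℕ → ℝ) {η : ℝ} (hη : 0 < η) :
    ∑ l ∈ S, ∑ k ∈ S, a l * b k * ρ (l - k) ≤
      R / 2 * (η * ∑ l ∈ S, a l ^ 2 + η⁻¹ * ∑ k ∈ S, b k ^ 2) := by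
  have hbound : ∀ f : ℕ → ℤ, Function.Injective f → ∑ k ∈ S, ρ (f k) ≤ R := fun f hf =>
    ((Summable.sum_le_tsum S (fun _ _ => hρ0 _) (hρ.comp_injective hf)).trans
      (tsum_comp_le_tsum_of_inj hρ hρ0 hf)).trans hR
  have h1 : ∀ l : ℕ, ∑ k ∈ S, ρ ((l : ℤ) - k) ≤ R := fun l =>
    hbound (fun k => (l : ℤ) - k) fun i j h => by simpa using h
  have h2 : ∀ k : ℕ, ∑ l ∈ S, ρ ((l : ℤ) - k) ≤ R := fun k =>
    hbound (fun l => (l : ℤ) - k) fun i j h => by simpa using h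
  have h3 : ∀ l k : ℕ, a l * b k * ρ (l - k) ≤
      η / 2 * a l ^ 2 * ρ (l - k) + η⁻¹ / 2 * b k ^ 2 * ρ (l - k) := by
    intro l k
    rw [← add_mul]
    refine mul_le_mul_of_nonneg_right ?_ (hρ0 _)
    have h4 : 0 ≤ η⁻¹ / 2 * (η * a l - b k) ^ 2 := by positivity
    have h5 : η⁻¹ / 2 * (η * a l - b k) ^ 2 =
        η / 2 * a l ^ 2 + η⁻¹ / 2 * b k ^ 2 - a l * b k := by field_simp; ring
    linarith
  calc ∑ l ∈ S, ∑ k ∈ S, a l * b k * ρ (l - k)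
      ≤ ∑ l ∈ S, ∑ k ∈ S, (η / 2 * a l ^ 2 * ρ (l - k) + η⁻¹ / 2 * b k ^ 2 * ρ (l - k)) :=
        Finset.sum_le_sum fun l _ => Finset.sum_le_sum fun k _ => h3 l k
    _ = ∑ l ∈ S, η / 2 * a l ^ 2 * ∑ k ∈ S, ρ (l - k) +
        ∑ k ∈ S, η⁻¹ / 2 * b k ^ 2 * ∑ l ∈ S, ρ (l - k) := by
        simp_rw [Finset.sum_add_distrib, Finset.mul_sum]
        congr 1
        exact Finset.sum_comm
    _ ≤ ∑ l ∈ S, η / 2 * a l ^ 2 * R + ∑ k ∈ S, η⁻¹ / 2 * b k ^ 2 * R :=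
        add_le_add (Finset.sum_le_sum fun l _ => mul_le_mul_of_nonneg_left (h1 l) (by positivity))
          (Finset.sum_le_sum fun k _ => mul_le_mul_of_nonneg_left (h2 k) (by positivity))
    _ = _ := by
        rw [← Finset.sum_mul, ← Finset.sum_mul, ← Finset.mul_sum, ← Finset.mul_sum]; ring

section Hilbert

variable {H : Type*} [NormedAddCommGroup H] [InnerProductSpace ℂ H] {y : ℤ → H}
  {r : ℤ → ℂ} (hy : ∀ n u, inner ℂ (y n) (y (n + u)) = r u)

include hy

lemma inner_stationary (m n : ℤ) : inner ℂ (y m) (y n) = r (n - m) := by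
  rw [← hy m (n - m)]; congr 2; ring

lemma norm_sq_sum_stationary (S : Finset ℤ) (c : ℤ → ℂ) :
    ‖∑ k ∈ S, c k • y k‖ ^ 2 = (∑ k ∈ S, ∑ l ∈ S, conj (c k) * c l * r (l - k)).re := by
  rw [← inner_self_eq_norm_sq (𝕜 := ℂ), sum_inner]
  simp_rw [inner_sum, inner_smul_left, inner_smul_right, inner_stationary hy]
  simp only [RCLike.re_to_complex]
  congr 1
  refine Finset.sum_congr rfl fun k _ => Finset.sum_congr rfl fun l _ => by ring

variable (hr : Summable fun u => ‖r u‖)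
  {κ : ℝ} (hκ0 : 0 < κ) (hκ : ∀ ν ∈ Set.Icc (0 : ℝ) 1, κ ≤ (fseries r ν).re)

include hr hκ in
-- A symbol bounded below makes the sequence satisfy a lower Riesz bound: the norm of a combination
-- controls its coefficients.
lemma riesz_lower (S : Finset ℤ) (c : ℤ → ℂ) :
    κ * ∑ k ∈ S, ‖c k‖ ^ 2 ≤ ‖∑ k ∈ S, c k • y k‖ ^ 2 := by
  rw [norm_sq_sum_stationary hy]; exact toeplitz_coercive hr hκ S c

include hr hκ in
lemma riesz_lower_nat (n : ℤ) (S : Finset ℕ) (c : ℕ → ℂ) :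
    κ * ∑ k ∈ S, ‖c k‖ ^ 2 ≤ ‖∑ k ∈ S, c k • y (n - k)‖ ^ 2 := by
  have h := riesz_lower hy hr hκ (S.image fun k : ℕ => n - (k : ℤ)) (fun j => c (n - j).toNat)
  have hinj : Set.InjOn (fun k : ℕ => n - (k : ℤ)) S := fun i _ j _ h => by simpa using h
  rw [Finset.sum_image hinj, Finset.sum_image hinj] at h
  simpa using h

variable {R : ℝ} (hR0 : 0 < R) (hρ : Summable fun u : ℤ => |(u : ℝ)| * ‖r u‖)
  (hR : ∑' u : ℤ, |(u : ℝ)| * ‖r u‖ ≤ R)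

omit hy in
lemma sum_range_eq_of_zero {E : Type*} [AddCommMonoid E] {n : ℕ} {f : ℕ → E}
    (hf : ∀ k, n < k → f k = 0) (m : ℕ) (hm : n + 1 ≤ m) :
    ∑ k ∈ Finset.range m, f k = ∑ k ∈ Finset.range (n + 1), f k := by
  refine (Finset.sum_subset (Finset.range_mono hm) fun k _ hk => hf k ?_).symm
  simp at hk; omega

include hr hκ hκ0 hR0 hρ hR in
/-- Coefficients of the prediction error of finite order, with bounds uniform in the order. -/
lemma exists_finite_predictor (n : ℕ) : ∃ d : ℕ → ℂ, d 0 = 1 ∧ (∀ k, n < k → d k = 0) ∧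
    (∀ l : ℕ, 1 ≤ l → l ≤ n → ∑' k : ℕ, d k * r (l - k) = 0) ∧
    (∀ k, ‖d k‖ ^ 2 ≤ ‖y 0‖ ^ 2 / κ) ∧
    ∀ m, ∑ k ∈ Finset.range m, (k : ℝ) ^ 2 * ‖d k‖ ^ 2 ≤ (R / κ) ^ 2 * (‖y 0‖ ^ 2 / κ) := by
  let K : Submodule ℂ H := Submodule.span ℂ (Set.range fun k : Fin n => y (-((k : ℤ) + 1)))
  have : FiniteDimensional ℂ K := FiniteDimensional.span_of_finite ℂ (Set.finite_range _)
  obtain ⟨c, hc⟩ := Submodule.mem_span_range_iff_exists_fun ℂ |>.1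
    (K.starProjection_apply_mem (y 0))
  let d : ℕ → ℂ := fun k => match k with
    | 0 => 1
    | k + 1 => if h : k < n then -c ⟨k, h⟩ else 0
  have hd0 : d 0 = 1 := rfl
  have hdn : ∀ k, n < k → d k = 0 := by
    intro k hk
    obtain ⟨k, rfl⟩ : ∃ j, k = j + 1 := ⟨k - 1, by omega⟩
    simp only [d]
    rw [dif_neg (by omega)]
  set e : H := y 0 - K.starProjection (y 0) with he
  have hsum : ∑ k ∈ Finset.range (n + 1), d k • y (0 - k) = e := by
    rw [Finset.sum_range_succ', he, ← hc, Finset.sum_range]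
    simp only [hd0, d, Fin.is_lt, dif_pos, Fin.eta, neg_smul, Finset.sum_neg_distrib]
    have h1 : ∀ k : Fin n, (0 : ℤ) - ((k + 1 : ℕ) : ℤ) = -((k : ℤ) + 1) := fun k => by
      push_cast; ring
    simp only [h1, one_smul, Nat.cast_zero, sub_zero]
    rw [add_comm, sub_eq_add_neg]
  have hort : ∀ l : ℕ, 1 ≤ l → l ≤ n → inner ℂ (y (0 - l)) e = 0 := by
    intro l hl hln
    refine (Submodule.mem_orthogonal _ _).1 (K.sub_starProjection_mem_orthogonal (y 0)) _ ?_
    refine Submodule.subset_span ⟨⟨l - 1, by omega⟩, ?_⟩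
    simp only
    congr 1; omega
  have hinner : ∀ l : ℕ, inner ℂ (y (0 - l)) e = ∑ k ∈ Finset.range (n + 1), d k * r (l - k) := by
    intro l
    rw [← hsum, inner_sum]
    refine Finset.sum_congr rfl fun k _ => ?_
    rw [inner_smul_right, inner_stationary hy]
    congr 2; ring
  have hnorm : ‖e‖ ^ 2 ≤ ‖y 0‖ ^ 2 := by
    have h1 : ‖e‖ ^ 2 = (inner ℂ e (y 0)).re := by
      rw [← inner_self_eq_norm_sq (𝕜 := ℂ)]
      nth_rewrite 2 [he]
      rw [inner_sub_right, (Submodule.mem_orthogonal' _ _).1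
        (K.sub_starProjection_mem_orthogonal (y 0)) _ (K.starProjection_apply_mem (y 0)), sub_zero]
      rfl
    have h2 : (inner ℂ e (y 0)).re ≤ ‖e‖ * ‖y 0‖ := (Complex.re_le_norm _).trans (norm_inner_le_norm _ _)
    nlinarith [norm_nonneg e, norm_nonneg (y 0), sq_nonneg (‖e‖ - ‖y 0‖)]
  -- The prediction error is no longer than `y 0`, so the Riesz bound controls its coefficients
  -- whatever the order `n`.
  have hD : ∑ k ∈ Finset.range (n + 1), ‖d k‖ ^ 2 ≤ ‖y 0‖ ^ 2 / κ := by
    rw [le_div_iff₀ hκ0, mul_comm]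
    refine (riesz_lower_nat hy hr hκ 0 (Finset.range (n + 1)) d).trans ?_
    rw [hsum]; exact hnorm
  refine ⟨d, hd0, hdn, fun l hl hln => ?_, fun k => ?_, fun m => ?_⟩
  · rw [tsum_eq_sum (s := Finset.range (n + 1)), ← hinner, hort l hl hln]
    intro k hk
    rw [hdn k (by simpa using hk), zero_mul]
  · by_cases hk : n < k
    · rw [hdn k hk]; simp; positivity
    · exact (Finset.single_le_sum (f := fun k => ‖d k‖ ^ 2) (fun _ _ => by positivity)
        (Finset.mem_range.2 (by omega))).trans hD
  · set w : ℕ → ℂ := fun k => k * d k with hw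
    set X := ∑ k ∈ Finset.range (n + 1), ‖w k‖ ^ 2 with hX
    have hXeq : X = ∑ k ∈ Finset.range (n + 1), (k : ℝ) ^ 2 * ‖d k‖ ^ 2 := by
      refine Finset.sum_congr rfl fun k _ => ?_
      simp only [w]
      rw [norm_mul, mul_pow, Complex.norm_natCast]
    have hle : ∑ k ∈ Finset.range m, (k : ℝ) ^ 2 * ‖d k‖ ^ 2 ≤ X := by
      rw [hXeq, ← sum_range_eq_of_zero (f := fun k => (k : ℝ) ^ 2 * ‖d k‖ ^ 2)
        (fun k hk => by simp [hdn k hk]) (max m (n + 1)) (le_max_right _ _)]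
      exact Finset.sum_le_sum_of_subset_of_nonneg (Finset.range_mono (le_max_left _ _))
        fun _ _ _ => by positivity
    refine hle.trans ?_
    -- Commutator trick: since the error is orthogonal to `y (-l)`, one may subtract `l * ∑ d k * r
    -- (l - k) = 0`, which replaces the weight `k` by `k - l`. That factor is absorbed by the
    -- summability of `|u| ‖r u‖`. For `l = 0` the subtracted term is trivially zero.
    have hfw : ∀ l ∈ Finset.range (n + 1),
        inner ℂ (w l • y (0 - l)) (∑ k ∈ Finset.range (n + 1), w k • y (0 - k)) =
        ∑ k ∈ Finset.range (n + 1), conj (w l) * d k * ((k - l : ℂ) * r (l - k)) := by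
      intro l hl
      have h1 : (l : ℂ) * ∑ k ∈ Finset.range (n + 1), d k * r (l - k) = 0 ∨ l = 0 := by
        rcases Nat.eq_zero_or_pos l with h | h
        · exact Or.inr h
        · left; rw [← hinner, hort l h (by simp at hl; omega), mul_zero]
      have h2 : (l : ℂ) * ∑ k ∈ Finset.range (n + 1), d k * r (l - k) = 0 := by
        rcases h1 with h | h
        · exact h
        · rw [h]; simp
      rw [inner_smul_left, inner_sum]
      simp_rw [inner_smul_right, inner_stationary hy, mul_assoc]
      rw [← Finset.mul_sum]
      congr 1
      rw [← sub_zero (∑ i ∈ Finset.range (n + 1), _), ← h2, Finset.mul_sum, ← Finset.sum_sub_distrib]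
      refine Finset.sum_congr rfl fun k _ => ?_
      simp only [w]
      rw [show (0 - (k : ℤ) - (0 - (l : ℤ))) = l - k by ring]
      ring
    have h3 : κ * X ≤ ∑ l ∈ Finset.range (n + 1), ∑ k ∈ Finset.range (n + 1),
        ‖w l‖ * ‖d k‖ * (|(((l : ℤ) - (k : ℤ) : ℤ) : ℝ)| * ‖r (l - k)‖) := by
      refine (riesz_lower_nat hy hr hκ 0 (Finset.range (n + 1)) w).trans ?_
      rw [← inner_self_eq_norm_sq (𝕜 := ℂ), sum_inner, Finset.sum_congr rfl hfw]
      refine (Complex.re_le_norm _).trans ((norm_sum_le _ _).trans (Finset.sum_le_sum fun l _ =>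
        (norm_sum_le _ _).trans (Finset.sum_le_sum fun k _ => ?_)))
      rw [norm_mul, norm_mul, norm_mul, RCLike.norm_conj]
      have : ‖(k - l : ℂ)‖ = |(((l : ℤ) - (k : ℤ) : ℤ) : ℝ)| := by
        rw [norm_sub_rev, show (l - k : ℂ) = ((((l : ℤ) - (k : ℤ) : ℤ) : ℝ) : ℂ) by push_cast; rfl,
          Complex.norm_real, Real.norm_eq_abs]
      rw [this]
    -- With `η = κ / R` the contribution of `w` is `κ / 2 * X`, half of the left side, and is
    -- absorbed there.
    have h4 := schur_toeplitz (ρ := fun u : ℤ => |(u : ℝ)| * ‖r u‖) (fun u => by positivity) hρ hR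
      (Finset.range (n + 1)) (fun k => ‖w k‖) (fun k => ‖d k‖) (η := κ / R) (by positivity)
    have h5 := h3.trans h4
    have h6 : R / 2 * (κ / R * X + (κ / R)⁻¹ * ∑ k ∈ Finset.range (n + 1), ‖d k‖ ^ 2) =
        κ / 2 * X + R ^ 2 / (2 * κ) * ∑ k ∈ Finset.range (n + 1), ‖d k‖ ^ 2 := by
      field_simp
    rw [h6] at h5
    have h7 : R ^ 2 / (2 * κ) * ∑ k ∈ Finset.range (n + 1), ‖d k‖ ^ 2 ≤
        R ^ 2 / (2 * κ) * (‖y 0‖ ^ 2 / κ) := mul_le_mul_of_nonneg_left hD (by positivity)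
    have h8 : (R / κ) ^ 2 * (‖y 0‖ ^ 2 / κ) =
        2 / κ * (R ^ 2 / (2 * κ) * (‖y 0‖ ^ 2 / κ)) := by field_simp
    rw [h8]
    have h9 : κ / 2 * X ≤ R ^ 2 / (2 * κ) * (‖y 0‖ ^ 2 / κ) := by linarith
    have h10 := mul_le_mul_of_nonneg_left h9 (by positivity : 0 ≤ 2 / κ)
    calc X = 2 / κ * (κ / 2 * X) := by field_simp
      _ ≤ _ := h10

omit hy in
-- Write `‖d k‖ = (k ‖d k‖) * (1/k)` for `k ≥ 1`: a product of two square summable sequences.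
lemma summable_of_weighted {d : ℕ → ℂ} {C : ℝ}
    (hd : ∀ m, ∑ k ∈ Finset.range m, (k : ℝ) ^ 2 * ‖d k‖ ^ 2 ≤ C) : Summable fun k => ‖d k‖ := by
  have h1 : Summable fun k : ℕ => (k : ℝ) ^ 2 * ‖d k‖ ^ 2 :=
    summable_of_sum_range_le (fun k => by positivity) hd
  have h2 : Summable fun k : ℕ => 1 / (k : ℝ) ^ 2 := Real.summable_one_div_nat_pow.2 one_lt_two
  rw [← summable_nat_add_iff 1]
  refine Summable.of_nonneg_of_le (fun _ => norm_nonneg _) (fun k => ?_)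
    ((summable_nat_add_iff 1).2 (h1.add h2))
  have hk : (0 : ℝ) < ((k + 1 : ℕ) : ℝ) := by positivity
  have h3 : ‖d (k + 1)‖ = (((k + 1 : ℕ) : ℝ) * ‖d (k + 1)‖) * (1 / ((k + 1 : ℕ) : ℝ)) := by field_simp
  have h4 := sq_nonneg ((((k + 1 : ℕ) : ℝ) * ‖d (k + 1)‖) - (1 / ((k + 1 : ℕ) : ℝ)))
  have h5 : (0 : ℝ) ≤ (((k + 1 : ℕ) : ℝ) * ‖d (k + 1)‖) ^ 2 := by positivity
  have h6 : (1 / ((k + 1 : ℕ) : ℝ)) ^ 2 = 1 / ((k + 1 : ℕ) : ℝ) ^ 2 := by rw [div_pow, one_pow]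
  have h7 : (((k + 1 : ℕ) : ℝ) * ‖d (k + 1)‖) ^ 2 = ((k + 1 : ℕ) : ℝ) ^ 2 * ‖d (k + 1)‖ ^ 2 := mul_pow _ _ _
  have h8 : (0 : ℝ) ≤ 1 / ((k + 1 : ℕ) : ℝ) ^ 2 := by positivity
  nlinarith

include hr hκ hκ0 hR0 hρ hR in
/-- Coefficients of the prediction error of infinite order. -/
lemma exists_predictor : ∃ d : ℕ → ℂ, d 0 = 1 ∧ (Summable fun k => ‖d k‖) ∧
    ∀ l : ℕ, 1 ≤ l → ∑' k : ℕ, d k * r (l - k) = 0 := by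
  choose d hd0 hdn hdl hdb hdm using exists_finite_predictor hy hr hκ0 hκ hR0 hρ hR
  set C := ‖y 0‖ ^ 2 / κ + 1 with hC
  have hdC : ∀ n k, ‖d n k‖ ≤ C := by
    intro n k
    have := hdb n k
    nlinarith [norm_nonneg (d n k), sq_nonneg (‖d n k‖ - 1)]
  -- Tychonoff provides a subsequence of orders along which every coefficient converges. The
  -- weighted bound passes to the limit on partial sums, and the normal equations by dominated
  -- convergence, `r` being summable.
  have hcomp : IsCompact (Set.univ.pi fun _ : ℕ => Metric.closedBall (0 : ℂ) C) :=
    isCompact_univ_pi fun _ => isCompact_closedBall 0 C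
  obtain ⟨a, ha, φ, hφ, hlim⟩ := hcomp.tendsto_subseq (x := d) (fun n k _ => by
    simpa using hdC n k)
  have hk : ∀ k, Tendsto (fun j => d (φ j) k) atTop (𝓝 (a k)) := fun k =>
    (tendsto_pi_nhds.1 hlim) k
  refine ⟨a, ?_, ?_, ?_⟩
  · refine tendsto_nhds_unique (hk 0) ?_
    simp only [hd0]; exact tendsto_const_nhds
  · refine summable_of_weighted (C := (R / κ) ^ 2 * (‖y 0‖ ^ 2 / κ)) fun m => ?_
    refine le_of_tendsto (tendsto_finsetSum (Finset.range m) fun k _ =>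
      (((hk k).norm.pow 2).const_mul ((k : ℝ) ^ 2))) (Eventually.of_forall fun j => hdm (φ j) m)
  · intro l hl
    have h1 : Tendsto (fun j => ∑' k : ℕ, d (φ j) k * r (l - k)) atTop
        (𝓝 (∑' k : ℕ, a k * r (l - k))) := by
      refine tendsto_tsum_of_dominated_convergence (bound := fun k : ℕ => C * ‖r (l - k)‖) ?_
        (fun k => (hk k).mul_const _) (Eventually.of_forall fun j k => ?_)
      · exact (hr.comp_injective (i := fun k : ℕ => (l : ℤ) - k)
          (fun i j h => by simpa using h)).mul_left C
      · rw [norm_mul]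
        exact mul_le_mul_of_nonneg_right (hdC _ _) (norm_nonneg _)
    refine tendsto_nhds_unique h1 ?_
    refine tendsto_const_nhds.congr' ?_
    filter_upwards [eventually_ge_atTop l] with j hj
    exact (hdl (φ j) l hl (hj.trans hφ.le_apply)).symm

end Hilbert

end SpectralCoherence

/-! ### Innovations in a Hilbert space and spectral factorization. -/

namespace SpectralCoherence

section Whitening

variable {H : Type*} [NormedAddCommGroup H] [InnerProductSpace ℂ H]

/-- Closed linear past of a sequence in a Hilbert space. -/
def closedPast (y : ℤ → H) (n : ℤ) : Submodule ℂ H :=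
  (Submodule.span ℂ {z : H | ∃ k : ℤ, k < n ∧ z = y k}).topologicalClosure

lemma mem_closedPast {y : ℤ → H} {k n : ℤ} (h : k < n) : y k ∈ closedPast y n :=
  Submodule.le_topologicalClosure _ (Submodule.subset_span ⟨k, h, rfl⟩)

lemma closedPast_mono (y : ℤ → H) {m n : ℤ} (h : m ≤ n) : closedPast y m ≤ closedPast y n :=
  Submodule.topologicalClosure_mono
    (Submodule.span_mono fun _ ⟨k, hk, hz⟩ => ⟨k, hk.trans_le h, hz⟩)

lemma isClosed_closedPast (y : ℤ → H) (n : ℤ) : IsClosed (closedPast y n : Set H) :=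
  Submodule.isClosed_topologicalClosure _

lemma mem_closedPast_orthogonal {y : ℤ → H} {n : ℤ} {e : H} (h : ∀ k < n, inner ℂ (y k) e = 0) :
    e ∈ (closedPast y n)ᗮ := by
  rw [closedPast, Submodule.orthogonal_closure, Submodule.mem_orthogonal]
  intro u hu
  induction hu using Submodule.span_induction with
  | mem x hx => obtain ⟨k, hk, rfl⟩ := hx; exact h k hk
  | zero => simp
  | add a b _ _ ha hb => rw [inner_add_left, ha, hb, add_zero]
  | smul c a _ ha => rw [inner_smul_left, ha, mul_zero]

variable [CompleteSpace H] {y : ℤ → H}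
  {r : ℤ → ℂ} (hy : ∀ n u, inner ℂ (y n) (y (n + u)) = r u)
  (hr : Summable fun u => ‖r u‖)
  {κ : ℝ} (hκ0 : 0 < κ) (hκ : ∀ ν ∈ Set.Icc (0 : ℝ) 1, κ ≤ (fseries r ν).re)
  {R : ℝ} (hR0 : 0 < R) (hρ : Summable fun u : ℤ => |(u : ℝ)| * ‖r u‖)
  (hR : ∑' u : ℤ, |(u : ℝ)| * ‖r u‖ ≤ R)

include hy hr hκ0 hκ hR0 hρ hR

/-- The innovations of a short memory stationary sequence with spectral density bounded below: the
correlations with the sequence give the coefficients of a spectral factor. -/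
theorem exists_whitening : ∃ (e : ℤ → H) (v : ℝ), 0 < v ∧ (∀ n, y n - e n ∈ closedPast y n) ∧
    (∀ n, e n ∈ (closedPast y n)ᗮ) ∧ (∀ n, ‖e n‖ ^ 2 = v) ∧
    ∀ ν, ‖∑' k : ℕ, inner ℂ (e 0) (y k) * fchar k ν‖ ^ 2 = v * (fseries r ν).re := by
  obtain ⟨d, hd0, hd, hdl⟩ := exists_predictor hy hr hκ0 hκ hR0 hρ hR
  have hyn : ∀ n, ‖y n‖ = ‖y 0‖ := by
    intro n
    have h1 : ∀ n, ‖y n‖ ^ 2 = (r 0).re := fun n => by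
      rw [← inner_self_eq_norm_sq (𝕜 := ℂ), inner_stationary hy, sub_self]; rfl
    exact (sq_eq_sq₀ (norm_nonneg _) (norm_nonneg _)).1 (by rw [h1, h1])
  set e : ℤ → H := fun n => ∑' k : ℕ, d k • y (n - k) with he
  have hes : ∀ n, HasSum (fun k : ℕ => d k • y (n - k)) (e n) := by
    intro n
    refine (Summable.of_norm ?_).hasSum
    simp_rw [norm_smul, hyn]
    exact hd.mul_right _
  have hinner : ∀ (z : H) n, HasSum (fun k : ℕ => d k * inner ℂ z (y (n - k))) (inner ℂ z (e n)) := by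
    intro z n
    have := (hes n).mapL (innerSL ℂ z)
    simpa only [innerSL_apply_apply, inner_smul_right] using this
  have hye : ∀ k n, inner ℂ (y k) (e n) = ∑' j : ℕ, d j * r (n - k - j) := by
    intro k n
    rw [← (hinner (y k) n).tsum_eq]
    congr 1; ext j
    rw [inner_stationary hy]; congr 2; ring
  have hye0 : ∀ k n, k < n → inner ℂ (y k) (e n) = 0 := by
    intro k n hkn
    rw [hye, ← hdl (n - k).toNat (by omega)]
    congr 1; ext j; congr 2; omega
  have hort : ∀ n, e n ∈ (closedPast y n)ᗮ := fun n =>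
    mem_closedPast_orthogonal fun k hk => hye0 k n hk
  -- As `d 0 = 1`, the terms `y n` cancel and only `y (n - k)` with `k ≥ 1` remain. Together with
  -- `hort` this is the orthogonal decomposition defining the innovation.
  have hsub : ∀ n, y n - e n ∈ closedPast y n := by
    intro n
    have h1 : HasSum (fun k : ℕ => if k = 0 then 0 else -(d k • y (n - k))) (y n - e n) := by
      have h2 := (hasSum_ite_eq (0 : ℕ) (y n)).sub (hes n)
      convert! h2 using 1
      ext k
      by_cases hk : k = 0
      · simp [hk, hd0]
      · simp [hk]
    refine (isClosed_closedPast y n).mem_of_tendsto h1 (Eventually.of_forall fun S => ?_)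
    refine Submodule.sum_mem _ fun k _ => ?_
    split_ifs with h
    · exact Submodule.zero_mem _
    · exact Submodule.neg_mem _ (Submodule.smul_mem _ _ (mem_closedPast (by omega)))
  have hmem : ∀ m n, m < n → e m ∈ closedPast y n := by
    intro m n hmn
    have h1 := Submodule.sub_mem _ (mem_closedPast (y := y) hmn)
      (closedPast_mono y hmn.le (hsub m))
    simpa using h1
  have hee : ∀ n, inner ℂ (e n) (e n) = inner ℂ (y n) (e n) := by
    intro n
    have h1 := (Submodule.mem_orthogonal _ _).1 (hort n) _ (hsub n)
    rw [inner_sub_left, sub_eq_zero] at h1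
    exact h1.symm
  have hnorm : ∀ n, ‖e n‖ ^ 2 = ‖e 0‖ ^ 2 := by
    intro n
    rw [← inner_self_eq_norm_sq (𝕜 := ℂ), ← inner_self_eq_norm_sq (𝕜 := ℂ), hee, hee, hye, hye]
    simp
  -- The leading coefficient 1 and the lower Riesz bound give `‖e 0‖² ≥ κ`: the sequence is not
  -- perfectly predictable.
  have hpos : 0 < ‖e 0‖ ^ 2 := by
    refine hκ0.trans_le ?_
    refine ge_of_tendsto ((hes 0).tendsto_sum_nat.norm.pow 2) ?_
    filter_upwards [eventually_ge_atTop 1] with n hn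
    refine le_trans ?_ (riesz_lower_nat hy hr hκ 0 (Finset.range n) d)
    have h1 : ‖d 0‖ ^ 2 ≤ ∑ k ∈ Finset.range n, ‖d k‖ ^ 2 :=
      Finset.single_le_sum (f := fun k => ‖d k‖ ^ 2) (fun _ _ => by positivity)
        (Finset.mem_range.2 (by omega))
    rw [hd0] at h1
    simp only [norm_one, one_pow] at h1
    nlinarith
  set v := ‖e 0‖ ^ 2 with hv
  refine ⟨e, v, hpos, hsub, hort, hnorm, fun ν => ?_⟩
  set D : ℂ := ∑' j : ℕ, d j * fchar j ν with hD
  set α : ℤ → ℂ := fun k => inner ℂ (e 0) (y k) with hα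
  have hαr : α = fun k => ∑' j : ℕ, conj (d j) * r (k - (-(j : ℤ))) := by
    ext k
    simp only [hα]
    rw [← inner_conj_symm, ← (hinner (y k) 0).tsum_eq, Complex.conj_tsum]
    congr 1; ext j
    rw [map_mul, inner_conj_symm, inner_stationary hy]
    congr 2; ring
  have hcd : Summable fun j => ‖conj (d j)‖ := by simpa only [RCLike.norm_conj] using hd
  have h1 := fseries_conv hr hcd fun j => -(j : ℤ)
  have hαs : Summable fun k => ‖α k‖ := by rw [hαr]; exact h1.1
  have h1' := h1.2 ν
  rw [← hαr] at h1'
  have hDc : ∑' j : ℕ, conj (d j) * fchar (-(j : ℤ)) ν = conj D := by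
    rw [hD, Complex.conj_tsum]
    congr 1; ext j
    rw [map_mul, fchar_conj]
  -- The correlations `α` of `e 0` with the sequence are a convolution of `r` with the reflected
  -- conjugate of `d`; here `D` is the symbol of `d`.
  have hfα : fseries α ν = conj D * fseries r ν := by rw [h1', hDc]
  have h2 := (fseries_conv hαs hd fun j => (j : ℤ)).2 ν
  -- Convolving once more gives the covariance of `e`, which is white. Hence `v = ‖D‖² f` with `f =
  -- fseries r ν`, and `‖conj D * f‖² = v f`.
  have hγ : (fun u : ℤ => ∑' k : ℕ, d k * α (u - k)) = fun u => if u = 0 then (v : ℂ) else 0 := by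
    ext u
    rw [(hinner (e 0) u).tsum_eq]
    split_ifs with hu
    · rw [hu, inner_self_eq_norm_sq_to_K]; simp [hv]
    · rcases lt_or_gt_of_ne hu with h | h
      · rw [← inner_conj_symm, (Submodule.mem_orthogonal _ _).1 (hort 0) _ (hmem u 0 h), map_zero]
      · exact (Submodule.mem_orthogonal _ _).1 (hort u) _ (hmem 0 u h)
  have hγs : fseries (fun u : ℤ => ∑' k : ℕ, d k * α (u - k)) ν = v := by
    rw [hγ, fseries]
    simp_rw [ite_mul, zero_mul]
    rw [tsum_ite_eq, fchar_zero, mul_one]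
  rw [hγs, hfα] at h2
  -- The correlations of `e 0` with its past vanish, so the one-sided series is the full Fourier
  -- series.
  have hnat : ∑' k : ℕ, inner ℂ (e 0) (y k) * fchar k ν = fseries α ν := by
    rw [fseries]
    refine (Nat.cast_injective (R := ℤ)).tsum_eq (f := fun u : ℤ => α u * fchar u ν) ?_
    intro u hu
    by_contra hc
    have hu0 : u < 0 := by
      by_contra h; exact hc ⟨u.toNat, by simp; omega⟩
    refine hu ?_
    simp only [hα]
    rw [← inner_conj_symm, hye0 u 0 hu0, map_zero, zero_mul]
  have h3 : (v : ℂ) = ((‖D‖ ^ 2 : ℝ) : ℂ) * fseries r ν := by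
    rw [h2, ← mul_assoc, Complex.mul_conj']; push_cast; rfl
  have hre : v = ‖D‖ ^ 2 * (fseries r ν).re := by
    have := congrArg Complex.re h3
    rwa [Complex.ofReal_re, Complex.re_ofReal_mul] at this
  have him : 0 = ‖D‖ ^ 2 * (fseries r ν).im := by
    have := congrArg Complex.im h3
    rwa [Complex.ofReal_im, Complex.im_ofReal_mul] at this
  have hD0 : ‖D‖ ^ 2 ≠ 0 := fun h => by rw [h, zero_mul] at hre; exact hpos.ne' hre
  have him0 : (fseries r ν).im = 0 := by
    rcases mul_eq_zero.1 him.symm with h | h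
    · exact absurd h hD0
    · exact h
  rw [hnat, hfα, norm_mul, mul_pow, RCLike.norm_conj, ← Complex.normSq_eq_norm_sq (fseries r ν),
    Complex.normSq_apply, him0]
  linear_combination (-(fseries r ν).re) * hre

end Whitening

end SpectralCoherence

/-! ### Gaussian law on the closed span of all the series. -/

namespace SpectralCoherence

variable {Ω : Type*} [MeasurableSpace Ω] {P : Measure Ω} [IsProbabilityMeasure P]

section Law

variable {Z : Ω → ℂ} {v : ℝ≥0} (hZm : Measurable Z) (hZ : HasComplexGaussianLaw Z v P)

omit [IsProbabilityMeasure P] in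
lemma integral_comp_of_map_eq_gaussian {X : Ω → ℝ} {w : ℝ≥0} (hX : Measurable X)
    (h : P.map X = gaussianReal 0 w) {E : Type*} [NormedAddCommGroup E] [NormedSpace ℝ E]
    {f : ℝ → E} (hf : Continuous f) : ∫ ω, f (X ω) ∂P = ∫ x, f x ∂gaussianReal 0 w := by
  rw [← h, integral_map hX.aemeasurable hf.aestronglyMeasurable]

omit [IsProbabilityMeasure P] in
lemma memLp_of_map_eq_gaussian {X : Ω → ℝ} {w : ℝ≥0} (hX : Measurable X)
    (h : P.map X = gaussianReal 0 w) : MemLp X 2 P := by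
  have h1 := memLp_id_gaussianReal' (μ := 0) (v := w) 2 (by norm_num)
  rw [← h, memLp_map_measure_iff (by fun_prop) hX.aemeasurable] at h1
  exact h1

omit [IsProbabilityMeasure P] in
lemma integral_sq_of_map_eq_gaussian {X : Ω → ℝ} {w : ℝ≥0} (hX : Measurable X)
    (h : P.map X = gaussianReal 0 w) : ∫ ω, X ω ^ 2 ∂P = w := by
  rw [integral_comp_of_map_eq_gaussian hX h (f := fun x => x ^ 2) (by fun_prop)]
  have h1 := variance_fun_id_gaussianReal (μ := 0) (v := w)
  rw [variance_eq_integral (by fun_prop), integral_id_gaussianReal] at h1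
  simpa using h1

include hZm hZ

omit [IsProbabilityMeasure P] in
lemma HasComplexGaussianLaw.memLp : MemLp Z 2 P := by
  refine memLp_re_im_iff.1 ⟨?_, ?_⟩
  · exact memLp_of_map_eq_gaussian (Complex.measurable_re.comp hZm) hZ.1
  · exact memLp_of_map_eq_gaussian (Complex.measurable_im.comp hZm) hZ.2.1

lemma HasComplexGaussianLaw.integral_eq_zero : ∫ ω, Z ω ∂P = 0 := by
  have hint := (hZ.memLp hZm).integrable (by norm_num)
  have hre := integral_comp_of_map_eq_gaussian (Complex.measurable_re.comp hZm) hZ.1 continuous_id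
  have him := integral_comp_of_map_eq_gaussian (Complex.measurable_im.comp hZm) hZ.2.1 continuous_id
  simp only [id, integral_id_gaussianReal, Function.comp] at hre him
  refine Complex.ext ?_ ?_
  · rw [← RCLike.re_to_complex, ← integral_re hint]; exact hre
  · rw [← RCLike.im_to_complex, ← integral_im hint]; exact him

omit [IsProbabilityMeasure P] in
lemma HasComplexGaussianLaw.integral_norm_sq : ∫ ω, ‖Z ω‖ ^ 2 ∂P = v := by
  have hre := integral_sq_of_map_eq_gaussian (Complex.measurable_re.comp hZm) hZ.1
  have him := integral_sq_of_map_eq_gaussian (Complex.measurable_im.comp hZm) hZ.2.1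
  have h1 := memLp_of_map_eq_gaussian (Complex.measurable_re.comp hZm) hZ.1
  have h2 := memLp_of_map_eq_gaussian (Complex.measurable_im.comp hZm) hZ.2.1
  have h3 : ∀ ω, ‖Z ω‖ ^ 2 = (Complex.re ∘ Z) ω ^ 2 + (Complex.im ∘ Z) ω ^ 2 := fun ω => by
    rw [← Complex.normSq_eq_norm_sq, Complex.normSq_apply]; simp [sq]
  simp_rw [h3]
  rw [integral_add h1.integrable_sq h2.integrable_sq, hre, him]
  push_cast; ring

omit [IsProbabilityMeasure P] in
lemma HasComplexGaussianLaw.integral_exp_re :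
    ∫ ω, Complex.exp ((Z ω).re * Complex.I) ∂P = Real.exp (-((v : ℝ) / 4)) := by
  have h := integral_comp_of_map_eq_gaussian (Complex.measurable_re.comp hZm) hZ.1
    (f := fun x : ℝ => Complex.exp (x * Complex.I)) (by fun_prop)
  simp only [Function.comp] at h
  rw [h]
  have h2 := charFun_gaussianReal (μ := 0) (v := v / 2) 1
  rw [charFun_apply_real] at h2
  simp only [Complex.ofReal_one, one_mul] at h2
  rw [h2]
  push_cast
  congr 1; ring

end Law

section L2

/-- Characteristic function of the real part of a square integrable variable. -/
def reCharFun (z : Lp ℂ 2 P) : ℂ := ∫ ω, Complex.exp ((z ω).re * Complex.I) ∂P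

lemma integral_norm_le_norm (z : Lp ℂ 2 P) : ∫ ω, ‖z ω‖ ∂P ≤ ‖z‖ := by
  have h1 : eLpNorm z 1 P ≤ eLpNorm z 2 P :=
    eLpNorm_le_eLpNorm_of_exponent_le (by norm_num) (Lp.aestronglyMeasurable z)
  rw [Lp.norm_def, integral_norm_eq_lintegral_enorm (Lp.aestronglyMeasurable z),
    ← eLpNorm_one_eq_lintegral_enorm]
  exact ENNReal.toReal_mono (Lp.eLpNorm_ne_top z) h1

lemma norm_exp_sub_exp_le (a b : ℝ) :
    ‖Complex.exp (a * Complex.I) - Complex.exp (b * Complex.I)‖ ≤ |a - b| := by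
  have h : Complex.exp (a * Complex.I) - Complex.exp (b * Complex.I) =
      Complex.exp (b * Complex.I) * (Complex.exp (Complex.I * ((a - b : ℝ) : ℂ)) - 1) := by
    rw [mul_sub, ← Complex.exp_add, mul_one]
    congr 2; push_cast; ring
  rw [h, norm_mul, Complex.norm_exp_ofReal_mul_I, one_mul]
  exact Real.norm_exp_I_mul_ofReal_sub_one_le

lemma integrable_exp_ofReal_mul_I {X : Ω → ℝ} (hX : AEMeasurable X P) :
    Integrable (fun ω => Complex.exp (X ω * Complex.I)) P := by
  refine Integrable.of_bound (C := 1) ?_ (Eventually.of_forall fun ω => ?_)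
  · exact (Complex.measurable_exp.comp_aemeasurable
      ((Complex.measurable_ofReal.comp_aemeasurable hX).mul_const _)).aestronglyMeasurable
  · rw [Complex.norm_exp_ofReal_mul_I]

omit [IsProbabilityMeasure P] in
lemma aemeasurable_re (z : Lp ℂ 2 P) : AEMeasurable (fun ω => (z ω).re) P :=
  Complex.measurable_re.comp_aemeasurable (Lp.aestronglyMeasurable z).aemeasurable

/-- It is 1-Lipschitz, because `e^{ix}` is and the `L¹` norm is at most the `L²` norm. This carries
the Gaussian formula from finite combinations to their closed span. -/
lemma continuous_reCharFun : Continuous (reCharFun : Lp ℂ 2 P → ℂ) := by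
  refine (LipschitzWith.of_dist_le_mul (K := 1) fun z w => ?_).continuous
  rw [NNReal.coe_one, one_mul, dist_eq_norm, dist_eq_norm, reCharFun, reCharFun,
    ← integral_sub (integrable_exp_ofReal_mul_I (aemeasurable_re z))
      (integrable_exp_ofReal_mul_I (aemeasurable_re w))]
  refine (norm_integral_le_integral_norm _).trans (le_trans ?_ (integral_norm_le_norm (z - w)))
  refine integral_mono_ae ?_ ?_ ?_
  · exact ((integrable_exp_ofReal_mul_I (aemeasurable_re z)).sub
      (integrable_exp_ofReal_mul_I (aemeasurable_re w))).norm
  · exact ((Lp.memLp (z - w)).integrable (by norm_num)).norm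
  · filter_upwards [Lp.coeFn_sub z w] with ω hω
    rw [hω, Pi.sub_apply]
    refine (norm_exp_sub_exp_le _ _).trans ?_
    rw [← Complex.sub_re]
    exact Complex.abs_re_le_norm _

omit [IsProbabilityMeasure P] in
lemma toL2_of_memLp {X : Ω → ℂ} (h : MemLp X 2 P) : toL2 X P = h.toLp X := by
  rw [toL2, dif_pos h]

omit [IsProbabilityMeasure P] in
lemma coeFn_toL2 {X : Ω → ℂ} (h : MemLp X 2 P) : toL2 X P =ᵐ[P] X := by
  rw [toL2_of_memLp h]; exact h.coeFn_toLp

omit [IsProbabilityMeasure P] in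
lemma inner_L2_eq (z w : Lp ℂ 2 P) : inner ℂ z w = ∫ ω, w ω * conj (z ω) ∂P := by
  rw [L2.inner_def]
  rfl

omit [IsProbabilityMeasure P] in
lemma inner_toL2 {X Y : Ω → ℂ} (hX : MemLp X 2 P) (hY : MemLp Y 2 P) :
    inner ℂ (toL2 X P) (toL2 Y P) = ∫ ω, Y ω * conj (X ω) ∂P := by
  rw [inner_L2_eq]
  refine integral_congr_ae ?_
  filter_upwards [coeFn_toL2 hX, coeFn_toL2 hY] with ω h1 h2
  rw [h1, h2]

omit [IsProbabilityMeasure P] in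
lemma norm_sq_toL2 {X : Ω → ℂ} (hX : MemLp X 2 P) : ‖toL2 X P‖ ^ 2 = ∫ ω, ‖X ω‖ ^ 2 ∂P := by
  have h1 : ((‖toL2 X P‖ ^ 2 : ℝ) : ℂ) = ((∫ ω, ‖X ω‖ ^ 2 ∂P : ℝ) : ℂ) := by
    have h2 := inner_self_eq_norm_sq_to_K (𝕜 := ℂ) (toL2 X P)
    rw [inner_toL2 hX hX] at h2
    push_cast
    rw [← integral_complex_ofReal]
    refine h2.symm.trans (integral_congr_ae (Eventually.of_forall fun ω => ?_))
    simp only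
    rw [Complex.mul_conj']; push_cast; rfl
  exact_mod_cast h1

end L2

section Joint

variable {y : ℕ → ℤ → Ω → ℂ} (hmeas : ∀ m n, Measurable (y m n))
  (hindep : iIndepFun (fun (m : ℕ) (ω : Ω) (n : ℤ) => y m n ω) P)
  (hgauss : ∀ m, IsComplexGaussianSeries (y m) P)

include hmeas hgauss

omit [IsProbabilityMeasure P] in
lemma memLp_series (m : ℕ) (n : ℤ) : MemLp (y m n) 2 P := by
  obtain ⟨v, hv⟩ := hgauss m {n} (fun _ => 1)
  simp only [Finset.sum_singleton, one_mul] at hv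
  exact hv.memLp (hmeas m n)

include hindep

/-- Each series contributes one complex Gaussian variable. These are independent and centred, so
characteristic functions multiply while variances, which are squared `L²` norms, add. -/
lemma gaussian_of_finset_sum (A : Finset ℕ) (S : Finset ℤ) (c : ℕ → ℤ → ℂ) :
    reCharFun (∑ m ∈ A, ∑ n ∈ S, c m n • toL2 (y m n) P) =
      Real.exp (-(‖∑ m ∈ A, ∑ n ∈ S, c m n • toL2 (y m n) P‖ ^ 2 / 4)) := by
  set Z : ℕ → Ω → ℂ := fun m ω => ∑ n ∈ S, c m n * y m n ω with hZ
  have hZm : ∀ m, Measurable (Z m) := fun m =>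
    Finset.measurable_fun_sum S fun n _ => (hmeas m n).const_mul _
  choose v hv using fun m => hgauss m S (c m)
  have hZL : ∀ m, MemLp (Z m) 2 P := fun m => (hv m).memLp (hZm m)
  have hZeq : ∀ m, ∑ n ∈ S, c m n • toL2 (y m n) P = toL2 (Z m) P := by
    intro m
    refine Lp.ext ?_
    have h1 : ∀ n ∈ S, ⇑(c m n • toL2 (y m n) P) =ᵐ[P] fun ω => c m n * y m n ω := by
      intro n _
      filter_upwards [Lp.coeFn_smul (c m n) (toL2 (y m n) P),
        coeFn_toL2 (memLp_series hmeas hgauss m n)] with ω h1 h2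
      rw [h1, Pi.smul_apply, h2, smul_eq_mul]
    have h1' := (Finset.eventually_all S).2 h1
    filter_upwards [h1', coeFn_toL2 (hZL m), Lp.coeFn_fun_finsetSum S fun n => c m n • toL2 (y m n) P]
      with ω h2 h3 h4
    rw [h3, h4]
    exact Finset.sum_congr rfl h2
  simp_rw [hZeq]
  have hind : iIndepFun Z P :=
    hindep.comp (fun m (f : ℤ → ℂ) => ∑ n ∈ S, c m n * f n) fun m =>
      Finset.measurable_fun_sum S fun n _ => (measurable_pi_apply n).const_mul _
  have hnorm : ‖∑ m ∈ A, toL2 (Z m) P‖ ^ 2 = ∑ m ∈ A, (v m : ℝ) := by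
    rw [← inner_self_eq_norm_sq (𝕜 := ℂ), sum_inner]
    simp_rw [inner_sum]
    rw [map_sum]
    refine Finset.sum_congr rfl fun i hi => ?_
    rw [Finset.sum_eq_single_of_mem i hi, inner_self_eq_norm_sq (𝕜 := ℂ), norm_sq_toL2 (hZL i),
      (hv i).integral_norm_sq (hZm i)]
    intro j _ hj
    rw [inner_toL2 (hZL i) (hZL j)]
    have h1 := (hind.indepFun hj).integral_fun_comp_mul_comp (f := fun z : ℂ => z)
      (g := fun z : ℂ => conj z) (hZm j).aemeasurable (hZm i).aemeasurable
      (by fun_prop) Complex.continuous_conj.aestronglyMeasurable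
    rw [h1, (hv j).integral_eq_zero (hZm j), zero_mul]
  have hchar : reCharFun (∑ m ∈ A, toL2 (Z m) P) =
      ∫ ω, ∏ m : A, Complex.exp ((Z m ω).re * Complex.I) ∂P := by
    refine integral_congr_ae ?_
    have h1' := (Finset.eventually_all A).2 fun m _ => coeFn_toL2 (hZL m)
    filter_upwards [h1', Lp.coeFn_fun_finsetSum A fun m => toL2 (Z m) P] with ω h1 h2
    rw [h2, Finset.prod_coe_sort A fun m => Complex.exp ((Z m ω).re * Complex.I), ← Complex.exp_sum,
      ← Finset.sum_mul, ← Complex.ofReal_sum, ← Complex.re_sum, Finset.sum_congr rfl h1]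
  rw [hchar, hnorm]
  have hindA : iIndepFun (fun m : A => Z m) P := hind.precomp Subtype.val_injective
  rw [hindA.integral_fun_prod_comp (f := fun _ (z : ℂ) => Complex.exp (z.re * Complex.I))
    (fun m => (hZm m).aemeasurable) (fun m => Continuous.aestronglyMeasurable (by fun_prop))]
  rw [Finset.prod_coe_sort A fun m => ∫ ω, Complex.exp ((Z m ω).re * Complex.I) ∂P]
  rw [Finset.prod_congr rfl fun m _ => (hv m).integral_exp_re (hZm m), ← Complex.ofReal_prod,
    ← Real.exp_sum, Finset.sum_neg_distrib, Finset.sum_div]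

/-- The closed linear span of all the series. -/
def gaussSpace (y : ℕ → ℤ → Ω → ℂ) (P : Measure Ω) : Submodule ℂ (Lp ℂ 2 P) :=
  (Submodule.span ℂ (Set.range fun p : ℕ × ℤ => toL2 (y p.1 p.2) P)).topologicalClosure

lemma reCharFun_of_mem_gaussSpace {z : Lp ℂ 2 P} (hz : z ∈ gaussSpace y P) :
    reCharFun z = Real.exp (-(‖z‖ ^ 2 / 4)) := by
  have hcl : IsClosed {z : Lp ℂ 2 P | reCharFun z = Real.exp (-(‖z‖ ^ 2 / 4))} :=
    isClosed_eq continuous_reCharFun (by fun_prop)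
  refine closure_minimal ?_ hcl hz
  intro w hw
  obtain ⟨c, rfl⟩ := Finsupp.mem_span_range_iff_exists_finsupp.1 hw
  have h := gaussian_of_finset_sum hmeas hindep hgauss (c.support.image Prod.fst)
    (c.support.image Prod.snd) fun m n => c (m, n)
  have h2 : (c.sum fun i a => a • toL2 (y i.1 i.2) P) = ∑ m ∈ c.support.image Prod.fst,
      ∑ n ∈ c.support.image Prod.snd, c (m, n) • toL2 (y m n) P := by
    rw [← Finset.sum_product', Finsupp.sum]
    refine Finset.sum_subset (fun p hp => ?_) fun p _ hp => ?_
    · exact Finset.mem_product.2 ⟨Finset.mem_image_of_mem _ hp, Finset.mem_image_of_mem _ hp⟩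
    · rw [Finsupp.notMem_support_iff.1 hp, zero_smul]
  change reCharFun _ = _
  rw [h2]; exact h

/-- Orthonormal elements of the closed linear span are independent standard complex Gaussian
variables. -/
theorem iIndepFun_of_orthonormal {ι : Type*} [Fintype ι] (z : ι → Lp ℂ 2 P)
    (hz : ∀ p, z p ∈ gaussSpace y P) (ho : Orthonormal ℂ z) :
    iIndepFun (fun p ω => z p ω) P ∧ ∀ p, P.map (z p) = stdCGauss := by
  have hzm : ∀ p, AEMeasurable (z p) P := fun p => (Lp.aestronglyMeasurable (z p)).aemeasurable
  -- The combination with coefficients `conj (t p)` stays in the span and has squared norm `∑ ‖t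
  -- p‖²`. Complex coefficients reach the imaginary parts too, so real parts alone determine the
  -- joint characteristic function.
  have key : ∀ (A : Finset ι) (t : ι → ℂ),
      ∫ ω, Complex.exp ((∑ p ∈ A, inner ℝ (z p ω) (t p) : ℝ) * Complex.I) ∂P =
        Real.exp (-((∑ p ∈ A, ‖t p‖ ^ 2) / 4)) := by
    intro A t
    have hmem : ∑ p ∈ A, conj (t p) • z p ∈ gaussSpace y P :=
      Submodule.sum_mem _ fun p _ => Submodule.smul_mem _ _ (hz p)
    have h := reCharFun_of_mem_gaussSpace hmeas hindep hgauss hmem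
    have hn : ‖∑ p ∈ A, conj (t p) • z p‖ ^ 2 = ∑ p ∈ A, ‖t p‖ ^ 2 := by
      rw [← inner_self_eq_norm_sq (𝕜 := ℂ), ho.inner_sum, map_sum]
      refine Finset.sum_congr rfl fun p _ => ?_
      rw [Complex.conj_conj, Complex.mul_conj']
      norm_cast
    rw [hn] at h
    rw [← h]
    refine integral_congr_ae ?_
    have h1' := (Finset.eventually_all A).2 fun p _ => Lp.coeFn_smul (conj (t p)) (z p)
    filter_upwards [h1', Lp.coeFn_fun_finsetSum A fun p => conj (t p) • z p] with ω h1 h2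
    rw [h2, Complex.re_sum]
    congr 3
    refine Finset.sum_congr rfl fun p hp => ?_
    rw [h1 p hp, Pi.smul_apply, smul_eq_mul, Complex.inner]
    simp only [Complex.mul_re, Complex.conj_re, Complex.conj_im]
    ring
  have hlaw : ∀ p, P.map (z p) = stdCGauss := by
    intro p
    have := Measure.isProbabilityMeasure_map (hzm p)
    refine Measure.ext_of_charFun ?_
    ext t
    rw [charFun_stdCGauss, charFun_apply, integral_map (hzm p) (by fun_prop)]
    have := key {p} fun _ => t
    simpa only [Finset.sum_singleton] using this
  refine ⟨(iIndepFun_iff_charFun_pi hzm).2 fun t => ?_, hlaw⟩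
  simp_rw [hlaw, charFun_stdCGauss]
  have hvec : AEMeasurable (fun ω => WithLp.toLp 2 fun p => z p ω) P :=
    (WithLp.measurable_toLp 2 _).comp_aemeasurable (aemeasurable_pi_lambda _ hzm)
  rw [charFun_apply, integral_map hvec (by fun_prop)]
  simp only [PiLp.inner_apply]
  rw [key Finset.univ fun p => t p, ← Complex.ofReal_prod, ← Real.exp_sum, Finset.sum_neg_distrib,
    Finset.sum_div]

end Joint

end SpectralCoherence

/-! ### Normalized innovations and their Fourier transforms at Fourier frequencies. -/

namespace SpectralCoherence

variable {Ω : Type*} [MeasurableSpace Ω] {P : Measure Ω} [IsProbabilityMeasure P]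

/-- The closed linear span of one series. -/
def seriesSpace (x : ℤ → Ω → ℂ) (P : Measure Ω) : Submodule ℂ (Lp ℂ 2 P) :=
  (Submodule.span ℂ (Set.range fun n : ℤ => toL2 (x n) P)).topologicalClosure

omit [IsProbabilityMeasure P] in
lemma toL2_mem_seriesSpace (x : ℤ → Ω → ℂ) (n : ℤ) : toL2 (x n) P ∈ seriesSpace x P :=
  Submodule.le_topologicalClosure _ (Submodule.subset_span ⟨n, rfl⟩)

omit [IsProbabilityMeasure P] in
lemma normInnovation_mem_seriesSpace (x : ℤ → Ω → ℂ) (n : ℤ) :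
    normInnovation x P n ∈ seriesSpace x P := by
  refine Submodule.smul_mem _ _ (Submodule.sub_mem _ (toL2_mem_seriesSpace x n) ?_)
  have h : pastSpace x P n ≤ seriesSpace x P :=
    Submodule.topologicalClosure_mono (Submodule.span_mono fun z ⟨k, _, hz⟩ => ⟨k, hz.symm⟩)
  exact h (Submodule.starProjection_apply_mem _ _)

section Single

omit [IsProbabilityMeasure P] in
lemma specDensity_eq (x : ℤ → Ω → ℂ) (ν : ℝ) :
    specDensity x P ν = (fseries (autocov x P) ν).re := rfl

variable {x : ℤ → Ω → ℂ} (hL : ∀ n, MemLp (x n) 2 P) (hstat : IsStationary x P)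
  (hmem : Summable fun u : ℤ => (1 + |(u : ℝ)|) * ‖autocov x P u‖)
  {κ : ℝ} (hκ0 : 0 < κ) (hκ : ∀ ν ∈ Set.Icc (0 : ℝ) 1, κ ≤ specDensity x P ν)

include hmem in
omit [IsProbabilityMeasure P] in
lemma summable_norm_autocov : Summable fun u : ℤ => ‖autocov x P u‖ :=
  Summable.of_nonneg_of_le (fun _ => norm_nonneg _)
    (fun u => le_mul_of_one_le_left (norm_nonneg _) (by linarith [abs_nonneg (u : ℝ)])) hmem

include hL hstat hmem hκ0 hκ

omit [IsProbabilityMeasure P] in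
/-- Normalized innovations are orthonormal and the causal coefficients form a spectral factor. -/
theorem normInnovation_spec : Orthonormal ℂ (normInnovation x P) ∧
    ∀ ν, ‖specFactor x P ν‖ ^ 2 = specDensity x P ν := by
  have hr := summable_norm_autocov hmem
  have hy : ∀ n u, inner ℂ (toL2 (x n) P) (toL2 (x (n + u)) P) = autocov x P u := fun n u => by
    rw [inner_toL2 (hL n) (hL (n + u)), hstat n u]
  have hρ : Summable fun u : ℤ => |(u : ℝ)| * ‖autocov x P u‖ :=
    Summable.of_nonneg_of_le (fun _ => by positivity)
      (fun u => mul_le_mul_of_nonneg_right (by linarith) (norm_nonneg _)) hmem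
  -- The added 1 keeps the bound positive for white noise, whose weighted sum is zero.
  have hR0 : 0 < ∑' u : ℤ, |(u : ℝ)| * ‖autocov x P u‖ + 1 :=
    add_pos_of_nonneg_of_pos (tsum_nonneg fun _ => by positivity) one_pos
  obtain ⟨e, v, hv, hsub, hort, hnorm, hfac⟩ := exists_whitening (y := fun n => toL2 (x n) P) hy hr
    hκ0 hκ hR0 hρ (le_add_of_nonneg_right zero_le_one)
  -- Uniqueness of the orthogonal decomposition identifies the explicit series with the projection
  -- error.
  have hinn : ∀ n, innovation x P n = e n := by
    intro n
    have h : (pastSpace x P n).starProjection (toL2 (x n) P) = toL2 (x n) P - e n :=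
      Submodule.eq_starProjection_of_mem_orthogonal (hsub n) (by simpa using! hort n)
    rw [innovation, h, sub_sub_cancel]
  have hen : ∀ n, ‖e n‖ = √v := fun n => by rw [← hnorm n, Real.sqrt_sq (norm_nonneg _)]
  have hni : ∀ n, normInnovation x P n = ((√v : ℝ) : ℂ)⁻¹ • e n := fun n => by
    rw [normInnovation, hinn, hen]
  have hsv : √v ≠ 0 := (Real.sqrt_pos.2 hv).ne'
  have hperp : ∀ m n, m < n → inner ℂ (e m) (e n) = 0 := by
    intro m n hmn
    have h1 : e m ∈ closedPast (fun n => toL2 (x n) P) n := by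
      have h1 := Submodule.sub_mem _ (mem_closedPast (y := fun n => toL2 (x n) P) hmn)
        (closedPast_mono _ hmn.le (hsub m))
      simpa using h1
    exact (Submodule.mem_orthogonal _ _).1 (hort n) _ h1
  refine ⟨⟨fun n => ?_, fun m n hmn => ?_⟩, fun ν => ?_⟩
  · rw [hni, norm_smul, hen, norm_inv, Complex.norm_real, Real.norm_of_nonneg (Real.sqrt_nonneg v),
      inv_mul_cancel₀ hsv]
  · simp only [hni]
    rw [inner_smul_left, inner_smul_right]
    have : inner ℂ (e m) (e n) = 0 := by
      rcases lt_or_gt_of_ne hmn with h | h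
      · exact hperp m n h
      · rw [← inner_conj_symm, hperp n m h, map_zero]
    rw [this, mul_zero, mul_zero]
  · have hw : ∀ k : ℕ, wienerCoeff x P k = ((√v : ℝ) : ℂ)⁻¹ * inner ℂ (e 0) (toL2 (x k) P) := by
      intro k
      have h1 : wienerCoeff x P k = inner ℂ (normInnovation x P 0) (toL2 (x k) P) := by
        rw [inner_L2_eq, wienerCoeff]
        refine integral_congr_ae ?_
        filter_upwards [coeFn_toL2 (hL k)] with ω h1
        rw [h1]
      rw [h1, hni, inner_smul_left, ← Complex.ofReal_inv, Complex.conj_ofReal]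
    have h2 : specFactor x P ν =
        ((√v : ℝ) : ℂ)⁻¹ * ∑' k : ℕ, inner ℂ (e 0) (toL2 (x k) P) * fchar k ν := by
      rw [specFactor, ← tsum_mul_left]
      congr 1; ext k
      rw [hw, mul_assoc, fchar]; push_cast; rfl
    rw [h2, norm_mul, mul_pow, hfac ν, norm_inv, Complex.norm_real,
      Real.norm_of_nonneg (Real.sqrt_nonneg v), inv_pow, Real.sq_sqrt hv.le, specDensity_eq]
    field_simp

end Single

lemma fchar_eq_pow (j : ℕ) (ν : ℝ) : fchar j ν = fchar 1 ν ^ j := by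
  rw [fchar, fchar, ← Complex.exp_nat_mul]
  congr 1; push_cast; ring

/-- Orthogonality of the discrete Fourier basis. -/
lemma sum_fchar_eq_zero {N : ℕ} (hN : 0 < N) {q : ℤ} (hq : ¬ (N : ℤ) ∣ q) :
    ∑ n ∈ Finset.Icc (1 : ℤ) N, fchar (n - 1) (q / N) = 0 := by
  have h1 : ∑ n ∈ Finset.Icc (1 : ℤ) N, fchar (n - 1) (q / N) =
      ∑ j ∈ Finset.range N, fchar 1 (q / N) ^ j := by
    symm
    refine Finset.sum_nbij' (fun j : ℕ => (j : ℤ) + 1) (fun n : ℤ => (n - 1).toNat) ?_ ?_ ?_ ?_ ?_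
    · intro j hj; simp at hj ⊢; omega
    · intro n hn; simp at hn ⊢; omega
    · intro j _; simp
    · intro n hn; simp at hn ⊢; omega
    · intro j _; rw [← fchar_eq_pow]; congr 1; ring
  have hN0 : (N : ℂ) ≠ 0 := by exact_mod_cast hN.ne'
  have hw1 : fchar 1 (q / N) ≠ 1 := by
    intro h
    rw [fchar, Complex.exp_eq_one_iff] at h
    obtain ⟨n, hn⟩ := h
    apply hq
    refine ⟨-n, ?_⟩
    have hpi : (2 * Real.pi * Complex.I : ℂ) ≠ 0 := Complex.two_pi_I_ne_zero
    have h2 : (2 * Real.pi * Complex.I : ℂ) * (-(q / N)) = (2 * Real.pi * Complex.I : ℂ) * n := by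
      push_cast at hn
      linear_combination hn
    have h3 := mul_left_cancel₀ hpi h2
    have h4 : (q : ℂ) = N * (-n) := by field_simp at h3; linear_combination -h3
    exact_mod_cast h4
  have hwN : fchar 1 (q / N) ^ N = 1 := by
    rw [← fchar_eq_pow, fchar, Complex.exp_eq_one_iff]
    refine ⟨-q, ?_⟩
    push_cast
    field_simp
  rw [h1, geom_sum_eq hw1, hwN, sub_self, zero_div]

/-- The finite Fourier transform of the innovations as an element of `L²`. -/
def finFourierL2 (x : ℤ → Ω → ℂ) (P : Measure Ω) (N : ℕ) (ν : ℝ) : Lp ℂ 2 P :=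
  ∑ n ∈ Finset.Icc (1 : ℤ) N, (((√N : ℝ) : ℂ)⁻¹ * fchar (n - 1) ν) • normInnovation x P n

omit [IsProbabilityMeasure P] in
lemma coeFn_finFourierL2 (x : ℤ → Ω → ℂ) (N : ℕ) (ν : ℝ) :
    ⇑(finFourierL2 x P N ν) =ᵐ[P] fun ω => finFourier N (fun n => normInnovation x P n ω) ν := by
  have h1' := (Finset.eventually_all (Finset.Icc (1 : ℤ) N)).2 fun n _ =>
    Lp.coeFn_smul (((√N : ℝ) : ℂ)⁻¹ * fchar (n - 1) ν) (normInnovation x P n)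
  filter_upwards [h1', Lp.coeFn_fun_finsetSum (Finset.Icc (1 : ℤ) N) fun n =>
    (((√N : ℝ) : ℂ)⁻¹ * fchar (n - 1) ν) • normInnovation x P n] with ω h1 h2
  rw [finFourierL2, h2, finFourier, Finset.mul_sum]
  refine Finset.sum_congr rfl fun n hn => ?_
  rw [h1 n hn, Pi.smul_apply, smul_eq_mul, fchar]
  push_cast
  ring

omit [IsProbabilityMeasure P] in
lemma finFourierL2_mem_seriesSpace (x : ℤ → Ω → ℂ) (N : ℕ) (ν : ℝ) :
    finFourierL2 x P N ν ∈ seriesSpace x P :=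
  Submodule.sum_mem _ fun n _ => Submodule.smul_mem _ _ (normInnovation_mem_seriesSpace x n)

omit [IsProbabilityMeasure P] in
lemma inner_finFourierL2 {x : ℤ → Ω → ℂ} (ho : Orthonormal ℂ (normInnovation x P)) {N : ℕ}
    (ν ν' : ℝ) : inner ℂ (finFourierL2 x P N ν) (finFourierL2 x P N ν') =
      (N : ℂ)⁻¹ * ∑ n ∈ Finset.Icc (1 : ℤ) N, fchar (n - 1) (ν' - ν) := by
  rw [finFourierL2, finFourierL2, ho.inner_sum, Finset.mul_sum]
  refine Finset.sum_congr rfl fun n _ => ?_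
  have h1 : fchar (n - 1) (ν' - ν) = conj (fchar (n - 1) ν) * fchar (n - 1) ν' := by
    rw [fchar_conj, fchar, fchar, fchar, ← Complex.exp_add]
    congr 1; push_cast; ring
  have h2 : ((√N : ℝ) : ℂ)⁻¹ * ((√N : ℝ) : ℂ)⁻¹ = (N : ℂ)⁻¹ := by
    rw [← mul_inv, ← Complex.ofReal_mul, Real.mul_self_sqrt (Nat.cast_nonneg N)]; simp
  rw [h1, ← h2, map_mul, ← Complex.ofReal_inv, Complex.conj_ofReal]
  ring

section Joint

variable {y : ℕ → ℤ → Ω → ℂ} (hmeas : ∀ m n, Measurable (y m n))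
  (hindep : iIndepFun (fun (m : ℕ) (ω : Ω) (n : ℤ) => y m n ω) P)
  (hgauss : ∀ m, IsComplexGaussianSeries (y m) P)

omit [IsProbabilityMeasure P] in
lemma seriesSpace_le_gaussSpace (m : ℕ) : seriesSpace (y m) P ≤ gaussSpace y P :=
  Submodule.topologicalClosure_mono (Submodule.span_mono fun _ ⟨n, hn⟩ => ⟨(m, n), hn⟩)

include hmeas hindep hgauss

lemma inner_seriesSpace_eq_zero {m m' : ℕ} (hm : m ≠ m') {z w : Lp ℂ 2 P}
    (hz : z ∈ seriesSpace (y m) P) (hw : w ∈ seriesSpace (y m') P) : inner ℂ z w = 0 := by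
  have hbase : ∀ n n', inner ℂ (toL2 (y m n) P) (toL2 (y m' n') P) = 0 := by
    intro n n'
    rw [inner_toL2 (memLp_series hmeas hgauss m n) (memLp_series hmeas hgauss m' n')]
    have h1 := (hindep.indepFun hm.symm).integral_fun_comp_mul_comp
      (f := fun f : ℤ → ℂ => f n') (g := fun f : ℤ → ℂ => conj (f n))
      (measurable_pi_lambda _ (hmeas m')).aemeasurable
      (measurable_pi_lambda _ (hmeas m)).aemeasurable
      (measurable_pi_apply n').aestronglyMeasurable
      (Complex.continuous_conj.measurable.comp (measurable_pi_apply n)).aestronglyMeasurable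
    rw [h1]
    obtain ⟨v, hv⟩ := hgauss m' {n'} (fun _ => 1)
    simp only [Finset.sum_singleton, one_mul] at hv
    rw [hv.integral_eq_zero (hmeas m' n'), zero_mul]
  have h1 : seriesSpace (y m') P ≤ (seriesSpace (y m) P)ᗮ := by
    refine Submodule.topologicalClosure_minimal _ (Submodule.span_le.2 ?_)
      (Submodule.isClosed_orthogonal _)
    rintro _ ⟨n', rfl⟩
    rw [seriesSpace, Submodule.orthogonal_closure, SetLike.mem_coe, Submodule.mem_orthogonal]
    intro u hu
    induction hu using Submodule.span_induction with
    | mem x hx => obtain ⟨n, rfl⟩ := hx; exact hbase n n'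
    | zero => simp
    | add a b _ _ ha hb => rw [inner_add_left, ha, hb, add_zero]
    | smul c a _ ha => rw [inner_smul_left, ha, mul_zero]
  exact (Submodule.mem_orthogonal _ _).1 (h1 hw) z hz

/-- At distinct Fourier frequencies the Fourier transforms of the innovations are independent
standard complex Gaussian variables. -/
theorem iIndepFun_finFourier (ho : ∀ m, Orthonormal ℂ (normInnovation (y m) P)) {N : ℕ}
    (hN : 0 < N) {ι : Type*} [Fintype ι] (m : ι → ℕ) (q : ι → ℤ)
    (hq : ∀ p p', p ≠ p' → m p = m p' → ¬ (N : ℤ) ∣ q p' - q p) :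
    iIndepFun (fun p ω =>
        finFourier N (fun n => normInnovation (y (m p)) P n ω) ((q p : ℝ) / N)) P ∧
      ∀ p, P.map (fun ω =>
        finFourier N (fun n => normInnovation (y (m p)) P n ω) ((q p : ℝ) / N)) = stdCGauss := by
  have hN0 : (N : ℂ) ≠ 0 := by exact_mod_cast hN.ne'
  -- Within one series this is orthogonality of the discrete Fourier basis; across series it follows
  -- from independence and zero mean.
  have hort : Orthonormal ℂ fun p => finFourierL2 (y (m p)) P N ((q p : ℝ) / N) := by
    classical
    rw [orthonormal_iff_ite]
    intro p p'
    split_ifs with h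
    · subst h
      rw [inner_finFourierL2 (ho _), sub_self]
      simp [fchar, hN0]
    · by_cases hm : m p = m p'
      · rw [← hm, inner_finFourierL2 (ho _), ← sub_div, ← Int.cast_sub,
          sum_fchar_eq_zero hN (hq p p' h hm), mul_zero]
      · exact inner_seriesSpace_eq_zero hmeas hindep hgauss hm (finFourierL2_mem_seriesSpace _ _ _)
          (finFourierL2_mem_seriesSpace _ _ _)
  obtain ⟨h1, h2⟩ := iIndepFun_of_orthonormal hmeas hindep hgauss _
    (fun p => seriesSpace_le_gaussSpace (m p) (finFourierL2_mem_seriesSpace _ _ _)) hort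
  refine ⟨h1.congr fun p => coeFn_finFourierL2 _ _ _, fun p => ?_⟩
  rw [← h2 p]
  exact (Measure.map_congr (coeFn_finFourierL2 _ _ _)).symm

end Joint

end SpectralCoherence

/-! ### Grouping Fourier frequencies into independent windows. -/

namespace SpectralCoherence

variable {Ω : Type*} [MeasurableSpace Ω] {P : Measure Ω} [IsProbabilityMeasure P]

/-- Grouping a family of independent variables into blocks gives independent blocks. -/
lemma iIndepFun_curry {ι κ E : Type*} [Fintype ι] [Fintype κ] [MeasurableSpace E]
    {X : ι × κ → Ω → E} (hX : ∀ p, Measurable (X p)) (h : iIndepFun X P) :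
    iIndepFun (fun i ω j => X (i, j) ω) P := by
  have hp : ∀ p, IsProbabilityMeasure (P.map (X p)) :=
    fun p => Measure.isProbabilityMeasure_map (hX p).aemeasurable
  have h1 := (iIndepFun_iff_map_fun_eq_infinitePi_map hX).1 h
  rw [iIndepFun_iff_map_fun_eq_infinitePi_map (fun i => measurable_pi_lambda _ fun j => hX (i, j))]
  have h2 : ∀ i, P.map (fun ω j => X (i, j) ω) =
      Measure.infinitePi fun j => P.map (X (i, j)) := fun i =>
    (iIndepFun_iff_map_fun_eq_infinitePi_map fun j => hX (i, j)).1
      (h.precomp (Prod.mk_right_injective i))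
  simp_rw [h2]
  rw [← Measure.infinitePi_map_curry (μ := fun i j => P.map (X (i, j)))]
  have h3 : (fun ω i j => X (i, j) ω) =
      (MeasurableEquiv.curry ι κ E) ∘ fun ω p => X p ω := rfl
  rw [h3, ← Measure.map_map (MeasurableEquiv.measurable _) (measurable_pi_lambda _ hX), h1]

/-- Number of pairs of distinct indices. -/
lemma card_pairs (M : ℕ) :
    ((Finset.univ.filter fun p : Fin M × Fin M => p.1 < p.2).card : ℝ) = M * (M - 1) / 2 := by
  have h1 : (Finset.univ.filter fun p : Fin M × Fin M => p.1 < p.2).card = ∑ j : Fin M, (j : ℕ) := by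
    rw [Finset.card_filter, ← Finset.univ_product_univ, Finset.sum_product_right]
    refine Finset.sum_congr rfl fun j _ => ?_
    rw [← Finset.card_filter]
    have : (Finset.univ.filter fun i : Fin M => i < j) = Finset.Iio j := by ext; simp
    rw [this, Fin.card_Iio]
  have h2 : (∑ j : Fin M, (j : ℕ)) * 2 = M * (M - 1) := by
    rw [Fin.sum_univ_eq_sum_range (fun j => j), Finset.sum_range_id_mul_two]
  rw [h1]
  rcases Nat.eq_zero_or_pos M with h | h
  · subst h; simp
  · have h3 : (((∑ j : Fin M, (j : ℕ)) * 2 : ℕ) : ℝ) = ((M * (M - 1) : ℕ) : ℝ) := by rw [h2]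
    rw [Nat.cast_mul, Nat.cast_mul, Nat.cast_sub h] at h3
    push_cast at h3 ⊢
    linarith

/-- Evenness matters: for odd `B` the integer division would leave only `B` points. -/
lemma card_window {B : ℕ} (hB : Even B) : (window B).card = B + 1 := by
  obtain ⟨c, rfl⟩ := hB
  rw [window, Int.card_Icc]
  omega

section Grid

/-- Fourier transform of the innovations of series `m` at the Fourier frequency with index `q`. -/
def gridVar (y : ℕ → ℤ → Ω → ℂ) (P : Measure Ω) (N : ℕ) (m : ℕ) (q : ℤ) (ω : Ω) : ℂ :=
  finFourier N (fun n => normInnovation (y m) P n ω) ((q : ℝ) / N)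

omit [IsProbabilityMeasure P] in
lemma measurable_gridVar (y : ℕ → ℤ → Ω → ℂ) (N : ℕ) (m : ℕ) (q : ℤ) :
    Measurable (gridVar y P N m q) := by
  unfold gridVar finFourier
  refine Measurable.const_mul (Finset.measurable_fun_sum _ fun n _ => Measurable.mul_const ?_ _) _
  exact (Lp.stronglyMeasurable _).measurable

/-- The Fourier transforms over the window centred at the frequency with index `f`. -/
def blockVar (y : ℕ → ℤ → Ω → ℂ) (P : Measure Ω) (N B M : ℕ) (f : ℤ) (m : Fin M) (ω : Ω)
    (b : window B) : ℂ := gridVar y P N m (f + b) ω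

omit [IsProbabilityMeasure P] in
lemma measurable_blockVar (y : ℕ → ℤ → Ω → ℂ) (N B M : ℕ) (f : ℤ) (m : Fin M) :
    Measurable (blockVar y P N B M f m) :=
  measurable_pi_lambda _ fun _ => measurable_gridVar y N _ _

variable {y : ℕ → ℤ → Ω → ℂ} (hmeas : ∀ m n, Measurable (y m n))
  (hindep : iIndepFun (fun (m : ℕ) (ω : Ω) (n : ℤ) => y m n ω) P)
  (hgauss : ∀ m, IsComplexGaussianSeries (y m) P)
  (ho : ∀ m, Orthonormal ℂ (normInnovation (y m) P)) {N : ℕ} (hN : 0 < N) (B M : ℕ)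

include hmeas hindep hgauss ho hN

/-- Independence of the windows when all their frequencies are distinct modulo the sample size. -/
lemma iIndepFun_windows {κ : Type*} [Fintype κ] (f : κ → ℤ)
    (hf : ∀ k k', ∀ b ∈ window B, ∀ b' ∈ window B, (N : ℤ) ∣ (f k' + b') - (f k + b) →
      k = k' ∧ b = b') :
    iIndepFun (fun k ω (m : Fin M) => blockVar y P N B M (f k) m ω) P ∧
    ∀ k, iIndepFun (blockVar y P N B M (f k)) P ∧
      ∀ m, P.map (blockVar y P N B M (f k) m) = stdCGaussVec (window B) := by
  obtain ⟨h1, h2⟩ := iIndepFun_finFourier hmeas hindep hgauss ho hN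
    (ι := (κ × Fin M) × window B) (fun p => p.1.2) (fun p => f p.1.1 + p.2) (by
      rintro ⟨⟨k, m⟩, b⟩ ⟨⟨k', m'⟩, b'⟩ hne hm hdvd
      obtain ⟨h1, h2⟩ := hf k k' b b.2 b' b'.2 hdvd
      exact hne (by
        simp only at hm
        rw [h1, Fin.ext hm, Subtype.ext h2]))
  have h3 : iIndepFun (fun p : κ × Fin M => blockVar y P N B M (f p.1) p.2) P :=
    iIndepFun_curry (X := fun p : (κ × Fin M) × window B => gridVar y P N p.1.2 (f p.1.1 + p.2))
      (fun p => measurable_gridVar y N p.1.2 (f p.1.1 + p.2)) h1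
  refine ⟨iIndepFun_curry (X := fun p : κ × Fin M => blockVar y P N B M (f p.1) p.2)
    (fun p => measurable_blockVar y N B M (f p.1) p.2) h3,
    fun k => ⟨?_, fun m => ?_⟩⟩
  · have h5 : iIndepFun (fun m : Fin M => blockVar y P N B M (f k) m) P :=
      iIndepFun.precomp (g := fun m : Fin M => (k, m)) (Prod.mk_right_injective k) h3
    exact h5
  have h5 : iIndepFun (fun b : window B => gridVar y P N m (f k + b)) P :=
    h1.precomp (Prod.mk_right_injective (k, m))
  have h6 := (iIndepFun_iff_map_fun_eq_pi_map
    fun b => (measurable_gridVar y N m (f k + (b : window B))).aemeasurable).1 h5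
  refine h6.trans ?_
  congr 1
  ext1 b
  exact h2 ((k, m), b)

end Grid

end SpectralCoherence

/-! ### Exceedances on the grid and bounds at a fixed sample size. -/

namespace SpectralCoherence

variable {Ω : Type*} [MeasurableSpace Ω] {P : Measure Ω} [IsProbabilityMeasure P]

/-- Pairs of distinct series. -/
abbrev pairs (M : ℕ) : Finset (Fin M × Fin M) := Finset.univ.filter fun p => p.1 < p.2

/-- Coefficients of the smoothed cross periodogram of the pair `p` at the frequency index `f`. -/
def crossCoeff (y : ℕ → ℤ → Ω → ℂ) (P : Measure Ω) (N B M : ℕ) (f : ℤ) (p : Fin M × Fin M)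
    (b : window B) : ℂ :=
  specFactor (y p.1) P (((f + b : ℤ) : ℝ) / N) * conj (specFactor (y p.2) P (((f + b : ℤ) : ℝ) / N))

/-- Exceedance of the level `x` by some pair at the frequency with index `f`. -/
def gridEvent (y : ℕ → ℤ → Ω → ℂ) (P : Measure Ω) (N B M : ℕ) (x : ℝ) (f : ℤ) : Set Ω :=
  ⋃ p ∈ pairs M, crossEvent (blockVar y P N B M f) (crossCoeff y P N B M f p) x p.1 p.2

section Bounds

variable {y : ℕ → ℤ → Ω → ℂ} (hmeas : ∀ m n, Measurable (y m n))
  (hindep : iIndepFun (fun (m : ℕ) (ω : Ω) (n : ℤ) => y m n ω) P)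
  (hgauss : ∀ m, IsComplexGaussianSeries (y m) P)
  (ho : ∀ m, Orthonormal ℂ (normInnovation (y m) P))
  (hfac : ∀ m ν, ‖specFactor (y m) P ν‖ ^ 2 = specDensity (y m) P ν)
  {κ S : ℝ} (hκ0 : 0 < κ) (hκ : ∀ m ν, κ ≤ specDensity (y m) P ν)
  (hS : ∀ m ν, specDensity (y m) P ν ≤ S)
  {N : ℕ} (hN : 0 < N) {B M : ℕ}

include hfac in
omit [IsProbabilityMeasure P] in
lemma norm_sq_crossCoeff (f : ℤ) (p : Fin M × Fin M) (b : window B) :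
    ‖crossCoeff y P N B M f p b‖ ^ 2 = specDensity (y p.1) P (((f + b : ℤ) : ℝ) / N) *
      specDensity (y p.2) P (((f + b : ℤ) : ℝ) / N) := by
  rw [crossCoeff, norm_mul, mul_pow, RCLike.norm_conj, hfac, hfac]

include hfac hκ0 hκ in
omit [IsProbabilityMeasure P] in
lemma sum_norm_sq_crossCoeff_ge (hB : Even B) (f : ℤ) (p : Fin M × Fin M) :
    (B + 1) * κ ^ 2 ≤ ∑ b, ‖crossCoeff y P N B M f p b‖ ^ 2 := by
  have h1 : ∀ b : window B, κ ^ 2 ≤ ‖crossCoeff y P N B M f p b‖ ^ 2 := fun b => by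
    rw [norm_sq_crossCoeff hfac, sq]
    exact mul_le_mul (hκ _ _) (hκ _ _) hκ0.le (hκ0.le.trans (hκ _ _))
  have h2 := Finset.card_nsmul_le_sum Finset.univ _ _ fun b (_ : b ∈ Finset.univ) => h1 b
  rw [Finset.card_univ, Fintype.card_coe, card_window hB, nsmul_eq_mul] at h2
  push_cast at h2
  exact h2

include hfac hκ0 hκ in
omit [IsProbabilityMeasure P] in
lemma sum_norm_sq_crossCoeff_pos (hB : Even B) (f : ℤ) (p : Fin M × Fin M) :
    0 < ∑ b, ‖crossCoeff y P N B M f p b‖ ^ 2 :=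
  lt_of_lt_of_le (by positivity) (sum_norm_sq_crossCoeff_ge hfac hκ0 hκ hB f p)

include hfac hκ0 hκ hS in
omit [IsProbabilityMeasure P] in
-- No frequency dominates its window: spectral densities lying between `κ` and `S` make every
-- relative weight `O(1/B)`. This is the parameter `m` of the tail bounds.
lemma norm_sq_crossCoeff_div_le (hB : Even B) (f : ℤ) (p : Fin M × Fin M) (b : window B) :
    ‖crossCoeff y P N B M f p b‖ ^ 2 / ∑ a, ‖crossCoeff y P N B M f p a‖ ^ 2 ≤
      S ^ 2 / κ ^ 2 / (B + 1) := by
  rw [div_div]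
  refine div_le_div₀ (by positivity) ?_ (by positivity) ?_
  · rw [norm_sq_crossCoeff hfac, sq S]
    exact mul_le_mul (hS _ _) (hS _ _) (hκ0.le.trans (hκ _ _))
      (hκ0.le.trans ((hκ 0 0).trans (hS 0 0)))
  · rw [mul_comm]
    exact sum_norm_sq_crossCoeff_ge hfac hκ0 hκ hB f p

omit [IsProbabilityMeasure P] in
lemma measurableSet_gridEvent (N B M : ℕ) (x : ℝ) (f : ℤ) :
    MeasurableSet (gridEvent y P N B M x f) :=
  Finset.measurableSet_biUnion _ fun _ _ =>
    measurableSet_crossEvent (fun m => measurable_blockVar y N B M f m) _ _ _ _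

omit [IsProbabilityMeasure P] in
lemma window_sub_bound {b b' : ℤ} (hb : b ∈ window B) (hb' : b' ∈ window B) :
    |b' - b| ≤ B := by
  rw [window, Finset.mem_Icc] at hb hb'
  rw [abs_le]; omega

include hmeas hindep hgauss ho hN in
lemma block_law (hBN : B + 1 ≤ N) (f : ℤ) : iIndepFun (blockVar y P N B M f) P ∧
      ∀ m, P.map (blockVar y P N B M f m) = stdCGaussVec (window B) := by
  refine (iIndepFun_windows hmeas hindep hgauss ho hN B M (fun _ : Unit => f) ?_).2 ()
  intro _ _ b hb b' hb' hdvd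
  refine ⟨rfl, ?_⟩
  have h1 := window_sub_bound hb hb'
  have h2 : f + b' - (f + b) = b' - b := by ring
  rw [h2] at hdvd
  have h3 := Int.eq_zero_of_abs_lt_dvd hdvd (by omega)
  omega

variable {x : ℝ}

include hmeas hindep hgauss ho hfac hκ0 hκ hS hN

lemma measureReal_gridEvent_le (hB : Even B) (hBN : B + 1 ≤ N) (hx : 2 ≤ x)
    (hxm : x * (S ^ 2 / κ ^ 2 / (B + 1)) ≤ 1 / 4) (f : ℤ) :
    P.real (gridEvent y P N B M x f) ≤
      (M * (M - 1) / 2 : ℝ) * Real.exp (-x + x ^ 2 * (S ^ 2 / κ ^ 2 / (B + 1))) := by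
  obtain ⟨h1, h2⟩ := block_law (M := M) hmeas hindep hgauss ho hN hBN f
  rw [← card_pairs]
  exact measureReal_biUnion_crossEvent_le (fun m => measurable_blockVar y N B M f m) h1 h2 _ _
    (fun p hp => (Finset.mem_filter.1 hp).2)
    (fun p _ => sum_norm_sq_crossCoeff_pos hfac hκ0 hκ hB f p)
    (fun p _ b => norm_sq_crossCoeff_div_le hfac hκ0 hκ hS hB f p b) (by linarith) hxm

lemma le_measureReal_gridEvent (hB : Even B) (hBN : B + 1 ≤ N) (hx : 2 ≤ x)
    (hxm : x * (S ^ 2 / κ ^ 2 / (B + 1)) ≤ 1 / 4) (f : ℤ) :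
    (M * (M - 1) / 2 : ℝ) * (Real.exp (-x) * (1 - 2 * x * (S ^ 2 / κ ^ 2 / (B + 1)))) -
      (M * (M - 1) / 2 : ℝ) ^ 2 * Real.exp (-2 * x + 4 * x ^ 2 * (S ^ 2 / κ ^ 2 / (B + 1))) ≤
    P.real (gridEvent y P N B M x f) := by
  obtain ⟨h1, h2⟩ := block_law (M := M) hmeas hindep hgauss ho hN hBN f
  rw [← card_pairs]
  exact le_measureReal_biUnion_crossEvent (fun m => measurable_blockVar y N B M f m) h1 h2
    (by positivity) _ _ (fun p hp => (Finset.mem_filter.1 hp).2)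
    (fun p _ => sum_norm_sq_crossCoeff_pos hfac hκ0 hκ hB f p)
    (fun p _ b => norm_sq_crossCoeff_div_le hfac hκ0 hκ hS hB f p b) hx hxm

omit hfac hκ0 hκ hS in
/-- Independence across the grid. -/
lemma measureReal_iInter_gridEvent_compl (hB : Even B) {K : ℕ} (hK : K * (B + 1) ≤ N) :
    P.real (⋂ k : Fin K, (gridEvent y P N B M x ((k : ℕ) * (B + 1) : ℤ))ᶜ) =
      ∏ k : Fin K, (1 - P.real (gridEvent y P N B M x ((k : ℕ) * (B + 1) : ℤ))) := by
  have hind := (iIndepFun_windows hmeas hindep hgauss ho hN B M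
    (fun k : Fin K => ((k : ℕ) * (B + 1) : ℤ)) (by
      intro k k' b hb b' hb' hdvd
      obtain ⟨c, hc⟩ := hB
      rw [window, Finset.mem_Icc] at hb hb'
      have hk := k.2
      have hk' := k'.2
      have hKN : ((K : ℤ)) * (B + 1) ≤ N := by exact_mod_cast hK
      have h1 : ((k : ℕ) : ℤ) + 1 ≤ K := by omega
      have h1' : ((k' : ℕ) : ℤ) + 1 ≤ K := by omega
      have h2 := mul_le_mul_of_nonneg_right h1 (by positivity : (0 : ℤ) ≤ (B : ℤ) + 1)
      have h2' := mul_le_mul_of_nonneg_right h1' (by positivity : (0 : ℤ) ≤ (B : ℤ) + 1)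
      have h3 : (0 : ℤ) ≤ (k : ℕ) * ((B : ℤ) + 1) := by positivity
      have h3' : (0 : ℤ) ≤ (k' : ℕ) * ((B : ℤ) + 1) := by positivity
      have hbb : b' - b ≤ B := by omega
      have hbb' : -(B : ℤ) ≤ b' - b := by omega
      rw [add_mul, one_mul] at h2 h2'
      -- Two centres with `k, k' < K` differ by at most `N - (B + 1)` and offsets by at most `B`, so
      -- a multiple of `N` must be 0. The centres then differ by a multiple of `B + 1` of size at
      -- most `B`, hence coincide.
      have h4 := Int.eq_zero_of_abs_lt_dvd hdvd (by
        rw [abs_lt]; constructor <;> linarith)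
      have h5 : (((k' : ℕ) : ℤ) - (k : ℕ)) * (B + 1) = b - b' := by linarith
      have h6 : |b - b'| < B + 1 := by rw [abs_lt]; omega
      have h7 : b - b' = 0 := Int.eq_zero_of_abs_lt_dvd ⟨((k' : ℕ) : ℤ) - (k : ℕ), by
        rw [← h5, mul_comm]⟩ h6
      rw [h7] at h5
      have h8 : ((k' : ℕ) : ℤ) - (k : ℕ) = 0 := by
        rcases mul_eq_zero.1 h5 with h | h
        · exact h
        · omega
      exact ⟨Fin.ext (by omega), by omega⟩)).1
  have hset : ∀ k : Fin K, MeasurableSet[MeasurableSpace.comap (fun ω (m : Fin M) =>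
      blockVar y P N B M ((k : ℕ) * (B + 1) : ℤ) m ω) inferInstance]
      (gridEvent y P N B M x ((k : ℕ) * (B + 1) : ℤ))ᶜ := by
    intro k
    refine MeasurableSet.compl ⟨⋃ p ∈ pairs M, crossEvent (fun m (w : Fin M → window B → ℂ) => w m)
      (crossCoeff y P N B M ((k : ℕ) * (B + 1) : ℤ) p) x p.1 p.2,
      Finset.measurableSet_biUnion _ fun p _ => measurableSet_crossEvent
        (fun m => measurable_pi_apply m) _ _ _ _, ?_⟩
    simp only [Set.preimage_iUnion]
    rfl
  have h := hind.meas_iInter hset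
  rw [measureReal_def, h, ENNReal.toReal_prod]
  refine Finset.prod_congr rfl fun k _ => ?_
  rw [← measureReal_def, probReal_compl_eq_one_sub (measurableSet_gridEvent N B M x _)]

omit hmeas hindep hgauss ho hS hN [IsProbabilityMeasure P] in
-- Since squared moduli of the factors are spectral densities, `(B+1) σ²` is exactly the sum of the
-- squared coefficients, and all powers of `B+1` cancel.
lemma stat_le_iff (hB : Even B) (f : ℤ) (p : Fin M × Fin M) (ω : Ω) :
    ((B : ℝ) + 1) * ‖sTilde (y p.1) (y p.2) P N B ((f : ℝ) / N) ω‖ ^ 2 /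
        sigmaSq (y p.1) (y p.2) P N B ((f : ℝ) / N) ≤ x ↔
      ω ∉ crossEvent (blockVar y P N B M f) (crossCoeff y P N B M f p) x p.1 p.2 := by
  have hfreq : ∀ b : ℤ, (f : ℝ) / N + b / N = ((f + b : ℤ) : ℝ) / N := fun b => by
    push_cast; ring
  have hB1 : (0 : ℝ) < (B : ℝ) + 1 := by positivity
  have hs : sTilde (y p.1) (y p.2) P N B ((f : ℝ) / N) ω = ((B : ℂ) + 1)⁻¹ *
      ∑ b, crossCoeff y P N B M f p b * blockVar y P N B M f p.1 ω b *
        conj (blockVar y P N B M f p.2 ω b) := by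
    rw [sTilde, ← Finset.sum_coe_sort]
    simp only [hfreq]
    rfl
  have hσ : sigmaSq (y p.1) (y p.2) P N B ((f : ℝ) / N) = ((B : ℝ) + 1)⁻¹ *
      ∑ b, ‖crossCoeff y P N B M f p b‖ ^ 2 := by
    rw [sigmaSq, ← Finset.sum_coe_sort]
    simp only [hfreq, norm_sq_crossCoeff hfac]
  have hpos := sum_norm_sq_crossCoeff_pos (N := N) hfac hκ0 hκ hB f p
  have hn : ‖((B : ℂ) + 1)⁻¹‖ = ((B : ℝ) + 1)⁻¹ := by
    rw [norm_inv]
    congr 1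
    exact_mod_cast Complex.norm_natCast (B + 1)
  rw [hs, hσ, norm_mul, hn, crossEvent, Set.mem_ofPred_eq, not_lt, div_le_iff₀ (by positivity)]
  field_simp

omit hmeas hindep hgauss ho hS [IsProbabilityMeasure P] in
/-- The maximum stays below the level if and only if no grid event occurs. -/
lemma setOf_maxStat_le (hB : Even B) (hM : 2 ≤ M) :
    {ω | maxStat y P N M B ω ≤ x} =
      ⋂ k : Fin (N / (B + 1) + 1), (gridEvent y P N B M x ((k : ℕ) * (B + 1) : ℤ))ᶜ := by
  have hgrid : ∀ k : ℕ, (k : ℝ) ≤ (N : ℝ) / ((B : ℝ) + 1) ↔ k < N / (B + 1) + 1 := by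
    intro k
    rw [Nat.lt_succ_iff, Nat.le_div_iff_mul_le (Nat.succ_pos B), le_div_iff₀ (by positivity)]
    exact_mod_cast Iff.rfl
  have hfreq : ∀ k : ℕ, (k : ℝ) * (((B : ℝ) + 1) / N) = (((k * (B + 1) : ℤ)) : ℝ) / N := by
    intro k
    push_cast; ring
  have hfin : (indexSet N M B).Finite := by
    refine (Set.finite_range fun q : (Fin M × Fin M) × Fin (N / (B + 1) + 1) =>
      ((q.1.1 : ℕ), (q.1.2 : ℕ), ((q.2 : ℕ) : ℝ) * (((B : ℝ) + 1) / N))).subset ?_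
    rintro ⟨i, j, ν⟩ ⟨hij, hj, k, hk, rfl⟩
    simp only at hij hj
    exact ⟨((⟨i, hij.trans hj⟩, ⟨j, hj⟩), ⟨k, (hgrid k).1 hk⟩), rfl⟩
  have : Finite (indexSet N M B) := hfin
  -- Finiteness and nonemptiness make the real supremum a genuine maximum rather than a default
  -- value; `M ≥ 2` supplies the pair `(0, 1)` at frequency 0.
  have : Nonempty (indexSet N M B) :=
    ⟨⟨(0, 1, 0), Nat.zero_lt_one, by change 1 < M; omega, 0, by simpa using by positivity, by simp⟩⟩
  ext ω
  simp only [Set.mem_ofPred_eq, maxStat, ciSup_le_iff (Set.finite_range _).bddAbove,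
    Set.mem_iInter, Set.mem_compl_iff, gridEvent, Set.mem_iUnion, not_exists]
  constructor
  · intro h k p hp
    have h1 := h ⟨(p.1, p.2, ((k : ℕ) : ℝ) * (((B : ℝ) + 1) / N)), (Finset.mem_filter.1 hp).2,
      p.2.2, k, (hgrid k).2 k.2, rfl⟩
    simp only [hfreq] at h1
    exact (stat_le_iff hfac hκ0 hκ hB _ p ω).1 h1
  · rintro h ⟨⟨i, j, ν⟩, hij, hj, k, hk, hν⟩
    simp only at hij hj
    have h1 := (stat_le_iff (x := x) hfac hκ0 hκ hB _ (⟨i, hij.trans hj⟩, ⟨j, hj⟩) ω).2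
      (h ⟨k, (hgrid k).1 hk⟩ (⟨i, hij.trans hj⟩, ⟨j, hj⟩)
        (Finset.mem_filter.2 ⟨Finset.mem_univ _, hij⟩))
    rw [← hfreq] at h1
    simp only at hν ⊢
    rw [hν]
    exact h1

/-- Bounds on the distribution of the maximum at a fixed sample size. -/
theorem measureReal_maxStat_bounds (hB : Even B) (hM : 2 ≤ M) (hBN : B + 1 ≤ N) (hx : 2 ≤ x)
    (hxm : x * (S ^ 2 / κ ^ 2 / (B + 1)) ≤ 1 / 4) {u l : ℝ}
    (hu : (M * (M - 1) / 2 : ℝ) * Real.exp (-x + x ^ 2 * (S ^ 2 / κ ^ 2 / (B + 1))) ≤ u)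
    (hu2 : u ≤ 1 / 2)
    (hl : l ≤ (M * (M - 1) / 2 : ℝ) * (Real.exp (-x) * (1 - 2 * x * (S ^ 2 / κ ^ 2 / (B + 1)))) -
      (M * (M - 1) / 2 : ℝ) ^ 2 * Real.exp (-2 * x + 4 * x ^ 2 * (S ^ 2 / κ ^ 2 / (B + 1)))) :
    Real.exp (-((N / (B + 1) : ℕ) * (u + u ^ 2))) - u ≤ P.real {ω | maxStat y P N M B ω ≤ x} ∧
      P.real {ω | maxStat y P N M B ω ≤ x} ≤ Real.exp (-((N / (B + 1) : ℕ) * l)) := by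
  set K := N / (B + 1) with hK
  have hKN : K * (B + 1) ≤ N := Nat.div_mul_le_self N (B + 1)
  set E : ℕ → Set Ω := fun k => gridEvent y P N B M x ((k : ℕ) * (B + 1) : ℤ) with hE
  have hEu : ∀ k, P.real (E k) ≤ u := fun k =>
    (measureReal_gridEvent_le hmeas hindep hgauss ho hfac hκ0 hκ hS hN hB hBN hx hxm _).trans hu
  have hEl : ∀ k, l ≤ P.real (E k) := fun k => hl.trans
    (le_measureReal_gridEvent hmeas hindep hgauss ho hfac hκ0 hκ hS hN hB hBN hx hxm _)
  have hE0 : ∀ k, 0 ≤ P.real (E k) := fun k => measureReal_nonneg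
  have hEm : ∀ k, MeasurableSet (E k) := fun k => measurableSet_gridEvent N B M x _
  have hprod : P.real (⋂ k : Fin K, (E k)ᶜ) = ∏ k : Fin K, (1 - P.real (E k)) :=
    measureReal_iInter_gridEvent_compl hmeas hindep hgauss ho hN hB hKN
  have hset := setOf_maxStat_le (x := x) hfac hκ0 hκ hN hB hM
  -- The grid has `K + 1` points, and the window of the last one may meet that of frequency 0 modulo
  -- `N`. It is left out of the independent product: free for the upper bound, at cost `u` for the
  -- lower one.
  have hset2 : {ω | maxStat y P N M B ω ≤ x} = (⋂ k : Fin K, (E k)ᶜ) \ E K := by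
    rw [hset]
    ext ω
    simp only [Set.mem_iInter, Set.mem_sdiff, Set.mem_compl_iff]
    rw [Fin.forall_fin_succ']
    rfl
  rw [hset2]
  constructor
  · have h1 : P.real (⋂ k : Fin K, (E k)ᶜ) - P.real (E K) ≤ P.real ((⋂ k : Fin K, (E k)ᶜ) \ E K) :=
      le_measureReal_sdiff
    have h2 : Real.exp (-(K * (u + u ^ 2))) ≤ P.real (⋂ k : Fin K, (E k)ᶜ) := by
      rw [hprod]
      have h3 : ∀ k : Fin K, Real.exp (-(u + u ^ 2)) ≤ 1 - P.real (E k) := by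
        intro k
        have hu0 : 0 ≤ u := (hE0 k).trans (hEu k)
        have h4 := inv_one_sub_le_exp hu0 hu2
        have h5 : 1 - u ≤ 1 - P.real (E k) := by linarith [hEu k]
        refine le_trans ?_ h5
        rw [Real.exp_neg]
        exact inv_le_of_inv_le₀ (by linarith) h4
      calc Real.exp (-(K * (u + u ^ 2))) = ∏ k : Fin K, Real.exp (-(u + u ^ 2)) := by
            rw [Finset.prod_const, Finset.card_univ, Fintype.card_fin, ← Real.exp_nat_mul]
            congr 1; ring
        _ ≤ _ := Finset.prod_le_prod (fun _ _ => (Real.exp_pos _).le) fun k _ => h3 k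
    linarith [hEu K]
  · refine (measureReal_mono Set.sdiff_subset).trans ?_
    rw [hprod]
    calc ∏ k : Fin K, (1 - P.real (E k)) ≤ ∏ k : Fin K, Real.exp (-l) := by
          refine Finset.prod_le_prod (fun k _ => ?_) fun k _ => ?_
          · linarith [hEu k]
          · have := Real.add_one_le_exp (-P.real (E k))
            have h2 := Real.exp_le_exp.2 (neg_le_neg (hEl k))
            linarith
      _ = _ := by
          rw [Finset.prod_const, Finset.card_univ, Fintype.card_fin, ← Real.exp_nat_mul]
          congr 1; ring

end Bounds

end SpectralCoherence

/-! ### Growth rates and limits of the bounds. -/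

namespace SpectralCoherence

section Rates

variable {M B : ℕ → ℕ} {C₁ C₂ ρ : ℝ}

lemma tendsto_natCast_rpow {s : ℝ} (hs : 0 < s) :
    Tendsto (fun N : ℕ => (N : ℝ) ^ s) atTop atTop :=
  (tendsto_rpow_atTop hs).comp tendsto_natCast_atTop_atTop

lemma tendsto_natCast_of_rate {f : ℕ → ℕ} (h1 : 0 < C₁) (hρ : 0 < ρ)
    (h : ∀ᶠ N : ℕ in atTop, C₁ * (N : ℝ) ^ ρ ≤ f N) :
    Tendsto (fun N => (f N : ℝ)) atTop atTop :=
  tendsto_atTop_mono' _ h ((tendsto_natCast_rpow hρ).const_mul_atTop h1)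

lemma tendsto_add_one_div_of_rate {f : ℕ → ℕ} (hρ1 : ρ < 1)
    (h : ∀ᶠ N : ℕ in atTop, (f N : ℝ) ≤ C₂ * (N : ℝ) ^ ρ) :
    Tendsto (fun N : ℕ => ((f N : ℝ) + 1) / N) atTop (𝓝 0) := by
  have h1 : Tendsto (fun N : ℕ => C₂ * ((N : ℝ) ^ (1 - ρ))⁻¹ + 1 / (N : ℝ)) atTop (𝓝 0) := by
    have := ((tendsto_natCast_rpow (sub_pos.2 hρ1)).inv_tendsto_atTop.const_mul C₂).add
      tendsto_one_div_atTop_nhds_zero_nat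
    simpa using this
  refine squeeze_zero' (Eventually.of_forall fun N => by positivity) ?_ h1
  filter_upwards [h, eventually_gt_atTop 0] with N hN hN0
  have hN' : (0 : ℝ) < N := by exact_mod_cast hN0
  have h2 : C₂ * ((N : ℝ) ^ (1 - ρ))⁻¹ = C₂ * (N : ℝ) ^ ρ / N := by
    rw [Real.rpow_sub hN', Real.rpow_one]
    field_simp
  rw [h2, add_div]
  gcongr

/-- Rounding `N / b` down loses at most `b / N` in the product, so counting only complete windows is
harmless. -/
lemma tendsto_natDiv_mul_div {b : ℕ → ℕ} (hb : ∀ N, 0 < b N)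
    (h : Tendsto (fun N : ℕ => (b N : ℝ) / N) atTop (𝓝 0)) :
    Tendsto (fun N : ℕ => ((N / b N : ℕ) : ℝ) * ((b N : ℝ) / N)) atTop (𝓝 1) := by
  have h1 : Tendsto (fun N : ℕ => 1 - (b N : ℝ) / N) atTop (𝓝 1) := by
    simpa using h.const_sub 1
  refine tendsto_of_tendsto_of_tendsto_of_le_of_le' h1 tendsto_const_nhds ?_ ?_
  · filter_upwards [eventually_gt_atTop 0] with N hN
    have hN' : (0 : ℝ) < N := by exact_mod_cast hN
    have h2 : N < (N / b N + 1) * b N := by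
      rw [add_mul, one_mul]
      exact Nat.lt_div_mul_add (hb N)
    have h3 : (N : ℝ) ≤ ((N / b N : ℕ) + 1) * b N := by exact_mod_cast h2.le
    rw [← mul_div_assoc, ← sub_nonneg]
    have h4 : ((N / b N : ℕ) : ℝ) * b N / N - (1 - (b N : ℝ) / N) =
        (((N / b N : ℕ) + 1) * b N - N) / N := by
      field_simp
      ring
    rw [h4]
    exact div_nonneg (sub_nonneg.2 h3) hN'.le
  · refine Eventually.of_forall fun N => ?_
    rw [← mul_div_assoc]
    refine div_le_one_of_le₀ ?_ N.cast_nonneg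
    exact_mod_cast Nat.div_mul_le_self N (b N)

/-- The level at which the maximum is centred. -/
def level (M B : ℕ → ℕ) (t : ℝ) (N : ℕ) : ℝ :=
  t + Real.log ((N : ℝ) / ((B N : ℝ) + 1)) + Real.log ((M N : ℝ) * ((M N : ℝ) - 1) / 2)

/-- The reason for the centring: to first order a window has `e^{-t}(B+1)/N` expected exceedances,
so about `N/(B+1)` windows have `e^{-t}` in total. -/
lemma pairs_mul_exp_neg_level (t : ℝ) {N : ℕ} (hN : 0 < N) (hM : 2 ≤ M N) :
    ((M N : ℝ) * (M N - 1) / 2) * Real.exp (-level M B t N) =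
      Real.exp (-t) * (((B N : ℝ) + 1) / N) := by
  have hM' : (2 : ℝ) ≤ M N := by exact_mod_cast hM
  have hN' : (0 : ℝ) < N := by exact_mod_cast hN
  have hL : 0 < (M N : ℝ) * (M N - 1) / 2 := by
    have : (0 : ℝ) < M N - 1 := by linarith
    positivity
  rw [level, neg_add, neg_add, Real.exp_add, Real.exp_add, Real.exp_neg (Real.log _),
    Real.exp_neg (Real.log _), Real.exp_log hL, Real.exp_log (by positivity)]
  rw [mul_comm, mul_assoc, inv_mul_cancel₀ hL.ne', mul_one, inv_div]

lemma tendsto_level (t : ℝ) (h : Tendsto (fun N : ℕ => ((B N : ℝ) + 1) / N) atTop (𝓝 0))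
    (hM : ∀ᶠ N in atTop, 2 ≤ M N) : Tendsto (level M B t) atTop atTop := by
  have h1 : Tendsto (fun N : ℕ => (N : ℝ) / ((B N : ℝ) + 1)) atTop atTop := by
    have h2 : Tendsto (fun N : ℕ => ((B N : ℝ) + 1) / N) atTop (𝓝[>] 0) := by
      refine tendsto_nhdsWithin_iff.2 ⟨h, ?_⟩
      filter_upwards [eventually_gt_atTop 0] with N hN
      have hN' : (0 : ℝ) < N := by exact_mod_cast hN
      exact Set.mem_Ioi.2 (by positivity)
    refine h2.inv_tendsto_nhdsGT_zero.congr fun N => ?_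
    simp
  refine tendsto_atTop_mono' _ ?_
    (tendsto_atTop_add_const_left _ t (Real.tendsto_log_atTop.comp h1))
  filter_upwards [hM] with N hMN
  have hM' : (2 : ℝ) ≤ M N := by exact_mod_cast hMN
  have h3 : 0 ≤ Real.log ((M N : ℝ) * ((M N : ℝ) - 1) / 2) := Real.log_nonneg (by nlinarith)
  simp only [Function.comp_apply, level]
  linarith

lemma level_le (t : ℝ) (h2 : 0 < C₂) (hρ1 : ρ < 1) {N : ℕ} (hN : 0 < N) (hM : 2 ≤ M N)
    (hMN : (M N : ℝ) ≤ C₂ * (N : ℝ) ^ ρ) :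
    level M B t N ≤ (t + 2 * Real.log C₂) + 3 * Real.log N := by
  have hM' : (2 : ℝ) ≤ M N := by exact_mod_cast hM
  have hN' : (1 : ℝ) ≤ N := by exact_mod_cast hN
  have hN0 : (0 : ℝ) < N := by linarith
  have h3 : Real.log ((N : ℝ) / ((B N : ℝ) + 1)) ≤ Real.log N := by
    refine Real.log_le_log (by positivity) (div_le_self hN0.le ?_)
    have : (0 : ℝ) ≤ B N := Nat.cast_nonneg _
    linarith
  have h4 : (M N : ℝ) ≤ C₂ * N := hMN.trans (by
    have := Real.rpow_le_rpow_of_exponent_le hN' hρ1.le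
    rw [Real.rpow_one] at this
    gcongr)
  have h5 : Real.log ((M N : ℝ) * ((M N : ℝ) - 1) / 2) ≤ Real.log ((C₂ * N) ^ 2) :=
    Real.log_le_log (by nlinarith) (by nlinarith)
  rw [Real.log_pow, Real.log_mul h2.ne' hN0.ne'] at h5
  push_cast at h5
  rw [level]
  linarith

/-- The level is `O(log N)` while `B` is at least of order `N^ρ`; the exponent `ρ/2` appears because
the ratio is bounded before squaring. This makes all the relative errors in the tail bounds vanish.
-/
lemma tendsto_level_sq_div (t : ℝ) (h1 : 0 < C₁) (h2 : 0 < C₂) (hρ : 0 < ρ) (hρ1 : ρ < 1)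
    (hB : ∀ᶠ N : ℕ in atTop, C₁ * (N : ℝ) ^ ρ ≤ B N)
    (hMC : ∀ᶠ N : ℕ in atTop, (M N : ℝ) ≤ C₂ * (N : ℝ) ^ ρ)
    (hM : ∀ᶠ N in atTop, 2 ≤ M N) (hx : ∀ᶠ N in atTop, 0 ≤ level M B t N) :
    Tendsto (fun N => level M B t N ^ 2 / ((B N : ℝ) + 1)) atTop (𝓝 0) := by
  have hρ2 : 0 < ρ / 2 := by positivity
  set A := t + 2 * Real.log C₂
  have h3 : Tendsto (fun N : ℕ => (A + 3 * Real.log N) / (N : ℝ) ^ (ρ / 2)) atTop (𝓝 0) := by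
    have h4 : Tendsto (fun N : ℕ => Real.log N / (N : ℝ) ^ (ρ / 2)) atTop (𝓝 0) :=
      (isLittleO_log_rpow_atTop hρ2).tendsto_div_nhds_zero.comp tendsto_natCast_atTop_atTop
    have h5 := ((tendsto_natCast_rpow hρ2).inv_tendsto_atTop.const_mul A).add (h4.const_mul 3)
    simp only [mul_zero, add_zero] at h5
    refine h5.congr fun N => ?_
    simp only [Pi.inv_apply]
    ring
  have h6 : Tendsto (fun N : ℕ => ((A + 3 * Real.log N) / (N : ℝ) ^ (ρ / 2)) ^ 2 / C₁) atTop
      (𝓝 0) := by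
    simpa using (h3.pow 2).div_const C₁
  refine squeeze_zero' (Eventually.of_forall fun N => by positivity) ?_ h6
  filter_upwards [hB, hMC, hM, hx, eventually_gt_atTop 0] with N hBN hMN hM2 hxN hN
  have hN0 : (0 : ℝ) < N := by exact_mod_cast hN
  have h7 : ((N : ℝ) ^ (ρ / 2)) ^ 2 = (N : ℝ) ^ ρ := by
    rw [← Real.rpow_natCast, ← Real.rpow_mul hN0.le]
    congr 1; push_cast; ring
  rw [div_pow, h7, div_div]
  have h8 := level_le (B := B) t h2 hρ1 hN hM2 hMN
  have h9 : (N : ℝ) ^ ρ * C₁ ≤ (B N : ℝ) + 1 := by linarith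
  exact div_le_div₀ (by positivity) (pow_le_pow_left₀ hxN h8 2) (by positivity) h9

end Rates

/-- Limits of the bounds on the distribution of the maximum. -/
lemma tendsto_bounds {K a v w : ℕ → ℝ} {τ : ℝ} (hKa : Tendsto (fun N => K N * a N) atTop (𝓝 τ))
    (ha : Tendsto a atTop (𝓝 0)) (hv : Tendsto v atTop (𝓝 0)) (hw : Tendsto w atTop (𝓝 0)) :
    Tendsto (fun N => a N * Real.exp (v N)) atTop (𝓝 0) ∧
    Tendsto (fun N => Real.exp (-(K N * (a N * Real.exp (v N) + (a N * Real.exp (v N)) ^ 2))) -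
      a N * Real.exp (v N)) atTop (𝓝 (Real.exp (-τ))) ∧
    Tendsto (fun N => Real.exp (-(K N * (a N * (1 - 2 * w N) - a N ^ 2 * Real.exp (4 * v N)))))
      atTop (𝓝 (Real.exp (-τ))) := by
  have he : Tendsto (fun N => Real.exp (v N)) atTop (𝓝 1) := by
    have := (Real.continuous_exp.tendsto 0).comp hv
    rwa [Real.exp_zero] at this
  have he4 : Tendsto (fun N => Real.exp (4 * v N)) atTop (𝓝 1) := by
    have := (Real.continuous_exp.tendsto (4 * 0)).comp (hv.const_mul 4)
    rwa [mul_zero, Real.exp_zero] at this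
  have hu : Tendsto (fun N => a N * Real.exp (v N)) atTop (𝓝 0) := by simpa using ha.mul he
  have hKu : Tendsto (fun N => K N * a N * Real.exp (v N)) atTop (𝓝 τ) := by
    simpa using hKa.mul he
  refine ⟨hu, ?_, ?_⟩
  · have h1 : Tendsto (fun N => K N * (a N * Real.exp (v N) + (a N * Real.exp (v N)) ^ 2)) atTop
        (𝓝 τ) := by
      have := hKu.add (hKu.mul hu)
      rw [mul_zero, add_zero] at this
      exact this.congr fun N => by ring
    have := ((Real.continuous_exp.tendsto _).comp h1.neg).sub hu
    rw [sub_zero] at this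
    exact this
  · have h1 : Tendsto (fun N => K N * (a N * (1 - 2 * w N) - a N ^ 2 * Real.exp (4 * v N))) atTop
        (𝓝 τ) := by
      have := (hKa.mul ((hw.const_mul 2).const_sub 1)).sub ((hKa.mul ha).mul he4)
      rw [mul_zero, sub_zero, mul_one, mul_zero, zero_mul, sub_zero] at this
      exact this.congr fun N => by ring
    exact (Real.continuous_exp.tendsto _).comp h1.neg

lemma specDensity_le {Ω : Type*} [MeasurableSpace Ω] {x : ℤ → Ω → ℂ} {P : Measure Ω} {K : ℝ}
    (hsum : Summable fun u : ℤ => (1 + |(u : ℝ)|) * ‖autocov x P u‖)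
    (hK : ∑' u : ℤ, (1 + |(u : ℝ)|) * ‖autocov x P u‖ ≤ K) (ν : ℝ) :
    specDensity x P ν ≤ K := by
  have h1 := summable_norm_autocov hsum
  rw [specDensity_eq]
  refine (Complex.re_le_norm _).trans ((norm_fseries_le h1 ν).trans (le_trans ?_ hK))
  refine h1.tsum_le_tsum (fun u => ?_) hsum
  exact le_mul_of_one_le_left (norm_nonneg _) (by linarith [abs_nonneg (u : ℝ)])

/-- Windows near the ends of the grid leave `[0, 1]`; periodicity of the spectral density covers
them. -/
lemma le_specDensity {Ω : Type*} [MeasurableSpace Ω] {x : ℤ → Ω → ℂ} {P : Measure Ω} {κ : ℝ}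
    (hκ : ∀ ν ∈ Set.Icc (0 : ℝ) 1, κ ≤ specDensity x P ν) (ν : ℝ) :
    κ ≤ specDensity x P ν := by
  have h1 := hκ (Int.fract ν) ⟨Int.fract_nonneg ν, (Int.fract_lt_one ν).le⟩
  rwa [specDensity_eq, ← fseries_add_int (Int.fract ν) ⌊ν⌋, Int.fract_add_floor,
    ← specDensity_eq] at h1

end SpectralCoherence

end

/-! ### Assembly of the limit theorem. -/

theorem proposition1 {Ω : Type*} [MeasurableSpace Ω] (P : Measure Ω) [IsProbabilityMeasure P]
    (y : ℕ → ℤ → Ω → ℂ)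
    -- the time series: mutually independent, stationary, zero-mean complex Gaussian
    (hmeas : ∀ m n, Measurable (y m n))
    (hindep : iIndepFun (fun (m : ℕ) (ω : Ω) (n : ℤ) => y m n ω) P)
    (hstat : ∀ m, SpectralCoherence.IsStationary (y m) P)
    (hgauss : ∀ m, SpectralCoherence.IsComplexGaussianSeries (y m) P)
    -- uniform short memory
    (hmem : ∃ K : ℝ, ∀ m,
      Summable (fun u : ℤ => (1 + |(u : ℝ)|) * ‖SpectralCoherence.autocov (y m) P u‖) ∧
      ∑' u : ℤ, (1 + |(u : ℝ)|) * ‖SpectralCoherence.autocov (y m) P u‖ ≤ K)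
    -- spectral densities uniformly bounded away from zero
    (hspec : ∃ κ : ℝ, 0 < κ ∧
      ∀ m, ∀ ν ∈ Set.Icc (0 : ℝ) 1, κ ≤ SpectralCoherence.specDensity (y m) P ν)
    -- asymptotic regime
    (M B : ℕ → ℕ) (hBeven : ∀ N, Even (B N))
    (hrate : ∃ C₁ C₂ ρ : ℝ, 0 < C₁ ∧ 0 < C₂ ∧ 0 < ρ ∧ ρ < 1 ∧ ∀ᶠ N : ℕ in atTop,
      C₁ * (N : ℝ) ^ ρ ≤ B N ∧ (B N : ℝ) ≤ C₂ * (N : ℝ) ^ ρ ∧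
      C₁ * (N : ℝ) ^ ρ ≤ M N ∧ (M N : ℝ) ≤ C₂ * (N : ℝ) ^ ρ)
    (hratio : ∃ c : ℝ, 0 < c ∧ Tendsto (fun N => (M N : ℝ) / (B N : ℝ)) atTop (𝓝 c)) :
    ∀ t : ℝ, Tendsto
      (fun N : ℕ => P.real {ω | SpectralCoherence.maxStat y P N (M N) (B N) ω ≤
        t + Real.log ((N : ℝ) / ((B N : ℝ) + 1)) +
          Real.log ((M N : ℝ) * ((M N : ℝ) - 1) / 2)})
      atTop (𝓝 (Real.exp (-Real.exp (-t)))) := by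
  open SpectralCoherence in
  intro t
  obtain ⟨S, hS⟩ := hmem
  obtain ⟨κ, hκ0, hκ⟩ := hspec
  obtain ⟨C₁, C₂, ρ, hC1, hC2, hρ, hρ1, hrate⟩ := hrate
  have hfactor := fun m => normInnovation_spec (memLp_series hmeas hgauss m) (hstat m)
    (hS m).1 hκ0 (hκ m)
  have hM2 : ∀ᶠ N in atTop, 2 ≤ M N := by
    filter_upwards [(tendsto_natCast_of_rate hC1 hρ
      (hrate.mono fun N h => h.2.2.1)).eventually_ge_atTop 2] with N hN
    exact_mod_cast hN
  have hb : Tendsto (fun N : ℕ => ((B N : ℝ) + 1) / N) atTop (𝓝 0) :=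
    tendsto_add_one_div_of_rate hρ1 (hrate.mono fun N h => h.2.1)
  have hx := tendsto_level (M := M) t hb hM2
  set D : ℝ := S ^ 2 / κ ^ 2
  have hx2 : Tendsto (fun N => level M B t N ^ 2 * (D / (B N + 1))) atTop (𝓝 0) := by
    have h := (tendsto_level_sq_div t hC1 hC2 hρ hρ1 (hrate.mono fun N h => h.1)
      (hrate.mono fun N h => h.2.2.2) hM2 (hx.eventually_ge_atTop 0)).const_mul D
    rw [mul_zero] at h
    exact h.congr fun N => by ring
  -- The level is eventually at least 1, so its first power is dominated by its square.
  have hx1 : Tendsto (fun N => level M B t N * (D / (B N + 1))) atTop (𝓝 0) := by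
    refine squeeze_zero' ?_ ?_ hx2
    · filter_upwards [hx.eventually_ge_atTop 0] with N hN
      positivity
    · filter_upwards [hx.eventually_ge_atTop 1] with N hN
      gcongr
      nlinarith
  have ha : Tendsto (fun N : ℕ => Real.exp (-t) * (((B N : ℝ) + 1) / N)) atTop (𝓝 0) := by
    simpa using hb.const_mul (Real.exp (-t))
  have hKa : Tendsto (fun N : ℕ => ((N / (B N + 1) : ℕ) : ℝ) *
      (Real.exp (-t) * (((B N : ℝ) + 1) / N))) atTop (𝓝 (Real.exp (-t))) := by
    have h := (tendsto_natDiv_mul_div (b := fun N => B N + 1) (fun N => Nat.succ_pos _)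
      (by simpa using hb)).const_mul (Real.exp (-t))
    rw [mul_one] at h
    exact h.congr fun N => by push_cast; ring
  obtain ⟨hu, hlow, hupp⟩ := tendsto_bounds hKa ha hx2 hx1
  -- Both halves of the squeeze come from one fixed-sample-size statement, so they are proved as a
  -- single eventual conjunction.
  refine and_imp.2 (tendsto_of_tendsto_of_tendsto_of_le_of_le' hlow hupp) (eventually_and.1 ?_)
  filter_upwards [hM2, hx.eventually_ge_atTop 2,
    hx1.eventually_le_const (by norm_num : (0 : ℝ) < 1 / 4),
    hu.eventually_le_const (by norm_num : (0 : ℝ) < 1 / 2), hb.eventually_le_const one_pos,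
    eventually_gt_atTop 0] with N hM hxN hx1N huN hbN hN
  have hN' : (0 : ℝ) < N := by exact_mod_cast hN
  have hBN : B N + 1 ≤ N := by
    rw [div_le_one hN'] at hbN
    exact_mod_cast hbN
  have hL := pairs_mul_exp_neg_level (B := B) t hN hM
  exact measureReal_maxStat_bounds hmeas hindep hgauss (fun m => (hfactor m).1)
    (fun m => (hfactor m).2) hκ0 (fun m ν => le_specDensity (hκ m) ν)
    (fun m ν => specDensity_le (hS m).1 (hS m).2 ν) hN (hBeven N) hM hBN hxN hx1N
    (u := Real.exp (-t) * (((B N : ℝ) + 1) / N) * Real.exp (level M B t N ^ 2 * (D / (B N + 1))))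
    (l := Real.exp (-t) * (((B N : ℝ) + 1) / N) * (1 - 2 * (level M B t N * (D / (B N + 1)))) -
      (Real.exp (-t) * (((B N : ℝ) + 1) / N)) ^ 2 *
        Real.exp (4 * (level M B t N ^ 2 * (D / (B N + 1)))))
    (by rw [Real.exp_add, ← mul_assoc, hL]) huN
    (by
      have h1 : Real.exp (-2 * level M B t N + 4 * level M B t N ^ 2 * (D / (B N + 1))) =
          Real.exp (-level M B t N) ^ 2 *
            Real.exp (4 * (level M B t N ^ 2 * (D / (B N + 1)))) := by
        rw [← Real.exp_nat_mul, ← Real.exp_add]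
        congr 1; push_cast; ring
      rw [h1, ← hL]
      exact le_of_eq (by ring))
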